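/- Let $n=m+k$ with $m\ge 1$, $k\ge 0$, let $\mathbb T^d=\mathbb R^d/\mathbb Z^d$ with Lebesgue measure $\lambda$, and write points of $\mathbb T^n=\mathbb T^m\times\mathbb T^k$ as $z=(x,y)$. Let $\beta>0$ and $V\in C^2(\mathbb T^n)$, and put $\mathcal F=-\nabla V$, with first $m$ components $\mathcal F_1=-\nabla_xV$. For a density $p$ on $\mathbb T^n$ let $p^\xi(x)=\int_{\mathbb T^k}p(x,y)\,dy$ and $G_p(x)=-\int_{\mathbb T^k}\mathcal F_1(x,y)\frac{p(x,y)}{p^\xi(x)}\,dy$. The bias $B_p$ is $G_p$ in the ABF case, and in the PABF case it is the Helmholtz projection $\mathsf P_{L^2(\lambda)}(G_p)$, that is $\nabla g$ for the minimizer $g$ of $\int_{\mathbb T^m}|G_p-\nabla g|^2\,dx$ over $\{g\in H^1(\mathbb T^m):\int g=0\}$ (vector fields on $\mathbb T^m$ being taken up to null sets). A solution $(\pi_t,B_t)_{t\ge0}$ consists of probability densities $\pi_t$ on $\mathbb T^n$ and biases $B_t=B_{\pi_t}$, with $(t,z)\mapsto\pi_t(z)$ continuous on $[0,\infty)\times\mathbb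 T^n$ and $C^1$ in $z$ with gradient continuous on $(0,\infty)\times\mathbb T^n$, such that $$\partial_t\pi_t=\beta^{-1}\Delta\pi_t-\nabla\cdot(\mathcal F\pi_t)-\nabla_x\cdot(B_t\pi_t)$$ holds weakly: for every $\varphi\in C^\infty(\mathbb T^n)$ and $t>0$, $\frac{d}{dt}\int\varphi\pi_t=\int\bigl(-\beta^{-1}\nabla\varphi\cdot\nabla\pi_t+(\mathcal F\cdot\nabla\varphi+B_t\cdot\nabla_x\varphi)\pi_t\bigr)$. A stationary state is a solution that is constant in time. Let $A(x)=-\beta^{-1}\ln\int_{\mathbb T^k}e^{-\beta V(x,y)}\,dy$, let $\mu_A$ be the probability measure with density proportional to $e^{-\beta(V(x,y)-A(x))}$, and let $\mu_{A,x}(y)=\mu_A(x,y)/\mu_A^\xi(x)$. Let $\mathcal H(\mu|\nu)=\int\ln\frac{d\mu}{d\nu}\,d\mu$ if $\mu\ll\nu$, and $+\infty$ otherwise. A probability measure $\nu$ satisfies $LSI(\rho)$ if $\mathcal H(f\nu|\nu)\le\frac1{2\rho}\int|\nabla\ln f|^2f\,d\nu$ for all positive $C^1$ functions $f$ with $\int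 f\,d\nu=1$. Then, for both ABF and PABF: (i) There is $\rho>0$ such that $\mu_{A,x}$ satisfies $LSI(\rho)$ for all $x\in\mathbb T^m$. (ii) Let $\rho>0$ be any constant such that $\mu_{A,x}$ satisfies $LSI(\rho)$ for all $x\in\mathbb T^m$, and put $\Lambda=\min(8\pi^2,2\rho)\beta^{-1}$ in the ABF case and $\Lambda=\min(4\pi^2,2\rho)\beta^{-1}$ in the PABF case. For every solution $(\pi_t,B_t)$ such that $\pi_0$ is $C^\infty$ and $\pi_0^\xi>0$ everywhere, there is $K>0$ such that for all $\varepsilon>0$ and all $t\ge0$, $$\mathcal H(\pi_t|\mu_A)\le K\Bigl(1+\frac1{\varepsilon^2}\Bigr)e^{-(\Lambda-\varepsilon)t}.$$ (iii) $(\mu_A,\nabla A)$ is a stationary state, and it is the only one. -/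

import Mathlib

open MeasureTheory Set
open scoped ContDiff

noncomputable section

namespace ABF

/-! ### Calculus on the torus `𝕋^ι = ℝ^ι / ℤ^ι`

A function on the torus is identified with its `1`-periodic lift to `ℝ^ι`. The measure
`volume` on `UnitAddTorus ι` is the Lebesgue measure of total mass one. -/

/-- The `1`-periodic lift to `ℝ^ι` of a function on the torus. -/
def lift {ι : Type} (f : UnitAddTorus ι → ℝ) : (ι → ℝ) → ℝ :=
  fun v => f (fun i => (v i : UnitAddCircle))

/-- `f` is of class `C^r` on the torus. -/
def IsC {ι : Type} [Fintype ι] (r : WithTop ℕ∞) (f : UnitAddTorus ι → ℝ) : Prop :=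
  ContDiff ℝ r (lift f)

/-- The partial derivative `∂ᵢ f` at the point `z` of the torus. -/
def pd {ι : Type} [DecidableEq ι] (i : ι) (f : UnitAddTorus ι → ℝ) (z : UnitAddTorus ι) : ℝ :=
  deriv (fun s : ℝ => f (z + Pi.single i (s : UnitAddCircle))) 0

/-- `g` belongs to `H¹(𝕋^ι)` and `b` is its weak gradient. -/
structure IsH1WithGrad {ι : Type} [Fintype ι] [DecidableEq ι]
    (g : UnitAddTorus ι → ℝ) (b : UnitAddTorus ι → ι → ℝ) : Prop where
  memLp : MemLp g 2 volume
  memLp_grad : ∀ i, MemLp (fun x => b x i) 2 volume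
  weak_grad : ∀ φ : UnitAddTorus ι → ℝ, IsC ∞ φ → ∀ i,
    ∫ x, g x * pd i φ x = - ∫ x, b x i * φ x

/-- `b` is the Helmholtz projection, with respect to the Lebesgue measure, of the square
integrable vector field `f`: it is the gradient of the minimizer of `g ↦ ∫ |f - ∇g|²` among the
functions `g` of `H¹` with zero mean. -/
def IsHelmholtzProjection {ι : Type} [Fintype ι] [DecidableEq ι]
    (f b : UnitAddTorus ι → ι → ℝ) : Prop :=
  (∀ i, MemLp (fun x => f x i) 2 volume) ∧
  ∃ g : UnitAddTorus ι → ℝ, IsH1WithGrad g b ∧ ∫ x, g x = 0 ∧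
    ∀ (g' : UnitAddTorus ι → ℝ) (b' : UnitAddTorus ι → ι → ℝ),
      IsH1WithGrad g' b' → ∫ x, g' x = 0 →
        ∫ x, ∑ i, (f x i - b x i) ^ 2 ≤ ∫ x, ∑ i, (f x i - b' x i) ^ 2

/-- The measure with density `f` with respect to the Lebesgue measure of the torus. -/
def densityMeasure {ι : Type} [Fintype ι] (f : UnitAddTorus ι → ℝ) : Measure (UnitAddTorus ι) :=
  volume.withDensity (fun z => ENNReal.ofReal (f z))

/-- The Fisher information `∫ |∇ ln f|² f dν` of the measure `f ν` relative to `ν`. -/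
def fisherInformation {ι : Type} [Fintype ι] [DecidableEq ι]
    (f : UnitAddTorus ι → ℝ) (ν : Measure (UnitAddTorus ι)) : ℝ :=
  ∫ z, (∑ i, (pd i (fun w => Real.log (f w)) z) ^ 2) * f z ∂ν

/-- The logarithmic Sobolev inequality `LSI(ρ)`: the relative entropy with respect to `ν` of every
probability measure `f ν` is at most `1 / (2ρ)` times its Fisher information. As usual the
inequality is required for positive densities `f` of class `C¹`, for which the Fisher information
has its classical meaning. -/
def LSI {ι : Type} [Fintype ι] [DecidableEq ι] (ν : Measure (UnitAddTorus ι)) (ρ : ℝ) : Prop :=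
  ∀ f : UnitAddTorus ι → ℝ, IsC 1 f → (∀ z, 0 < f z) → ∫ z, f z ∂ν = 1 →
    InformationTheory.klDiv (ν.withDensity (fun z => ENNReal.ofReal (f z))) ν
      ≤ ENNReal.ofReal (1 / (2 * ρ) * fisherInformation f ν)

/-! ### The (projected) adaptive biasing force dynamics

Points of `𝕋^n = 𝕋^m × 𝕋^k`, with `n = m + k`, are functions on `Fin m ⊕ Fin k`; the point `(x, y)`
is `Sum.elim x y` and the transition coordinate is `ξ (x, y) = x`. -/

/-- The transition coordinate `ξ (x, y) = x`. -/
def xi {m k : ℕ} (z : UnitAddTorus (Fin m ⊕ Fin k)) : UnitAddTorus (Fin m) :=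
  fun i => z (Sum.inl i)

/-- The marginal density `p^ξ (x) = ∫ p (x, y) dy`. -/
def marginal {m k : ℕ} (p : UnitAddTorus (Fin m ⊕ Fin k) → ℝ) (x : UnitAddTorus (Fin m)) : ℝ :=
  ∫ y : UnitAddTorus (Fin k), p (Sum.elim x y)

/-- The average mean force `G (x) = ∫ -F₁ (x, y) p (x, y) / p^ξ (x) dy`, where `F₁` denotes the
first `m` components of the force field `F`. -/
def meanForce {m k : ℕ} (F : UnitAddTorus (Fin m ⊕ Fin k) → (Fin m ⊕ Fin k) → ℝ)
    (p : UnitAddTorus (Fin m ⊕ Fin k) → ℝ) (x : UnitAddTorus (Fin m)) (i : Fin m) : ℝ :=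
  ∫ y : UnitAddTorus (Fin k),
    - F (Sum.elim x y) (Sum.inl i) * (p (Sum.elim x y) / marginal p x)

/-- The two algorithms. -/
inductive Algorithm where
  | abf : Algorithm
  | pabf : Algorithm

/-- The bias `B` associated by the algorithm to the mean force `G`: `G` itself for ABF, and its
Helmholtz projection in `L²(λ)` for PABF. Vector fields are considered up to null sets. -/
def IsBias {m : ℕ} : Algorithm → (G B : UnitAddTorus (Fin m) → Fin m → ℝ) → Prop
  | .abf, G, B => B =ᵐ[volume] G
  | .pabf, G, B => IsHelmholtzProjection G B

/-- `(p t, B t)` is a solution on `[0, ∞)` of the non-linear Fokker-Planck equation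
`∂ₜ p = β⁻¹ Δ p - ∇ · (F p) - ∇ₓ · (B p)`, where `B t` is the bias given by the mean force of `p t`.
The `p t` are probability densities, continuous in time and space up to time `0`, with a continuous
spatial gradient at positive times, and the equation is understood weakly, against smooth test
functions on the torus. -/
structure IsSolution {m k : ℕ} (alg : Algorithm) (β : ℝ)
    (F : UnitAddTorus (Fin m ⊕ Fin k) → (Fin m ⊕ Fin k) → ℝ)
    (p : ℝ → UnitAddTorus (Fin m ⊕ Fin k) → ℝ)
    (B : ℝ → UnitAddTorus (Fin m) → Fin m → ℝ) : Prop where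
  nonneg : ∀ t, 0 ≤ t → ∀ z, 0 ≤ p t z
  mass : ∀ t, 0 ≤ t → ∫ z, p t z = 1
  continuousOn : ContinuousOn
    (fun q : ℝ × UnitAddTorus (Fin m ⊕ Fin k) => p q.1 q.2) (Ici 0 ×ˢ univ)
  isC_one : ∀ t, 0 < t → IsC 1 (p t)
  continuousOn_pd : ∀ i, ContinuousOn
    (fun q : ℝ × UnitAddTorus (Fin m ⊕ Fin k) => pd i (p q.1) q.2) (Ioi 0 ×ˢ univ)
  bias : ∀ t, 0 ≤ t → IsBias alg (meanForce F (p t)) (B t)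
  equation : ∀ φ : UnitAddTorus (Fin m ⊕ Fin k) → ℝ, IsC ∞ φ → ∀ t, 0 < t →
    HasDerivAt (fun s => ∫ z, φ z * p s z)
      (∫ z, (- β⁻¹ * ∑ i, pd i φ z * pd i (p t) z
        + (∑ i, F z i * pd i φ z) * p t z
        + (∑ i : Fin m, B t (xi z) i * pd (Sum.inl i) φ z) * p t z)) t

/-- `(p, B)` is a stationary state of the dynamics: a solution that is constant in time. -/
def IsStationary {m k : ℕ} (alg : Algorithm) (β : ℝ)
    (F : UnitAddTorus (Fin m ⊕ Fin k) → (Fin m ⊕ Fin k) → ℝ)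
    (p : UnitAddTorus (Fin m ⊕ Fin k) → ℝ) (B : UnitAddTorus (Fin m) → Fin m → ℝ) : Prop :=
  IsSolution alg β F (fun _ => p) (fun _ => B)

/-! ### The conservative case -/

/-- The conservative force `F = -∇V`. -/
def gradForce {m k : ℕ} (V : UnitAddTorus (Fin m ⊕ Fin k) → ℝ)
    (z : UnitAddTorus (Fin m ⊕ Fin k)) (i : Fin m ⊕ Fin k) : ℝ :=
  - pd i V z

/-- The free energy `A (x) = -β⁻¹ ln ∫ exp (-β V (x, y)) dy`. -/
def freeEnergy {m k : ℕ} (β : ℝ) (V : UnitAddTorus (Fin m ⊕ Fin k) → ℝ)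
    (x : UnitAddTorus (Fin m)) : ℝ :=
  - β⁻¹ * Real.log (∫ y : UnitAddTorus (Fin k), Real.exp (- β * V (Sum.elim x y)))

/-- The gradient `∇A` of the free energy. -/
def gradFreeEnergy {m k : ℕ} (β : ℝ) (V : UnitAddTorus (Fin m ⊕ Fin k) → ℝ)
    (x : UnitAddTorus (Fin m)) (i : Fin m) : ℝ :=
  pd i (freeEnergy β V) x

/-- The density of `μ_A`, namely `Z⁻¹ exp (-β (V - A ∘ ξ))` with
`Z = ∫ exp (-β (V - A ∘ ξ))`. -/
def muA {m k : ℕ} (β : ℝ) (V : UnitAddTorus (Fin m ⊕ Fin k) → ℝ)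
    (z : UnitAddTorus (Fin m ⊕ Fin k)) : ℝ :=
  (∫ w : UnitAddTorus (Fin m ⊕ Fin k), Real.exp (- β * (V w - freeEnergy β V (xi w))))⁻¹ *
    Real.exp (- β * (V z - freeEnergy β V (xi z)))

/-- The conditional density `y ↦ μ_A (x, y) / μ_A^ξ (x)`. -/
def condMuA {m k : ℕ} (β : ℝ) (V : UnitAddTorus (Fin m ⊕ Fin k) → ℝ)
    (x : UnitAddTorus (Fin m)) (y : UnitAddTorus (Fin k)) : ℝ :=
  muA β V (Sum.elim x y) / marginal (muA β V) x

/-- The rate `Λ`: `(8π² ∧ 2ρ) β⁻¹` for ABF and `(4π² ∧ 2ρ) β⁻¹` for PABF. -/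
def rate (alg : Algorithm) (β ρ : ℝ) : ℝ :=
  match alg with
  | .abf => min (8 * Real.pi ^ 2) (2 * ρ) * β⁻¹
  | .pabf => min (4 * Real.pi ^ 2) (2 * ρ) * β⁻¹

end ABF

end

noncomputable section

namespace ABF

open Filter Topology InformationTheory

set_option linter.unusedSectionVars false

/-! ### The torus as an open quotient of Euclidean space -/

section TorusBasics

variable {ι : Type} [Fintype ι]

/-! The proof is an entropy method in which the marginal is treated separately from the conditional
laws. Write S for the marginal density of p, G for its mean force, D = G - ∇A, R = B - ∇A, and E for
the relative entropy with respect to μ_A.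

Integrating the equation over y, the marginal solves a heat equation with drift B - G, and B - G is
either zero (ABF) or orthogonal to all gradients (PABF). In the time derivative of ∫ Φ(S) the drift
therefore disappears and only -β⁻¹ ∫ Φ''(S)|∇S|² is left (`hasDerivAt_integral_comp_marginal`). With
Φ(s) = (s - 1)² and the sharp Poincaré inequality, N = ∫ (S - 1)² decays at rate 8π²β⁻¹; with the
cube of the positive part of a - s, a lower bound a of S at time zero persists (`le_marginal`).

The derivative of E is -β⁻¹ ∫ p|∇ℓ|² + ∫ p R·∇ₓℓ with ℓ = ln(p/μ_A). The y-part of the Fisher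
information is handled by LSI(ρ) on the fibres and gives -2ρβ⁻¹ times the conditional entropy, that
is E minus the entropy of S. In the x-part, completing the square around βD replaces p(∂ᵢℓ)² by a
quantity linear in p∂ᵢℓ, whose fibre average is exactly ∂ᵢS + βDᵢS. The leading term becomes β ∫
(D·R - |D|²), which is nonpositive because R is the projection of D. What remains involves ∇S or S -
1 and is absorbed by Young's inequality, with a small multiple of ∫ |D|²; a Pinsker inequality on
fibres and the lower bound on S control ∫ |D|² by E. Hence (`exists_production_le`) E' ≤ -(2ρβ⁻¹ -
θ)E + K(1 + 1/θ) ∫ |∇S|². Adding κN with κ of order 1 + 1/ε² absorbs the gradient term, and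
Gronwall's lemma concludes (`entropy_decay_rate`, `exists_mixEntropy_le`).

Two technical points shape the argument. Since p may vanish and is only C¹, the computation is made
for q = (1 - δ)p + δμ_A with δ = η², whose errors are O(η) and vanish as η tends to zero. Since the
equation is only weak, functionals are differentiated in time through convexity
(`WeakFlow.hasDerivAt_integral_comp`).

The uniform LSI follows from one on the flat torus, by tensorization and bounded perturbation.
Stationarity of μ_A holds because its current vanishes; conversely, a stationary density has ∇S = 0,
so its entropy is both constant and decaying, hence zero. -/

instance isProbabilityMeasure_unitAddCircle :
    IsProbabilityMeasure (volume : Measure UnitAddCircle) :=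
  ⟨UnitAddCircle.measure_univ⟩

/-- The projection `ℝ^ι → 𝕋^ι`. -/
def toTorus (v : ι → ℝ) : UnitAddTorus ι := fun i => (v i : UnitAddCircle)

lemma isOpenQuotientMap_toTorus : IsOpenQuotientMap (toTorus : (ι → ℝ) → UnitAddTorus ι) :=
  IsOpenQuotientMap.piMap (fun _ => QuotientAddGroup.isOpenQuotientMap_mk)

lemma continuous_toTorus : Continuous (toTorus : (ι → ℝ) → UnitAddTorus ι) :=
  isOpenQuotientMap_toTorus.continuous

lemma surjective_toTorus : Function.Surjective (toTorus : (ι → ℝ) → UnitAddTorus ι) :=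
  isOpenQuotientMap_toTorus.surjective

lemma continuous_iff_comp_toTorus {E : Type*} [TopologicalSpace E] {f : UnitAddTorus ι → E} :
    Continuous f ↔ Continuous (fun v => f (toTorus v)) :=
  isOpenQuotientMap_toTorus.isQuotientMap.continuous_iff

lemma toTorus_add_single [DecidableEq ι] (v : ι → ℝ) (i : ι) (s : ℝ) :
    toTorus (v + Pi.single i s) = toTorus v + Pi.single i (s : UnitAddCircle) := by
  funext j
  by_cases h : j = i
  · subst h; simp [toTorus]
  · simp [toTorus, h]

lemma integrable_of_continuous {f : UnitAddTorus ι → ℝ} (hf : Continuous f) : Integrable f :=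
  hf.integrable_of_hasCompactSupport (HasCompactSupport.of_compactSpace f)

lemma exists_bound_of_continuous {f : UnitAddTorus ι → ℝ} (hf : Continuous f) :
    ∃ C, 0 < C ∧ ∀ z, |f z| ≤ C := by
  obtain ⟨C, hC⟩ := isCompact_univ.exists_bound_of_continuousOn hf.continuousOn
  exact ⟨max C 1, by positivity, fun z => (hC z (mem_univ z)).trans (le_max_left _ _)⟩

lemma continuous_single_shift [DecidableEq ι] (z : UnitAddTorus ι) (i : ι) :
    Continuous (fun s : ℝ => z + Pi.single i (s : UnitAddCircle)) := by
  refine continuous_const.add ?_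
  exact (continuous_single i).comp continuous_quotient_mk'

end TorusBasics

lemma hasDerivAt_integral_of_bound {α : Type*} [MeasurableSpace α] {μ : Measure α}
    [IsFiniteMeasure μ] {F F' : ℝ → α → ℝ} {C x₀ : ℝ}
    (hF : ∀ s, AEStronglyMeasurable (F s) μ) (hF₀ : Integrable (F x₀) μ)
    (hF' : AEStronglyMeasurable (F' x₀) μ) (hC : ∀ s z, |F' s z| ≤ C)
    (hd : ∀ z s, HasDerivAt (fun s => F s z) (F' s z) s) :
    HasDerivAt (fun s => ∫ z, F s z ∂μ) (∫ z, F' x₀ z ∂μ) x₀ :=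
  (hasDerivAt_integral_of_dominated_loc_of_deriv_le (s := univ) (bound := fun _ => C) univ_mem
    (Eventually.of_forall hF) hF₀ hF' (ae_of_all _ fun z s _ => hC s z) (integrable_const _)
    (ae_of_all _ fun z s _ => hd z s)).2

/-! ### Calculus with partial derivatives on the torus -/

section C1

variable {ι : Type} [Fintype ι] [DecidableEq ι]

/-- Continuously differentiable functions on the torus, in terms of partial derivatives. -/
structure C1 (f : UnitAddTorus ι → ℝ) : Prop where
  continuous : Continuous f
  hasDerivAt : ∀ i z, HasDerivAt (fun s : ℝ => f (z + Pi.single i (s : UnitAddCircle)))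
    (pd i f z) 0
  continuous_pd : ∀ i, Continuous (pd i f)

variable {f g : UnitAddTorus ι → ℝ}

/-- Obtaining regularity and the formula for `pd` together lets each calculus rule below rest on a
single pointwise computation. -/
lemma C1.of_hasDerivAt (hf : Continuous f) (D : ι → UnitAddTorus ι → ℝ)
    (hD : ∀ i, Continuous (D i))
    (h : ∀ i z, HasDerivAt (fun s : ℝ => f (z + Pi.single i (s : UnitAddCircle))) (D i z) 0) :
    C1 f ∧ ∀ i, pd i f = D i := by
  have hpd : ∀ i, pd i f = D i := fun i => funext fun z => (h i z).deriv
  refine ⟨⟨hf, fun i z => ?_, fun i => ?_⟩, hpd⟩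
  · rw [hpd]; exact h i z
  · rw [hpd]; exact hD i

lemma C1.hasDerivAt_shift (hf : C1 f) (i : ι) (z : UnitAddTorus ι) (s : ℝ) :
    HasDerivAt (fun s : ℝ => f (z + Pi.single i (s : UnitAddCircle)))
      (pd i f (z + Pi.single i (s : UnitAddCircle))) s := by
  have h := hf.hasDerivAt i (z + Pi.single i (s : UnitAddCircle))
  rw [show (0:ℝ) = s - s by simp] at h
  refine (h.comp_sub_const s s).congr_of_eventuallyEq (Eventually.of_forall fun r => ?_)
  beta_reduce
  rw [add_assoc, ← Pi.single_add, ← AddCircle.coe_add, add_sub_cancel]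

/-- The converse, `C1.isC`, needs mollification. `C1` is the working notion because derivatives
along coordinate translations avoid lifts. -/
lemma IsC.c1 (hf : IsC 1 f) : C1 f := by
  have hf' : ContDiff ℝ 1 (fun v => f (toTorus v)) := hf
  have hfd : ∀ v, HasFDerivAt (fun v => f (toTorus v))
      (fderiv ℝ (fun v => f (toTorus v)) v) v := fun v =>
    (hf'.differentiable one_ne_zero v).hasFDerivAt
  have key : ∀ i v, HasDerivAt (fun s : ℝ => f (toTorus v + Pi.single i (s : UnitAddCircle)))
      (fderiv ℝ (fun v => f (toTorus v)) v (Pi.single i 1)) 0 := by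
    intro i v
    have h1 : HasDerivAt (fun s : ℝ => v + Pi.single i s) (Pi.single i (1:ℝ)) 0 := by
      have := (hasDerivAt_single (𝕜 := ℝ) i (0 : ℝ) ).const_add v
      simpa using this
    have h2 := (hfd (v + Pi.single i (0:ℝ))).comp_hasDerivAt (0:ℝ) h1
    simp only [Pi.single_zero, add_zero] at h2
    refine h2.congr_of_eventuallyEq (Eventually.of_forall fun s => ?_)
    simp [toTorus_add_single]
  have hpd : ∀ i v, pd i f (toTorus v)
      = fderiv ℝ (fun v => f (toTorus v)) v (Pi.single i 1) := fun i v => (key i v).deriv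
  refine ⟨continuous_iff_comp_toTorus.2 hf'.continuous, fun i z => ?_, fun i => ?_⟩
  · obtain ⟨v, rfl⟩ := surjective_toTorus z
    rw [hpd]; exact key i v
  · rw [continuous_iff_comp_toTorus]
    simp only [hpd]
    exact (hf'.continuous_fderiv one_ne_zero).clm_apply continuous_const

lemma IsC.of_le {r s : WithTop ℕ∞} (hf : IsC r f) (h : s ≤ r) : IsC s f := ContDiff.of_le hf h

lemma C1.const (c : ℝ) : C1 (fun _ : UnitAddTorus ι => c) :=
  (C1.of_hasDerivAt continuous_const (fun _ _ => 0) (fun _ => continuous_const)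
    (fun _ _ => hasDerivAt_const _ _)).1

lemma pd_const (i : ι) (c : ℝ) : pd i (fun _ : UnitAddTorus ι => c) = fun _ => 0 := by
  funext z; simp [pd]

lemma C1.add_aux (hf : C1 f) (hg : C1 g) : C1 (fun z => f z + g z) ∧
    ∀ i, pd i (fun z => f z + g z) = fun z => pd i f z + pd i g z :=
  C1.of_hasDerivAt (hf.continuous.add hg.continuous) _
    (fun i => (hf.continuous_pd i).add (hg.continuous_pd i))
    (fun i z => (hf.hasDerivAt i z).add (hg.hasDerivAt i z))

lemma C1.add (hf : C1 f) (hg : C1 g) : C1 (fun z => f z + g z) := (hf.add_aux hg).1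

lemma C1.pd_add (hf : C1 f) (hg : C1 g) (i : ι) (z : UnitAddTorus ι) :
    pd i (fun z => f z + g z) z = pd i f z + pd i g z := by rw [(hf.add_aux hg).2]

lemma C1.mul_aux (hf : C1 f) (hg : C1 g) : C1 (fun z => f z * g z) ∧
    ∀ i, pd i (fun z => f z * g z) = fun z => pd i f z * g z + f z * pd i g z :=
  C1.of_hasDerivAt (hf.continuous.mul hg.continuous) _
    (fun i => ((hf.continuous_pd i).mul hg.continuous).add (hf.continuous.mul (hg.continuous_pd i)))
    (fun i z => by simpa using! (hf.hasDerivAt i z).mul (hg.hasDerivAt i z))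

lemma C1.mul (hf : C1 f) (hg : C1 g) : C1 (fun z => f z * g z) := (hf.mul_aux hg).1

lemma C1.pd_mul (hf : C1 f) (hg : C1 g) (i : ι) (z : UnitAddTorus ι) :
    pd i (fun z => f z * g z) z = pd i f z * g z + f z * pd i g z := by rw [(hf.mul_aux hg).2]

lemma C1.const_mul (hf : C1 f) (c : ℝ) : C1 (fun z => c * f z) := (C1.const c).mul hf

lemma C1.pd_const_mul (hf : C1 f) (c : ℝ) (i : ι) (z : UnitAddTorus ι) :
    pd i (fun z => c * f z) z = c * pd i f z := by
  rw [(C1.const c).pd_mul hf, pd_const]; ring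

lemma C1.sub_aux (hf : C1 f) (hg : C1 g) : C1 (fun z => f z - g z) ∧
    ∀ i, pd i (fun z => f z - g z) = fun z => pd i f z - pd i g z :=
  C1.of_hasDerivAt (hf.continuous.sub hg.continuous) _
    (fun i => (hf.continuous_pd i).sub (hg.continuous_pd i))
    (fun i z => (hf.hasDerivAt i z).sub (hg.hasDerivAt i z))

lemma C1.sub (hf : C1 f) (hg : C1 g) : C1 (fun z => f z - g z) := (hf.sub_aux hg).1

lemma C1.pd_sub (hf : C1 f) (hg : C1 g) (i : ι) (z : UnitAddTorus ι) :
    pd i (fun z => f z - g z) z = pd i f z - pd i g z := by rw [(hf.sub_aux hg).2]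

lemma C1.comp_aux (hf : C1 f) {Φ Φ' : ℝ → ℝ} {s : Set ℝ} (hs : ∀ z, f z ∈ s)
    (hΦ : ∀ x ∈ s, HasDerivAt Φ (Φ' x) x) (hΦ' : ContinuousOn Φ' s) :
    C1 (fun z => Φ (f z)) ∧ ∀ i, pd i (fun z => Φ (f z)) = fun z => Φ' (f z) * pd i f z := by
  have hc : ContinuousOn Φ s := fun x hx => (hΦ x hx).continuousAt.continuousWithinAt
  refine C1.of_hasDerivAt (hc.comp_continuous hf.continuous hs) _
    (fun i => (hΦ'.comp_continuous hf.continuous hs).mul (hf.continuous_pd i)) (fun i z => ?_)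
  have h1 : HasDerivAt Φ (Φ' (f z)) (f (z + Pi.single i ((0:ℝ) : UnitAddCircle))) := by
    simpa using hΦ _ (hs z)
  exact h1.comp (0:ℝ) (hf.hasDerivAt i z)

lemma C1.log (hf : C1 f) (h : ∀ z, 0 < f z) : C1 (fun z => Real.log (f z)) :=
  (hf.comp_aux (s := Ioi 0) h (fun _ hx => Real.hasDerivAt_log (ne_of_gt hx))
    (continuousOn_inv₀.mono fun _ hx => ne_of_gt hx)).1

lemma C1.pd_log (hf : C1 f) (h : ∀ z, 0 < f z) (i : ι) (z : UnitAddTorus ι) :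
    pd i (fun z => Real.log (f z)) z = (f z)⁻¹ * pd i f z := by
  rw [(hf.comp_aux (s := Ioi 0) h (fun _ hx => Real.hasDerivAt_log (ne_of_gt hx))
    (continuousOn_inv₀.mono fun _ hx => ne_of_gt hx)).2]

lemma C1.exp (hf : C1 f) : C1 (fun z => Real.exp (f z)) :=
  (hf.comp_aux (s := univ) (fun _ => mem_univ _) (fun x _ => Real.hasDerivAt_exp x)
    Real.continuous_exp.continuousOn).1

lemma C1.pd_exp (hf : C1 f) (i : ι) (z : UnitAddTorus ι) :
    pd i (fun z => Real.exp (f z)) z = Real.exp (f z) * pd i f z := by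
  rw [(hf.comp_aux (s := univ) (fun _ => mem_univ _) (fun x _ => Real.hasDerivAt_exp x)
    Real.continuous_exp.continuousOn).2]

/-- The integral of a partial derivative over the torus vanishes. -/
lemma C1.integral_pd_eq_zero (hf : C1 f) (i : ι) : ∫ z, pd i f z = 0 := by
  obtain ⟨C, -, hC⟩ := exists_bound_of_continuous (hf.continuous_pd i)
  have hc : ∀ s : ℝ, Continuous fun z : UnitAddTorus ι => f (z + Pi.single i (s : UnitAddCircle)) := fun s =>
    hf.continuous.comp (continuous_id.add continuous_const)
  have hc' : ∀ s : ℝ, Continuous fun z : UnitAddTorus ι =>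
      pd i f (z + Pi.single i (s : UnitAddCircle)) := fun s =>
    (hf.continuous_pd i).comp (continuous_id.add continuous_const)
  have hd : ∀ (z : UnitAddTorus ι) (s : ℝ),
      HasDerivAt (fun s : ℝ => f (z + Pi.single i (s : UnitAddCircle)))
        (pd i f (z + Pi.single i (s : UnitAddCircle))) s := hf.hasDerivAt_shift i
  have h2 := hasDerivAt_integral_of_bound (fun s => (hc s).aestronglyMeasurable (μ := volume))
    (integrable_of_continuous (hc 0)) (hc' 0).aestronglyMeasurable (fun s z => hC _) hd
  -- By translation invariance the integral of the translated function does not depend on s, so its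
  -- derivative is zero.
  have hconst : (fun s : ℝ => ∫ z : UnitAddTorus ι, f (z + Pi.single i (s : UnitAddCircle)))
      = fun _ => ∫ z, f z := funext fun s => integral_add_right_eq_self f _
  rw [hconst] at h2
  have h3 := h2.unique (hasDerivAt_const _ _)
  rwa [integral_add_right_eq_self (pd i f)] at h3

lemma C1.integral_mul_pd (hf : C1 f) (hg : C1 g) (i : ι) :
    ∫ z, f z * pd i g z = - ∫ z, pd i f z * g z := by
  have h := (hf.mul hg).integral_pd_eq_zero i
  simp only [hf.pd_mul hg] at h
  have h1 : Continuous fun z => pd i f z * g z := (hf.continuous_pd i).mul hg.continuous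
  have h2 : Continuous fun z => f z * pd i g z := hf.continuous.mul (hg.continuous_pd i)
  rw [integral_add (integrable_of_continuous h1) (integrable_of_continuous h2)] at h
  linarith

end C1

/-! ### Fubini, marginals and slices on the product torus -/

section Splitting

variable {m k : ℕ}

lemma continuous_sumElim : Continuous (fun q : UnitAddTorus (Fin m) × UnitAddTorus (Fin k) =>
    (Sum.elim q.1 q.2 : UnitAddTorus (Fin m ⊕ Fin k))) := by
  refine continuous_pi fun i => ?_
  rcases i with i | j
  · exact (continuous_apply i).comp continuous_fst
  · exact (continuous_apply j).comp continuous_snd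

lemma continuous_xi : Continuous (xi : UnitAddTorus (Fin m ⊕ Fin k) → UnitAddTorus (Fin m)) :=
  continuous_pi fun _ => continuous_apply _

@[simp] lemma xi_sumElim (x : UnitAddTorus (Fin m)) (y : UnitAddTorus (Fin k)) :
    xi (Sum.elim x y) = x := rfl

lemma measurePreserving_sumElim :
    MeasurePreserving (fun q : UnitAddTorus (Fin m) × UnitAddTorus (Fin k) =>
      (Sum.elim q.1 q.2 : UnitAddTorus (Fin m ⊕ Fin k))) volume volume := by
  have h := volume_measurePreserving_sumPiEquivProdPi_symm
    (fun _ : Fin m ⊕ Fin k => UnitAddCircle)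
  convert h using 1
  funext q i
  rcases i with i | j <;> rfl

lemma measurableEmbedding_sumElim :
    MeasurableEmbedding (fun q : UnitAddTorus (Fin m) × UnitAddTorus (Fin k) =>
      (Sum.elim q.1 q.2 : UnitAddTorus (Fin m ⊕ Fin k))) := by
  have h := (MeasurableEquiv.sumPiEquivProdPi
    (fun _ : Fin m ⊕ Fin k => UnitAddCircle)).symm.measurableEmbedding
  convert h using 1
  funext q i
  rcases i with i | j <;> rfl

lemma measurePreserving_xi :
    MeasurePreserving (xi : UnitAddTorus (Fin m ⊕ Fin k) → UnitAddTorus (Fin m))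
      volume volume := by
  have h : MeasurePreserving (fun q : UnitAddTorus (Fin m) × UnitAddTorus (Fin k) => q.1)
      volume volume := measurePreserving_fst
  refine ⟨continuous_xi.measurable, ?_⟩
  rw [← measurePreserving_sumElim.map_eq, Measure.map_map continuous_xi.measurable
    measurePreserving_sumElim.measurable]
  exact h.map_eq

/-- Fubini's theorem on `𝕋^m × 𝕋^k`. -/
lemma integral_eq_integral_integral {f : UnitAddTorus (Fin m ⊕ Fin k) → ℝ} (hf : Integrable f) :
    ∫ z, f z = ∫ x, ∫ y, f (Sum.elim x y) := by
  rw [← measurePreserving_sumElim.integral_comp measurableEmbedding_sumElim]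
  exact integral_prod _ ((measurePreserving_sumElim.integrable_comp_emb
    measurableEmbedding_sumElim).2 hf)

lemma integral_eq_integral_marginal {f : UnitAddTorus (Fin m ⊕ Fin k) → ℝ} (hf : Integrable f) :
    ∫ z, f z = ∫ x, marginal f x := integral_eq_integral_integral hf

lemma integrable_marginal {f : UnitAddTorus (Fin m ⊕ Fin k) → ℝ} (hf : Integrable f) :
    Integrable (marginal f) :=
  ((measurePreserving_sumElim.integrable_comp_emb
    measurableEmbedding_sumElim).2 hf).integral_prod_left

lemma marginal_xi_mul (b : UnitAddTorus (Fin m) → ℝ) (f : UnitAddTorus (Fin m ⊕ Fin k) → ℝ)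
    (x : UnitAddTorus (Fin m)) : marginal (fun z => b (xi z) * f z) x = b x * marginal f x := by
  simp only [marginal, xi_sumElim]
  exact integral_const_mul _ _

lemma continuous_slice {f : UnitAddTorus (Fin m ⊕ Fin k) → ℝ} (hf : Continuous f)
    (x : UnitAddTorus (Fin m)) : Continuous (fun y : UnitAddTorus (Fin k) => f (Sum.elim x y)) :=
  hf.comp (continuous_sumElim.comp (Continuous.prodMk_right x))

lemma continuous_marginal {f : UnitAddTorus (Fin m ⊕ Fin k) → ℝ} (hf : Continuous f) :
    Continuous (marginal f) := by
  have h : Continuous (Function.uncurry fun (x : UnitAddTorus (Fin m)) (y : UnitAddTorus (Fin k)) =>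
    f (Sum.elim x y)) := hf.comp continuous_sumElim
  have h2 := continuous_parametric_integral_of_continuous (μ := volume) h isCompact_univ
  simpa [marginal] using! h2

lemma marginal_add {f g : UnitAddTorus (Fin m ⊕ Fin k) → ℝ} (hf : Continuous f)
    (hg : Continuous g) (x : UnitAddTorus (Fin m)) :
    marginal (fun z => f z + g z) x = marginal f x + marginal g x :=
  integral_add (integrable_of_continuous (continuous_slice hf x))
    (integrable_of_continuous (continuous_slice hg x))

lemma marginal_sub {f g : UnitAddTorus (Fin m ⊕ Fin k) → ℝ} (hf : Continuous f)
    (hg : Continuous g) (x : UnitAddTorus (Fin m)) :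
    marginal (fun z => f z - g z) x = marginal f x - marginal g x :=
  integral_sub (integrable_of_continuous (continuous_slice hf x))
    (integrable_of_continuous (continuous_slice hg x))

lemma marginal_const_mul (c : ℝ) (f : UnitAddTorus (Fin m ⊕ Fin k) → ℝ)
    (x : UnitAddTorus (Fin m)) : marginal (fun z => c * f z) x = c * marginal f x :=
  integral_const_mul _ _

lemma marginal_pos {f : UnitAddTorus (Fin m ⊕ Fin k) → ℝ} (hf : Continuous f)
    (h : ∀ z, 0 < f z) (x : UnitAddTorus (Fin m)) : 0 < marginal f x := by
  refine (integral_pos_iff_support_of_nonneg (fun y => (h _).le)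
    (integrable_of_continuous (continuous_slice hf x))).2 ?_
  have : Function.support (fun y : UnitAddTorus (Fin k) => f (Sum.elim x y)) = univ :=
    Set.eq_univ_of_forall fun y => (h _).ne'
  rw [this]
  simp

lemma sumElim_add_single_inl (x : UnitAddTorus (Fin m)) (y : UnitAddTorus (Fin k)) (i : Fin m)
    (s : UnitAddCircle) : (Sum.elim x y : UnitAddTorus (Fin m ⊕ Fin k)) + Pi.single (Sum.inl i) s
      = Sum.elim (x + Pi.single i s) y := by
  funext j
  rcases j with j | j
  · by_cases h : j = i
    · subst h; simp
    · simp [h]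
  · simp

lemma sumElim_add_single_inr (x : UnitAddTorus (Fin m)) (y : UnitAddTorus (Fin k)) (i : Fin k)
    (s : UnitAddCircle) : (Sum.elim x y : UnitAddTorus (Fin m ⊕ Fin k)) + Pi.single (Sum.inr i) s
      = Sum.elim x (y + Pi.single i s) := by
  funext j
  rcases j with j | j
  · simp
  · by_cases h : j = i
    · subst h; simp
    · simp [h]

lemma xi_add_single_inl (z : UnitAddTorus (Fin m ⊕ Fin k)) (i : Fin m) (s : UnitAddCircle) :
    xi (z + Pi.single (Sum.inl i) s) = xi z + Pi.single i s := by
  funext j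
  by_cases h : j = i
  · subst h; simp [xi]
  · simp [xi, h]

lemma xi_add_single_inr (z : UnitAddTorus (Fin m ⊕ Fin k)) (i : Fin k) (s : UnitAddCircle) :
    xi (z + Pi.single (Sum.inr i) s) = xi z := by
  funext j
  simp [xi]

lemma C1.marginal_aux {f : UnitAddTorus (Fin m ⊕ Fin k) → ℝ} (hf : C1 f) :
    C1 (marginal f) ∧ ∀ i, pd i (marginal f) = marginal (pd (Sum.inl i) f) := by
  refine C1.of_hasDerivAt (continuous_marginal hf.continuous) _
    (fun i => continuous_marginal (hf.continuous_pd _)) (fun i x => ?_)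
  obtain ⟨C, -, hC⟩ := exists_bound_of_continuous (hf.continuous_pd (Sum.inl i))
  have hc : ∀ s : ℝ, Continuous fun y : UnitAddTorus (Fin k) =>
      f (Sum.elim (x + Pi.single i (s : UnitAddCircle)) y) :=
    fun s => continuous_slice hf.continuous _
  have hc' : ∀ s : ℝ, Continuous fun y : UnitAddTorus (Fin k) =>
      pd (Sum.inl i) f (Sum.elim (x + Pi.single i (s : UnitAddCircle)) y) :=
    fun s => continuous_slice (hf.continuous_pd _) _
  have hd : ∀ (y : UnitAddTorus (Fin k)) (s : ℝ),
      HasDerivAt (fun s : ℝ => f (Sum.elim (x + Pi.single i (s : UnitAddCircle)) y))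
        (pd (Sum.inl i) f (Sum.elim (x + Pi.single i (s : UnitAddCircle)) y)) s := by
    intro y s
    have := hf.hasDerivAt_shift (Sum.inl i) (Sum.elim x y) s
    simpa only [sumElim_add_single_inl] using this
  have h := hasDerivAt_integral_of_bound (fun s => (hc s).aestronglyMeasurable (μ := volume))
    (integrable_of_continuous (hc 0)) (hc' 0).aestronglyMeasurable (fun s z => hC _) hd
  simpa [marginal] using h

lemma C1.marginal {f : UnitAddTorus (Fin m ⊕ Fin k) → ℝ} (hf : C1 f) : C1 (marginal f) :=
  hf.marginal_aux.1

lemma C1.pd_marginal {f : UnitAddTorus (Fin m ⊕ Fin k) → ℝ} (hf : C1 f) (i : Fin m)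
    (x : UnitAddTorus (Fin m)) :
    pd i (ABF.marginal f) x = ABF.marginal (pd (Sum.inl i) f) x := by
  rw [hf.marginal_aux.2]

lemma pd_comp_xi_inl (f : UnitAddTorus (Fin m) → ℝ) (i : Fin m)
    (z : UnitAddTorus (Fin m ⊕ Fin k)) : pd (Sum.inl i) (fun z => f (xi z)) z = pd i f (xi z) := by
  simp only [pd, xi_add_single_inl]

lemma pd_comp_xi_inr (f : UnitAddTorus (Fin m) → ℝ) (i : Fin k)
    (z : UnitAddTorus (Fin m ⊕ Fin k)) : pd (Sum.inr i) (fun z => f (xi z)) z = 0 := by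
  simp [pd, xi_add_single_inr]

lemma pd_slice (f : UnitAddTorus (Fin m ⊕ Fin k) → ℝ) (x : UnitAddTorus (Fin m)) (j : Fin k)
    (y : UnitAddTorus (Fin k)) :
    pd j (fun y => f (Sum.elim x y)) y = pd (Sum.inr j) f (Sum.elim x y) := by
  simp only [pd, sumElim_add_single_inr]

lemma C1.comp_xi {f : UnitAddTorus (Fin m) → ℝ} (hf : C1 f) :
    C1 (fun z : UnitAddTorus (Fin m ⊕ Fin k) => f (xi z)) := by
  refine ⟨hf.continuous.comp continuous_xi, fun i z => ?_, fun i => ?_⟩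
  · rcases i with i | j
    · simpa only [pd_comp_xi_inl, xi_add_single_inl] using hf.hasDerivAt i (xi z)
    · simpa only [pd_comp_xi_inr, xi_add_single_inr] using hasDerivAt_const _ _
  · rcases i with i | j
    · rw [show pd (Sum.inl i) (fun z : UnitAddTorus (Fin m ⊕ Fin k) => f (xi z))
        = fun z => pd i f (xi z) from funext fun z => pd_comp_xi_inl f i z]
      exact (hf.continuous_pd i).comp continuous_xi
    · rw [show pd (Sum.inr j) (fun z : UnitAddTorus (Fin m ⊕ Fin k) => f (xi z))
        = fun z => 0 from funext fun z => pd_comp_xi_inr f j z]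
      exact continuous_const

lemma C1.slice {f : UnitAddTorus (Fin m ⊕ Fin k) → ℝ} (hf : C1 f) (x : UnitAddTorus (Fin m)) :
    C1 (fun y : UnitAddTorus (Fin k) => f (Sum.elim x y)) := by
  refine ⟨continuous_slice hf.continuous x, fun i y => ?_, fun i => ?_⟩
  · rw [pd_slice]
    simpa only [sumElim_add_single_inr] using hf.hasDerivAt (Sum.inr i) (Sum.elim x y)
  · rw [show pd i (fun y : UnitAddTorus (Fin k) => f (Sum.elim x y))
        = fun y => pd (Sum.inr i) f (Sum.elim x y) from funext fun y => pd_slice f x i y]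
    exact continuous_slice (hf.continuous_pd _) x

lemma IsC.comp_xi {r : WithTop ℕ∞} {f : UnitAddTorus (Fin m) → ℝ} (hf : IsC r f) :
    IsC r (fun z : UnitAddTorus (Fin m ⊕ Fin k) => f (xi z)) := by
  have h : ContDiff ℝ r (fun v : Fin m ⊕ Fin k → ℝ => fun i : Fin m => v (Sum.inl i)) :=
    contDiff_pi.2 fun i => contDiff_apply _ _ _
  exact ContDiff.comp (g := lift f) hf h

end Splitting

/-! ### Density of smooth functions in C¹ -/

section Mollification

variable {ι : Type} [Fintype ι] [DecidableEq ι] {f : UnitAddTorus ι → ℝ}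

lemma uniformContinuous_toTorus : UniformContinuous (toTorus : (ι → ℝ) → UnitAddTorus ι) := by
  let φ : (ι → ℝ) →+ UnitAddTorus ι :=
    { toFun := toTorus
      map_zero' := rfl
      map_add' := fun _ _ => rfl }
  exact uniformContinuous_addMonoidHom_of_continuous (f := φ) continuous_toTorus

/-- The average of `f` over small translations, weighted by the bump function `ψ`. -/
def mollify (ψ : ContDiffBump (0 : ι → ℝ)) (f : UnitAddTorus ι → ℝ) (z : UnitAddTorus ι) : ℝ :=
  ∫ v : ι → ℝ, ψ.normed volume v * f (z - toTorus v)

open scoped Convolution in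
lemma lift_mollify (ψ : ContDiffBump (0 : ι → ℝ)) (f : UnitAddTorus ι → ℝ) :
    lift (mollify ψ f) = (ψ.normed volume ⋆[ContinuousLinearMap.lsmul ℝ ℝ, volume] lift f) := by
  funext v
  simp only [convolution, lift, mollify, ContinuousLinearMap.lsmul_apply, smul_eq_mul]
  rfl

lemma continuous_lift (hf : Continuous f) : Continuous (lift f) := hf.comp continuous_toTorus

lemma isC_mollify (ψ : ContDiffBump (0 : ι → ℝ)) (hf : Continuous f) : IsC ∞ (mollify ψ f) := by
  rw [IsC, lift_mollify]
  exact ψ.hasCompactSupport_normed.contDiff_convolution_left _ ψ.contDiff_normed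
    (continuous_lift hf).locallyIntegrable

lemma pd_mollify (ψ : ContDiffBump (0 : ι → ℝ)) (hf : C1 f) (i : ι) :
    pd i (mollify ψ f) = mollify ψ (pd i f) := by
  funext z
  obtain ⟨C, -, hC⟩ := exists_bound_of_continuous (hf.continuous_pd i)
  have hψc : Continuous (ψ.normed volume) := (ψ.contDiff_normed (n := 0)).continuous
  have hsub : ∀ s : ℝ, Continuous fun v : ι → ℝ =>
      z + Pi.single i (s : UnitAddCircle) - toTorus v :=
    fun s => continuous_const.sub continuous_toTorus
  have hc : ∀ s : ℝ, Continuous fun v : ι → ℝ =>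
      ψ.normed volume v * f (z + Pi.single i (s : UnitAddCircle) - toTorus v) :=
    fun s => hψc.mul (hf.continuous.comp (hsub s))
  have hc' : ∀ s : ℝ, Continuous fun v : ι → ℝ =>
      ψ.normed volume v * pd i f (z + Pi.single i (s : UnitAddCircle) - toTorus v) :=
    fun s => hψc.mul ((hf.continuous_pd i).comp (hsub s))
  have hint : Integrable fun v : ι → ℝ =>
      ψ.normed volume v * f (z + Pi.single i ((0:ℝ) : UnitAddCircle) - toTorus v) :=
    (hc 0).integrable_of_hasCompactSupport (ψ.hasCompactSupport_normed.mul_right)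
  have hd : ∀ (v : ι → ℝ) (s : ℝ), HasDerivAt (fun s : ℝ =>
      ψ.normed volume v * f (z + Pi.single i (s : UnitAddCircle) - toTorus v))
      (ψ.normed volume v * pd i f (z + Pi.single i (s : UnitAddCircle) - toTorus v)) s := by
    intro v s
    have := (hf.hasDerivAt_shift i (z - toTorus v) s).const_mul (ψ.normed volume v)
    simpa only [add_sub_right_comm] using this
  have hb : ∀ (v : ι → ℝ) (s : ℝ),
      ‖ψ.normed volume v * pd i f (z + Pi.single i (s : UnitAddCircle) - toTorus v)‖
        ≤ ψ.normed volume v * C := by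
    intro v s
    rw [norm_mul, Real.norm_of_nonneg (ψ.nonneg_normed v)]
    exact mul_le_mul_of_nonneg_left (hC _) (ψ.nonneg_normed v)
  have hbi : Integrable fun v : ι → ℝ => ψ.normed volume v * C :=
    (ψ.integrable_normed).mul_const C
  have h := (hasDerivAt_integral_of_dominated_loc_of_deriv_le (s := univ) univ_mem
    (Eventually.of_forall fun s => (hc s).aestronglyMeasurable) hint
    (hc' 0).aestronglyMeasurable (ae_of_all _ fun v s _ => hb v s) hbi
    (ae_of_all _ fun v s _ => hd v s)).2
  have h2 := h.deriv
  simpa [mollify, pd] using h2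

lemma abs_mollify_sub_le (ψ : ContDiffBump (0 : ι → ℝ)) (hf : Continuous f) {ε : ℝ}
    (h : ∀ v w : ι → ℝ, dist v w < ψ.rOut → dist (lift f v) (lift f w) ≤ ε)
    (z : UnitAddTorus ι) : |mollify ψ f z - f z| ≤ ε := by
  obtain ⟨v, rfl⟩ := surjective_toTorus z
  have := ContDiffBump.dist_normed_convolution_le (φ := ψ) (x₀ := v) (g := lift f) (μ := volume)
    (continuous_lift hf).aestronglyMeasurable (ε := ε) (fun x hx => h x v hx)
  rw [← lift_mollify] at this
  exact this

/-- Smooth functions are dense in `C¹`. -/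
lemma C1.exists_smooth_approx (hf : C1 f) {ε : ℝ} (hε : 0 < ε) :
    ∃ φ : UnitAddTorus ι → ℝ, IsC ∞ φ ∧ (∀ z, |φ z - f z| ≤ ε) ∧
      ∀ i z, |pd i φ z - pd i f z| ≤ ε := by
  have hu : ∀ g : UnitAddTorus ι → ℝ, Continuous g → ∃ δ > 0, ∀ v w : ι → ℝ,
      dist v w < δ → dist (lift g v) (lift g w) ≤ ε := by
    intro g hg
    have h1 : UniformContinuous (lift g) :=
      (CompactSpace.uniformContinuous_of_continuous hg).comp uniformContinuous_toTorus
    obtain ⟨δ, hδ, h⟩ := Metric.uniformContinuous_iff.1 h1 ε hε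
    exact ⟨δ, hδ, fun v w hvw => (h hvw).le⟩
  obtain ⟨δ₀, hδ₀, h₀⟩ := hu f hf.continuous
  choose δ hδ h using fun i => hu (pd i f) (hf.continuous_pd i)
  -- A single mollification radius must serve f and all its partial derivatives; a finite minimum
  -- exists only when there is at least one coordinate.
  obtain ⟨r, hr, hr0, hri⟩ : ∃ r > 0, r ≤ δ₀ ∧ ∀ i, r ≤ δ i := by
    rcases isEmpty_or_nonempty ι with he | he
    · exact ⟨δ₀, hδ₀, le_rfl, fun i => (IsEmpty.false i).elim⟩
    · obtain ⟨i₀, hi₀⟩ := Finite.exists_min δ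
      exact ⟨min δ₀ (δ i₀), lt_min hδ₀ (hδ i₀), min_le_left _ _,
        fun i => (min_le_right _ _).trans (hi₀ i)⟩
  let ψ : ContDiffBump (0 : ι → ℝ) := ⟨r / 2, r, by positivity, by linarith⟩
  refine ⟨mollify ψ f, isC_mollify ψ hf.continuous, fun z => ?_, fun i z => ?_⟩
  · exact abs_mollify_sub_le ψ hf.continuous (fun v w hvw => h₀ v w (lt_of_lt_of_le hvw hr0)) z
  · rw [pd_mollify ψ hf i]
    exact abs_mollify_sub_le ψ (hf.continuous_pd i)
      (fun v w hvw => h i v w (lt_of_lt_of_le hvw (hri i))) z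

lemma IsC.hasFDerivAt_lift {f : UnitAddTorus ι → ℝ} (hf : IsC 1 f) (v : ι → ℝ) :
    HasFDerivAt (lift f)
      (∑ i, pd i f (toTorus v) • (ContinuousLinearMap.proj i : (ι → ℝ) →L[ℝ] ℝ)) v := by
  have hf' : ContDiff ℝ 1 (lift f) := hf
  have hfd := (hf'.differentiable one_ne_zero v).hasFDerivAt
  have hpd : ∀ i, pd i f (toTorus v) = fderiv ℝ (lift f) v (Pi.single i 1) := by
    intro i
    have h1 : HasDerivAt (fun s : ℝ => v + Pi.single i s) (Pi.single i (1:ℝ)) 0 := by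
      have := (hasDerivAt_single (𝕜 := ℝ) i (0 : ℝ) ).const_add v
      simpa using this
    have h2 : HasFDerivAt (lift f) (fderiv ℝ (lift f) v) (v + Pi.single i (0:ℝ)) := by
      simpa using hfd
    have h3 := h2.comp_hasDerivAt (0:ℝ) h1
    rw [← h3.deriv]
    simp only [pd, ← toTorus_add_single]
    rfl
  suffices h : ∑ i, pd i f (toTorus v) • (ContinuousLinearMap.proj i : (ι → ℝ) →L[ℝ] ℝ)
      = fderiv ℝ (lift f) v by rwa [h]
  refine ContinuousLinearMap.ext fun w => ?_
  rw [sum_apply]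
  conv_rhs => rw [pi_eq_sum_univ' w, map_sum]
  refine Finset.sum_congr rfl fun i _ => ?_
  simp [hpd, mul_comm]

/-- A function with continuous partial derivatives is of class `C¹`. -/
lemma C1.isC (hf : C1 f) : IsC 1 f := by
  choose φ hφ hφ0 hφ1 using fun n : ℕ => hf.exists_smooth_approx (ε := 1 / ((n:ℝ) + 1))
    (by positivity)
  have hlim := tendsto_one_div_add_atTop_nhds_zero_nat (𝕜 := ℝ)
  let P : ι → ((ι → ℝ) →L[ℝ] ℝ) := fun i => ContinuousLinearMap.proj i
  have hder : ∀ v, HasFDerivAt (lift f) (∑ i, pd i f (toTorus v) • P i) v := by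
    -- The differentials of the smooth approximants converge uniformly to the candidate
    -- differential, so differentiability passes to the limit.
    refine hasFDerivAt_of_tendstoUniformly (l := atTop) (f := fun n => lift (φ n))
      (f' := fun n v => ∑ i, pd i (φ n) (toTorus v) • P i) ?_
      (fun n v => ((hφ n).of_le (by simp)).hasFDerivAt_lift v) (fun v => ?_)
    · rw [Metric.tendstoUniformly_iff]
      intro ε hε
      have h1 : Tendsto (fun n : ℕ => 1 / ((n:ℝ) + 1) * ∑ i, ‖P i‖) atTop (𝓝 0) := by
        simpa using hlim.mul_const (∑ i, ‖P i‖)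
      filter_upwards [h1.eventually (gt_mem_nhds hε)] with n hn v
      refine lt_of_le_of_lt ?_ hn
      rw [dist_eq_norm, ← Finset.sum_sub_distrib, Finset.mul_sum]
      refine norm_sum_le_of_le _ fun i _ => ?_
      rw [← sub_smul, norm_smul, Real.norm_eq_abs, abs_sub_comm]
      exact mul_le_mul_of_nonneg_right (hφ1 n i _) (norm_nonneg _)
    · rw [tendsto_iff_dist_tendsto_zero]
      exact squeeze_zero (fun _ => dist_nonneg) (fun n => hφ0 n (toTorus v)) hlim
  have hfd : fderiv ℝ (lift f) = fun v => ∑ i, pd i f (toTorus v) • P i :=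
    funext fun v => (hder v).fderiv
  refine contDiff_one_iff_fderiv.2 ⟨fun v => (hder v).differentiableAt, ?_⟩
  rw [hfd]
  exact continuous_finsetSum _ fun i _ =>
    ((hf.continuous_pd i).comp continuous_toTorus).smul continuous_const

end Mollification

/-! ### Fourier series and the sharp Poincaré inequality -/

section Poincare

variable {ι : Type} [Fintype ι]

open UnitAddTorus

/-- Parseval's identity for continuous functions on the torus. -/
lemma hasSum_sq_norm_integral_mFourier {f : UnitAddTorus ι → ℂ} (hf : Continuous f) :
    HasSum (fun n : ι → ℤ => ‖∫ z, mFourier (-n) z * f z‖ ^ 2) (∫ z, ‖f z‖ ^ 2) := by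
  have hμ : (Measure.pi fun _ : ι => AddCircle.haarAddCircle : Measure (UnitAddTorus ι))
      = volume := by
    have h : (AddCircle.haarAddCircle : Measure UnitAddCircle) = volume := by
      simp [AddCircle.volume_eq_smul_haarAddCircle]
    rw [h]; rfl
  rw [← hμ]
  have hmem : MemLp f 2 (Measure.pi fun _ : ι => AddCircle.haarAddCircle) := by
    obtain ⟨C, hC⟩ := isCompact_univ.exists_bound_of_continuousOn hf.continuousOn
    exact MemLp.of_bound hf.aestronglyMeasurable C (ae_of_all _ fun z => hC z (mem_univ z))
  have h : HasSum (fun n : ι → ℤ => ‖∫ z, mFourier (-n) z • hmem.toLp f z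
      ∂(Measure.pi fun _ : ι => AddCircle.haarAddCircle)‖ ^ 2)
      (∫ z, ‖hmem.toLp f z‖ ^ 2 ∂(Measure.pi fun _ : ι => AddCircle.haarAddCircle)) :=
    hasSum_sq_mFourierCoeff (hmem.toLp f)
  have hae := hmem.coeFn_toLp
  have e1 : ∀ n : ι → ℤ, ∫ z, mFourier (-n) z • hmem.toLp f z
      ∂(Measure.pi fun _ : ι => AddCircle.haarAddCircle)
      = ∫ z, mFourier (-n) z * f z ∂(Measure.pi fun _ : ι => AddCircle.haarAddCircle) := by
    intro n
    refine integral_congr_ae ?_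
    filter_upwards [hae] with z hz
    rw [hz, smul_eq_mul]
  have e2 : ∫ z, ‖hmem.toLp f z‖ ^ 2 ∂(Measure.pi fun _ : ι => AddCircle.haarAddCircle)
      = ∫ z, ‖f z‖ ^ 2 ∂(Measure.pi fun _ : ι => AddCircle.haarAddCircle) := by
    refine integral_congr_ae ?_
    filter_upwards [hae] with z hz
    rw [hz]
  rw [e2] at h
  simpa only [e1] using h

lemma mFourier_add_right (n : ι → ℤ) (z w : UnitAddTorus ι) :
    mFourier n (z + w) = mFourier n z * mFourier n w := by
  simp [mFourier, Finset.prod_mul_distrib, fourier_apply, AddCircle.toCircle_add]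

variable [DecidableEq ι]

lemma mFourier_coe_single (n : ι → ℤ) (i : ι) (s : ℝ) :
    mFourier n (Pi.single i (s : UnitAddCircle))
      = Complex.exp (2 * Real.pi * Complex.I * n i * s) := by
  simp only [mFourier, ContinuousMap.coe_mk]
  rw [Finset.prod_eq_single i]
  · rw [Pi.single_eq_same, fourier_coe_apply]
    simp
  · intro j _ hj
    simp [Pi.single_eq_of_ne hj]
  · simp

/-- By translation invariance, the n-th Fourier coefficient of u translated by s along the i-th axis
is exp(2πi nᵢ s) times that of u. The claim is the derivative of this identity at s = 0. -/
lemma integral_mFourier_mul_pd {u : UnitAddTorus ι → ℝ} (hu : C1 u) (n : ι → ℤ) (i : ι) :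
    ∫ z, mFourier (-n) z * (pd i u z : ℂ)
      = 2 * Real.pi * Complex.I * n i * ∫ z, mFourier (-n) z * (u z : ℂ) := by
  obtain ⟨C, -, hC⟩ := exists_bound_of_continuous (hu.continuous_pd i)
  have hcF : Continuous fun z : UnitAddTorus ι => mFourier (-n) z := (mFourier (-n)).continuous
  have hshift : ∀ s : ℝ, Continuous fun z : UnitAddTorus ι =>
      z + Pi.single i (s : UnitAddCircle) := fun s => continuous_id.add continuous_const
  have hc : ∀ s : ℝ, Continuous fun z : UnitAddTorus ι =>
      mFourier (-n) z * (u (z + Pi.single i (s : UnitAddCircle)) : ℂ) := fun s =>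
    hcF.mul (Complex.continuous_ofReal.comp (hu.continuous.comp (hshift s)))
  have hc' : ∀ s : ℝ, Continuous fun z : UnitAddTorus ι =>
      mFourier (-n) z * (pd i u (z + Pi.single i (s : UnitAddCircle)) : ℂ) := fun s =>
    hcF.mul (Complex.continuous_ofReal.comp ((hu.continuous_pd i).comp (hshift s)))
  have hint : Integrable fun z : UnitAddTorus ι =>
      mFourier (-n) z * (u (z + Pi.single i ((0:ℝ) : UnitAddCircle)) : ℂ) :=
    (hc 0).integrable_of_hasCompactSupport (HasCompactSupport.of_compactSpace _)
  have hb : ∀ (z : UnitAddTorus ι) (s : ℝ),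
      ‖mFourier (-n) z * (pd i u (z + Pi.single i (s : UnitAddCircle)) : ℂ)‖ ≤ C := by
    intro z s
    rw [norm_mul, Complex.norm_real]
    have h1 : ‖mFourier (-n) z‖ ≤ 1 := by
      simpa [mFourier_norm] using (mFourier (-n)).norm_coe_le_norm z
    calc ‖mFourier (-n) z‖ * ‖pd i u (z + Pi.single i (s : UnitAddCircle))‖
        ≤ 1 * C := mul_le_mul h1 (hC _) (norm_nonneg _) zero_le_one
      _ = C := one_mul C
  have hd : ∀ (z : UnitAddTorus ι) (s : ℝ), HasDerivAt (fun s : ℝ =>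
      mFourier (-n) z * (u (z + Pi.single i (s : UnitAddCircle)) : ℂ))
      (mFourier (-n) z * (pd i u (z + Pi.single i (s : UnitAddCircle)) : ℂ)) s := by
    intro z s
    exact ((hu.hasDerivAt_shift i z s).ofReal_comp).const_mul _
  have h := (hasDerivAt_integral_of_dominated_loc_of_deriv_le (s := univ) univ_mem
    (Eventually.of_forall fun s => (hc s).aestronglyMeasurable) hint
    (hc' 0).aestronglyMeasurable (ae_of_all _ fun z s _ => hb z s) (integrable_const C)
    (ae_of_all _ fun z s _ => hd z s)).2
  have htrans : (fun s : ℝ => ∫ z : UnitAddTorus ι,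
      mFourier (-n) z * (u (z + Pi.single i (s : UnitAddCircle)) : ℂ))
      = fun s : ℝ => Complex.exp (2 * Real.pi * Complex.I * n i * s)
        * ∫ z, mFourier (-n) z * (u z : ℂ) := by
    funext s
    rw [← integral_const_mul, ← integral_add_right_eq_self
      (fun z => Complex.exp (2 * Real.pi * Complex.I * n i * s) * (mFourier (-n) z * (u z : ℂ)))
      (Pi.single i (s : UnitAddCircle))]
    refine integral_congr_ae (ae_of_all _ fun z => ?_)
    beta_reduce
    rw [mFourier_add_right, mFourier_coe_single]
    have : Complex.exp (2 * Real.pi * Complex.I * n i * s)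
        * Complex.exp (2 * Real.pi * Complex.I * ((-n) i : ℤ) * s) = 1 := by
      rw [← Complex.exp_add]
      simp
    linear_combination
      (- mFourier (-n) z * (u (z + Pi.single i (s : UnitAddCircle)) : ℂ)) * this
  rw [htrans] at h
  have hexp : HasDerivAt (fun s : ℝ => Complex.exp (2 * Real.pi * Complex.I * n i * s)
      * ∫ z, mFourier (-n) z * (u z : ℂ))
      (2 * Real.pi * Complex.I * n i * ∫ z, mFourier (-n) z * (u z : ℂ)) 0 := by
    have h1 : HasDerivAt (fun s : ℝ => 2 * Real.pi * Complex.I * n i * (s : ℂ))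
        (2 * Real.pi * Complex.I * n i) 0 := by
      simpa using ((hasDerivAt_id (0:ℝ)).ofReal_comp).const_mul (2 * Real.pi * Complex.I * n i)
    simpa using h1.cexp.mul_const (∫ z, mFourier (-n) z * (u z : ℂ))
  have h4 := h.unique hexp
  rw [← h4]
  simp

/-- The Poincaré inequality on the torus, with the sharp constant. -/
lemma C1.poincare {u : UnitAddTorus ι → ℝ} (hu : C1 u) (h0 : ∫ z, u z = 0) :
    4 * Real.pi ^ 2 * ∫ z, u z ^ 2 ≤ ∫ z, ∑ i, pd i u z ^ 2 := by
  have e : ∀ {f : UnitAddTorus ι → ℝ}, Continuous f → HasSum (fun n : ι → ℤ =>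
      ‖∫ z, mFourier (-n) z * (f z : ℂ)‖ ^ 2) (∫ z, f z ^ 2) := by
    intro f hf
    have := hasSum_sq_norm_integral_mFourier (Complex.continuous_ofReal.comp hf)
    simpa using! this
  have h1 := (e hu.continuous).mul_left (4 * Real.pi ^ 2)
  have h2 : HasSum (fun n : ι → ℤ => ∑ i, ‖∫ z, mFourier (-n) z * (pd i u z : ℂ)‖ ^ 2)
      (∑ i, ∫ z, pd i u z ^ 2) := hasSum_sum fun i _ => e (hu.continuous_pd i)
  have h3 : ∫ z, ∑ i, pd i u z ^ 2 = ∑ i, ∫ z, pd i u z ^ 2 :=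
    integral_finsetSum _ fun i _ =>
      integrable_of_continuous (f := fun z => pd i u z ^ 2) ((hu.continuous_pd i).pow 2)
  rw [h3]
  refine hasSum_le (fun n => ?_) h1 h2
  simp only [integral_mFourier_mul_pd hu, norm_mul, mul_pow]
  simp only [Complex.norm_real, Complex.norm_I, Complex.norm_ofNat, Complex.norm_intCast,
    Real.norm_eq_abs, sq_abs, one_pow, mul_one]
  rw [← Finset.sum_mul]
  -- The zero mode is killed by the zero mean; any other frequency has a nonzero integer coordinate,
  -- whose square is at least one.
  by_cases hn : n = 0
  · have : ∫ z, mFourier (-n) z * (u z : ℂ) = 0 := by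
      simp only [hn, neg_zero, mFourier_zero, ContinuousMap.one_apply, one_mul]
      rw [integral_complex_ofReal, h0]; simp
    simp [this]
  · refine mul_le_mul_of_nonneg_right ?_ (sq_nonneg _)
    obtain ⟨i, hi⟩ := Function.ne_iff.1 hn
    have hi1 : (1:ℝ) ≤ (n i : ℝ) ^ 2 := by
      have : (1:ℤ) ≤ n i ^ 2 := by
        have := sq_nonneg (n i)
        have h' : n i ^ 2 ≠ 0 := pow_ne_zero _ hi
        omega
      exact_mod_cast this
    calc 4 * Real.pi ^ 2 ≤ 2 ^ 2 * Real.pi ^ 2 * (n i : ℝ) ^ 2 := by nlinarith [sq_nonneg Real.pi]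
      _ ≤ _ := Finset.single_le_sum (f := fun i => 2 ^ 2 * Real.pi ^ 2 * (n i : ℝ) ^ 2)
        (fun j _ => by positivity) (Finset.mem_univ i)

end Poincare

/-! ### Weak continuity equations and the time derivative of convex functionals -/

section WeakFlow

variable {ι : Type} [Fintype ι] [DecidableEq ι]

/-- `q` is a family of `C¹` functions solving `∂ₜ q = - ∇ · J` in the weak sense at positive
times. -/
structure WeakFlow (q : ℝ → UnitAddTorus ι → ℝ) (J : ℝ → UnitAddTorus ι → ι → ℝ) : Prop where
  c1 : ∀ t, 0 < t → C1 (q t)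
  continuousOn : ContinuousOn (fun r : ℝ × UnitAddTorus ι => q r.1 r.2) (Ioi 0 ×ˢ univ)
  continuousOn_pd : ∀ i, ContinuousOn (fun r : ℝ × UnitAddTorus ι => pd i (q r.1) r.2)
    (Ioi 0 ×ˢ univ)
  integrable : ∀ t, 0 < t → ∀ i, Integrable (fun z => J t z i)
  bound : ∀ t, 0 < t → ∃ C r, 0 < r ∧ ∀ s ∈ Metric.ball t r, 0 < s ∧
    ∑ i, ∫ z, |J s z i| ≤ C
  equation : ∀ φ : UnitAddTorus ι → ℝ, IsC ∞ φ → ∀ t, 0 < t →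
    HasDerivAt (fun s => ∫ z, φ z * q s z) (∫ z, ∑ i, pd i φ z * J t z i) t

variable {q : ℝ → UnitAddTorus ι → ℝ} {J : ℝ → UnitAddTorus ι → ι → ℝ}

lemma integrable_continuous_mul {f g : UnitAddTorus ι → ℝ} (hf : Continuous f)
    (hg : Integrable g) : Integrable (fun z => f z * g z) := by
  obtain ⟨C, -, hC⟩ := exists_bound_of_continuous hf
  exact hg.bdd_mul hf.aestronglyMeasurable (ae_of_all _ hC)

lemma abs_integral_sum_mul_le {f g : UnitAddTorus ι → ι → ℝ} {η : ℝ}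
    (hf : ∀ z i, |f z i| ≤ η) (hg : ∀ i, Integrable (fun z => g z i)) :
    |∫ z, ∑ i, f z i * g z i| ≤ η * ∑ i, ∫ z, |g z i| := by
  have hint : Integrable fun z => ∑ i, η * |g z i| :=
    integrable_finsetSum _ fun i _ => (hg i).abs.const_mul η
  have h := norm_integral_le_of_norm_le (f := fun z => ∑ i, f z i * g z i) hint
    (ae_of_all _ fun z => norm_sum_le_of_le _ fun i _ => by
      rw [norm_mul]
      exact mul_le_mul_of_nonneg_right (hf z i) (norm_nonneg _))
  rw [integral_finsetSum _ fun i _ => (hg i).abs.const_mul η] at h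
  simpa only [integral_const_mul, ← Finset.mul_sum, Real.norm_eq_abs] using h

lemma WeakFlow.integrable_pd_mul (h : WeakFlow q J) {ψ : UnitAddTorus ι → ℝ} (hψ : C1 ψ) {t : ℝ}
    (ht : 0 < t) (i : ι) : Integrable fun z => pd i ψ z * J t z i :=
  integrable_continuous_mul (hψ.continuous_pd i) (h.integrable t ht i)

/-- The weak equation holds for test functions of class `C¹`. -/
lemma WeakFlow.hasDerivAt_integral_mul (h : WeakFlow q J) {ψ : UnitAddTorus ι → ℝ} (hψ : C1 ψ)
    {t : ℝ} (ht : 0 < t) :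
    HasDerivAt (fun s => ∫ z, ψ z * q s z) (∫ z, ∑ i, pd i ψ z * J t z i) t := by
  choose φ hφ hφ0 hφ1 using fun n : ℕ => hψ.exists_smooth_approx (ε := 1 / ((n:ℝ) + 1))
    (by positivity)
  have hφc : ∀ n, C1 (φ n) := fun n => ((hφ n).of_le (by simp)).c1
  have hlim := tendsto_one_div_add_atTop_nhds_zero_nat (𝕜 := ℝ)
  obtain ⟨C, r, hr, hC⟩ := h.bound t ht
  -- The time derivatives for smooth test functions converge uniformly near t, because the flux is
  -- bounded in L¹ there; the integrals themselves converge pointwise.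
  refine hasDerivAt_of_tendstoUniformlyOn (l := atTop) (s := Metric.ball t r)
    (f := fun (n : ℕ) s => ∫ z, φ n z * q s z)
    (f' := fun (n : ℕ) s => ∫ z, ∑ i, pd i (φ n) z * J s z i)
    (g := fun s => ∫ z, ψ z * q s z)
    (g' := fun s => ∫ z, ∑ i, pd i ψ z * J s z i)
    Metric.isOpen_ball ?_ ?_ ?_ (Metric.mem_ball_self hr)
  · rw [Metric.tendstoUniformlyOn_iff]
    intro ε hε
    have h1 : Tendsto (fun n : ℕ => 1 / ((n:ℝ) + 1) * C) atTop (𝓝 0) := by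
      simpa using hlim.mul_const C
    filter_upwards [h1.eventually (gt_mem_nhds hε)] with n hn s hs
    obtain ⟨hs0, hsC⟩ := hC s hs
    refine lt_of_le_of_lt ?_ hn
    rw [Real.dist_eq, ← integral_sub
      (integrable_finsetSum _ fun i _ => h.integrable_pd_mul hψ hs0 i)
      (integrable_finsetSum _ fun i _ => h.integrable_pd_mul (hφc n) hs0 i)]
    simp only [← Finset.sum_sub_distrib, ← sub_mul]
    refine (abs_integral_sum_mul_le (η := 1 / ((n:ℝ) + 1)) (fun z i => ?_)
      (h.integrable s hs0)).trans ?_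
    · rw [abs_sub_comm]; exact hφ1 n i z
    · exact mul_le_mul_of_nonneg_left hsC (by positivity)
  · exact Eventually.of_forall fun n s hs => h.equation (φ n) (hφ n) s (hC s hs).1
  · intro s hs
    have hs0 := (hC s hs).1
    have hqi : Integrable (fun z => |q s z|) :=
      (integrable_of_continuous (h.c1 s hs0).continuous).abs
    rw [tendsto_iff_dist_tendsto_zero]
    refine squeeze_zero (fun _ => dist_nonneg) (g := fun n : ℕ =>
      1 / ((n:ℝ) + 1) * ∫ z, |q s z|) (fun n => ?_) (by simpa using hlim.mul_const _)
    rw [Real.dist_eq, ← integral_sub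
      (integrable_of_continuous (f := fun z => φ n z * q s z)
        ((hφc n).continuous.mul (h.c1 s hs0).continuous))
      (integrable_of_continuous (f := fun z => ψ z * q s z)
        (hψ.continuous.mul (h.c1 s hs0).continuous)), ← integral_const_mul]
    refine norm_integral_le_of_norm_le (f := fun z => φ n z * q s z - ψ z * q s z)
      (hqi.const_mul _) (ae_of_all _ fun z => ?_)
    rw [← sub_mul, norm_mul]
    exact mul_le_mul_of_nonneg_right (hφ0 n z) (norm_nonneg _)

/-- The functions `∫ ψ q` are locally Lipschitz in time, in terms of `sup |∇ψ|`. -/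
lemma WeakFlow.exists_abs_integral_mul_sub_le (h : WeakFlow q J) {t : ℝ} (ht : 0 < t) :
    ∃ C r, 0 < r ∧ 0 ≤ C ∧ ∀ s ∈ Metric.ball t r, 0 < s ∧ ∀ (ψ : UnitAddTorus ι → ℝ) (η : ℝ),
      C1 ψ → 0 ≤ η → (∀ z i, |pd i ψ z| ≤ η) →
      |∫ z, ψ z * (q s z - q t z)| ≤ C * η * |s - t| := by
  obtain ⟨C, r, hr, hC⟩ := h.bound t ht
  have hC0 : 0 ≤ C := le_trans
    (Finset.sum_nonneg fun i _ => integral_nonneg fun z => abs_nonneg _)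
    (hC t (Metric.mem_ball_self hr)).2
  refine ⟨C, r, hr, hC0, fun s hs => ⟨(hC s hs).1, fun ψ η hψ hη hb => ?_⟩⟩
  have hder : ∀ x ∈ Metric.ball t r, HasDerivWithinAt (fun s => ∫ z, ψ z * q s z)
      (∫ z, ∑ i, pd i ψ z * J x z i) (Metric.ball t r) x :=
    fun x hx => (h.hasDerivAt_integral_mul hψ (hC x hx).1).hasDerivWithinAt
  have hbd : ∀ x ∈ Metric.ball t r, ‖∫ z, ∑ i, pd i ψ z * J x z i‖ ≤ C * η := by
    intro x hx
    refine (abs_integral_sum_mul_le hb (h.integrable x (hC x hx).1)).trans ?_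
    rw [mul_comm C]
    exact mul_le_mul_of_nonneg_left (hC x hx).2 hη
  have := (convex_ball t r).norm_image_sub_le_of_norm_hasDerivWithin_le hder hbd
    (Metric.mem_ball_self hr) hs
  rw [← integral_sub
      (integrable_of_continuous (f := fun z => ψ z * q s z)
        (hψ.continuous.mul (h.c1 s (hC s hs).1).continuous))
      (integrable_of_continuous (f := fun z => ψ z * q t z)
        (hψ.continuous.mul (h.c1 t ht).continuous))] at this
  simpa only [← mul_sub, Real.norm_eq_abs] using this

/-- Time derivative of a convex functional along a weak flow. -/
lemma WeakFlow.hasDerivAt_integral_comp (h : WeakFlow q J) {Φ g g' : ℝ → ℝ} {S : Set ℝ}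
    (hS : ∀ t, 0 < t → ∀ z, q t z ∈ S)
    (hconv : ∀ a ∈ S, ∀ b ∈ S, g a * (b - a) ≤ Φ b - Φ a) (hΦ : ContinuousOn Φ S)
    (hg : ∀ a ∈ S, HasDerivAt g (g' a) a) (hg' : ContinuousOn g' S) {t : ℝ} (ht : 0 < t) :
    HasDerivAt (fun s => ∫ z, Φ (q s z))
      (∫ z, ∑ i, g' (q t z) * pd i (q t) z * J t z i) t := by
  have hgc : ContinuousOn g S := fun x hx => (hg x hx).continuousAt.continuousWithinAt
  have hcomp := fun s (hs : 0 < s) => (h.c1 s hs).comp_aux (hS s hs) hg hg'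
  have h1 := h.hasDerivAt_integral_mul (hcomp t ht).1 ht
  simp only [(hcomp t ht).2] at h1
  obtain ⟨C, r, hr, hC0, hC⟩ := h.exists_abs_integral_mul_sub_le ht
  -- Joint continuity and compactness of the torus make the gradient of g(q s) converge uniformly to
  -- that of g(q t) as s tends to t.
  have hunif : ∀ i, TendstoUniformly (fun s z => g' (q s z) * pd i (q s) z)
      (fun z => g' (q t z) * pd i (q t) z) (𝓝 t) := by
    intro i
    refine ContinuousOn.tendstoUniformly (U := Ioi 0)
      (f := fun s z => g' (q s z) * pd i (q s) z) (Ioi_mem_nhds ht) ?_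
    refine ContinuousOn.mul (hg'.comp h.continuousOn fun r hr => hS _ hr.1 _) (h.continuousOn_pd i)
  -- Convexity places Φ(q s) - Φ(q t) - g(q t)(q s - q t) between 0 and (g(q s) - g(q t))(q s - q
  -- t). The integral of the upper bound tests q s - q t against a function with small gradient, so
  -- the Lipschitz estimate makes it o(s - t). No pointwise time derivative of q is needed.
  have hsmall : (fun s => (∫ z, Φ (q s z)) - (∫ z, Φ (q t z))
      - ((∫ z, g (q t z) * q s z) - ∫ z, g (q t z) * q t z)) =o[𝓝 t] fun s => s - t := by
    rw [Asymptotics.isLittleO_iff]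
    intro c hc
    have hη : 0 < c / (C + 1) := by positivity
    have hev : ∀ᶠ s in 𝓝 t, ∀ i z,
        |g' (q s z) * pd i (q s) z - g' (q t z) * pd i (q t) z| ≤ c / (C + 1) := by
      rw [eventually_all]
      intro i
      filter_upwards [Metric.tendstoUniformly_iff.1 (hunif i) _ hη] with s hs z
      have := (hs z).le
      rwa [dist_comm, Real.dist_eq] at this
    filter_upwards [hev, Metric.ball_mem_nhds t hr] with s hs hsr
    obtain ⟨hs0, hsC⟩ := hC s hsr
    have hψ := (hcomp s hs0).1.sub (hcomp t ht).1
    have hest := hsC _ (c / (C + 1)) hψ hη.le (fun z i => by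
      rw [(hcomp s hs0).1.pd_sub (hcomp t ht).1, (hcomp s hs0).2, (hcomp t ht).2]
      exact hs i z)
    have cs := (h.c1 s hs0).continuous
    have ct := (h.c1 t ht).continuous
    have cgs := (hcomp s hs0).1.continuous
    have cgt := (hcomp t ht).1.continuous
    have cΦs : Continuous fun z => Φ (q s z) := hΦ.comp_continuous cs (hS s hs0)
    have cΦt : Continuous fun z => Φ (q t z) := hΦ.comp_continuous ct (hS t ht)
    have i1 : Integrable fun z => Φ (q s z) - Φ (q t z) :=
      integrable_of_continuous (cΦs.sub cΦt)
    have i2 : Integrable fun z => g (q t z) * q s z - g (q t z) * q t z :=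
      integrable_of_continuous ((cgt.mul cs).sub (cgt.mul ct))
    have i3 : Integrable fun z => (g (q s z) - g (q t z)) * (q s z - q t z) :=
      integrable_of_continuous ((cgs.sub cgt).mul (cs.sub ct))
    have e1 : (∫ z, Φ (q s z)) - (∫ z, Φ (q t z))
        - ((∫ z, g (q t z) * q s z) - ∫ z, g (q t z) * q t z)
        = ∫ z, ((Φ (q s z) - Φ (q t z)) - (g (q t z) * q s z - g (q t z) * q t z)) := by
      rw [integral_sub i1 i2, integral_sub (integrable_of_continuous cΦs)
        (integrable_of_continuous cΦt), integral_sub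
        (integrable_of_continuous (f := fun z => g (q t z) * q s z) (cgt.mul cs))
        (integrable_of_continuous (f := fun z => g (q t z) * q t z) (cgt.mul ct))]
    have hlow : 0 ≤ ∫ z, ((Φ (q s z) - Φ (q t z)) - (g (q t z) * q s z - g (q t z) * q t z)) := by
      refine integral_nonneg fun z => ?_
      have := hconv (q t z) (hS t ht z) (q s z) (hS s hs0 z)
      simp only [Pi.zero_apply]
      linarith
    have hup : ∫ z, ((Φ (q s z) - Φ (q t z)) - (g (q t z) * q s z - g (q t z) * q t z))
        ≤ ∫ z, (g (q s z) - g (q t z)) * (q s z - q t z) := by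
      refine integral_mono (i1.sub i2) i3 fun z => ?_
      have := hconv (q s z) (hS s hs0 z) (q t z) (hS t ht z)
      simp only
      linarith
    rw [e1, Real.norm_of_nonneg hlow, Real.norm_eq_abs]
    refine hup.trans ((le_abs_self _).trans (hest.trans ?_))
    refine mul_le_mul_of_nonneg_right ?_ (abs_nonneg _)
    rw [mul_div_assoc', div_le_iff₀ (by positivity)]
    nlinarith
  rw [hasDerivAt_iff_isLittleO] at h1 ⊢
  refine (hsmall.add h1).congr_left fun s => ?_
  ring

lemma continuousOn_integral_Ici {h : ℝ → UnitAddTorus ι → ℝ}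
    (hh : ContinuousOn (fun r : ℝ × UnitAddTorus ι => h r.1 r.2) (Ici 0 ×ˢ univ)) :
    ContinuousOn (fun t => ∫ z, h t z) (Ici 0) := by
  have h1 : Continuous (Function.uncurry fun (t : ℝ) (z : UnitAddTorus ι) => h (max t 0) z) := by
    refine hh.comp_continuous (f := fun r : ℝ × UnitAddTorus ι => (max r.1 0, r.2))
      (by fun_prop) (fun r => ⟨mem_Ici.2 (le_max_right r.1 0), mem_univ _⟩)
  have h2 := continuous_parametric_integral_of_continuous
    (μ := (volume : Measure (UnitAddTorus ι))) h1 isCompact_univ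
  simp only [Measure.restrict_univ] at h2
  refine h2.continuousOn.congr fun t ht => ?_
  simp only [max_eq_left (mem_Ici.1 ht)]

end WeakFlow

/-! ### Relative entropy and logarithmic Sobolev inequalities in terms of densities -/

section Entropy

variable {ι : Type} [Fintype ι] [DecidableEq ι]

lemma klDiv_withDensity_ofReal (ν : Measure (UnitAddTorus ι)) [IsFiniteMeasure ν]
    {f : UnitAddTorus ι → ℝ} (hf : Continuous f) (h0 : ∀ z, 0 ≤ f z) :
    klDiv (ν.withDensity (fun z => ENNReal.ofReal (f z))) ν
      = ENNReal.ofReal (∫ z, klFun (f z) ∂ν) := by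
  have hm : Measurable fun z => ENNReal.ofReal (f z) := hf.measurable.ennreal_ofReal
  have hint : ∀ {g : UnitAddTorus ι → ℝ}, Continuous g → Integrable g ν := fun hg =>
    hg.integrable_of_hasCompactSupport (HasCompactSupport.of_compactSpace _)
  have : IsFiniteMeasure (ν.withDensity (fun z => ENNReal.ofReal (f z))) :=
    isFiniteMeasure_withDensity_ofReal (hint hf).2
  rw [klDiv_eq_lintegral_klFun_of_ac (withDensity_absolutelyContinuous _ _),
    ofReal_integral_eq_lintegral_ofReal (f := fun z => klFun (f z))
      (hint (continuous_klFun.comp hf))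
      (ae_of_all _ fun z => klFun_nonneg (h0 z))]
  refine lintegral_congr_ae ?_
  filter_upwards [Measure.rnDeriv_withDensity ν hm] with z hz
  rw [hz, ENNReal.toReal_ofReal (h0 z)]

lemma isFiniteMeasure_densityMeasure {w : UnitAddTorus ι → ℝ} (hw : Continuous w) :
    IsFiniteMeasure (densityMeasure w) :=
  isFiniteMeasure_withDensity_ofReal (integrable_of_continuous hw).2

lemma integral_densityMeasure {w : UnitAddTorus ι → ℝ} (hw : Continuous w) (h0 : ∀ z, 0 ≤ w z)
    (f : UnitAddTorus ι → ℝ) : ∫ z, f z ∂(densityMeasure w) = ∫ z, w z * f z := by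
  rw [densityMeasure, integral_withDensity_eq_integral_toReal_smul
    hw.measurable.ennreal_ofReal (ae_of_all _ fun z => ENNReal.ofReal_lt_top)]
  simp [ENNReal.toReal_ofReal (h0 _)]

lemma klDiv_densityMeasure {p w : UnitAddTorus ι → ℝ} (hp : Continuous p) (hw : Continuous w)
    (hp0 : ∀ z, 0 ≤ p z) (hw0 : ∀ z, 0 < w z) :
    klDiv (densityMeasure p) (densityMeasure w)
      = ENNReal.ofReal (∫ z, w z * klFun (p z / w z)) := by
  have := isFiniteMeasure_densityMeasure hw
  have hc : Continuous fun z => p z / w z := hp.div hw fun z => (hw0 z).ne'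
  have e : densityMeasure p
      = (densityMeasure w).withDensity (fun z => ENNReal.ofReal (p z / w z)) := by
    rw [densityMeasure, densityMeasure, ← withDensity_mul _ hw.measurable.ennreal_ofReal
      hc.measurable.ennreal_ofReal]
    congr 1
    funext z
    rw [Pi.mul_apply, ← ENNReal.ofReal_mul (hw0 z).le, mul_div_cancel₀ _ (hw0 z).ne']
  rw [e, klDiv_withDensity_ofReal _ hc (fun z => div_nonneg (hp0 z) (hw0 z).le),
    integral_densityMeasure hw fun z => (hw0 z).le]

/-- The form in which `LSI` is proved and used: real integrals of `C1` functions, with |∇ ln f|² f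
rewritten as |∇f|²/f. -/
lemma lsi_densityMeasure_iff {w : UnitAddTorus ι → ℝ} (hw : Continuous w) (hw0 : ∀ z, 0 < w z)
    {ρ : ℝ} (hρ : 0 < ρ) :
    LSI (densityMeasure w) ρ ↔ ∀ f, C1 f → (∀ z, 0 < f z) → ∫ z, w z * f z = 1 →
      ∫ z, w z * klFun (f z) ≤
        1 / (2 * ρ) * ∫ z, w z * ∑ i, (pd i f z) ^ 2 / f z := by
  have := isFiniteMeasure_densityMeasure hw
  have hfi : ∀ f : UnitAddTorus ι → ℝ, C1 f → (∀ z, 0 < f z) →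
      fisherInformation f (densityMeasure w) = ∫ z, w z * ∑ i, (pd i f z) ^ 2 / f z := by
    intro f hf hf0
    rw [fisherInformation, integral_densityMeasure hw fun z => (hw0 z).le]
    refine integral_congr_ae (ae_of_all _ fun z => ?_)
    simp only [hf.pd_log hf0, Finset.sum_mul]
    congr 1
    refine Finset.sum_congr rfl fun i _ => ?_
    have := (hf0 z).ne'
    field_simp
  have hnn : ∀ f : UnitAddTorus ι → ℝ, (∀ z, 0 < f z) →
      0 ≤ 1 / (2 * ρ) * ∫ z, w z * ∑ i, (pd i f z) ^ 2 / f z := by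
    intro f hf0
    refine mul_nonneg (by positivity) (integral_nonneg fun z => mul_nonneg (hw0 z).le ?_)
    exact Finset.sum_nonneg fun i _ => div_nonneg (sq_nonneg _) (hf0 z).le
  have key : ∀ f : UnitAddTorus ι → ℝ, C1 f → (∀ z, 0 < f z) →
      (klDiv ((densityMeasure w).withDensity (fun z => ENNReal.ofReal (f z))) (densityMeasure w)
        ≤ ENNReal.ofReal (1 / (2 * ρ) * fisherInformation f (densityMeasure w)) ↔
      ∫ z, w z * klFun (f z) ≤ 1 / (2 * ρ) * ∫ z, w z * ∑ i, (pd i f z) ^ 2 / f z) := by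
    intro f hf hf0
    rw [klDiv_withDensity_ofReal _ hf.continuous fun z => (hf0 z).le, hfi f hf hf0,
      ENNReal.ofReal_le_ofReal_iff (hnn f hf0), integral_densityMeasure hw fun z => (hw0 z).le]
  constructor
  · intro h f hf hf0 h1
    exact (key f hf hf0).1 (h f hf.isC hf0
      (by rw [integral_densityMeasure hw fun z => (hw0 z).le, h1]))
  · intro h f hf hf0 h1
    rw [integral_densityMeasure hw fun z => (hw0 z).le] at h1
    exact (key f hf.c1 hf0).2 (h f hf.c1 hf0 h1)

/-- Cauchy–Schwarz with weight g, from expanding ∫ (f - l g)²/g ≥ 0 at the optimal l = ∫ f / ∫ g. -/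
lemma sq_integral_le {f g : UnitAddTorus ι → ℝ} (hf : Continuous f) (hg : Continuous g)
    (hg0 : ∀ z, 0 < g z) : (∫ z, f z) ^ 2 ≤ (∫ z, g z) * ∫ z, f z ^ 2 / g z := by
  have hG : 0 < ∫ z, g z := by
    refine (integral_pos_iff_support_of_nonneg (fun y => (hg0 y).le)
      (integrable_of_continuous hg)).2 ?_
    rw [show Function.support g = univ from Set.eq_univ_of_forall fun y => (hg0 y).ne']
    simp
  set l := (∫ z, f z) / ∫ z, g z with hl
  have c1 : Continuous fun z => f z ^ 2 / g z := (hf.pow 2).div hg fun z => (hg0 z).ne'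
  have h : 0 ≤ ∫ z, (f z ^ 2 / g z - 2 * l * f z + l ^ 2 * g z) := by
    refine integral_nonneg fun z => ?_
    have h0 := hg0 z
    have : f z ^ 2 / g z - 2 * l * f z + l ^ 2 * g z = (f z - l * g z) ^ 2 / g z := by
      field_simp
      ring
    simp only [Pi.zero_apply, this]
    positivity
  rw [integral_add (f := fun z => f z ^ 2 / g z - 2 * l * f z)
    (integrable_of_continuous (c1.sub (continuous_const.mul hf)))
    ((integrable_of_continuous hg).const_mul _),
    integral_sub (integrable_of_continuous c1) ((integrable_of_continuous hf).const_mul _),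
    integral_const_mul, integral_const_mul] at h
  have e : l * ∫ z, g z = ∫ z, f z := by rw [hl]; field_simp
  have e2 : (∫ z, f z) ^ 2 = (l * ∫ z, f z) * ∫ z, g z := by
    nth_rewrite 2 [← e]
    rw [← e]; ring
  have e3 : l ^ 2 * ∫ z, g z = l * ∫ z, f z := by rw [← e]; ring
  rw [e3] at h
  rw [e2, mul_comm]
  exact mul_le_mul_of_nonneg_left (by linarith) hG.le

end Entropy

/-! ### Logarithmic Sobolev inequality on the torus: dimension one, tensorization, perturbation -/

section TorusLSI

/-- The entropy inequality `∫ f ln f - (∫ f) ln ∫ f ≤ ∫ |∇f|² / f` on the torus. -/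
def EntropyInequality (ι : Type) [Fintype ι] [DecidableEq ι] : Prop :=
  ∀ f : UnitAddTorus ι → ℝ, C1 f → (∀ z, 0 < f z) →
    (∫ z, f z * Real.log (f z)) - (∫ z, f z) * Real.log (∫ z, f z)
      ≤ ∫ z, ∑ i, (pd i f z) ^ 2 / f z

/-- On the circle f deviates from its mean M by at most A = ∫ |f'|, and A² ≤ M ∫ f'²/f by
Cauchy–Schwarz. Since ln u ≤ u - 1, the entropy of f is at most M⁻¹ ∫ (f - M)² ≤ M⁻¹A². -/
lemma entropyInequality_fin_one : EntropyInequality (Fin 1) := by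
  intro f hf hf0
  set M := ∫ z, f z with hM
  have hM0 : 0 < M := by
    refine (integral_pos_iff_support_of_nonneg (fun y => (hf0 y).le)
      (integrable_of_continuous hf.continuous)).2 ?_
    rw [show Function.support f = univ from Set.eq_univ_of_forall fun y => (hf0 y).ne']
    simp
  have hcd : Continuous fun z => |pd 0 f z| := (hf.continuous_pd 0).abs
  -- Any point is reached from x by a translation of length less than one, and the integral of the
  -- absolute derivative along a full turn bounds the increment.
  have hosc : ∀ x y, |f y - f x| ≤ ∫ z, |pd 0 f z| := by
    intro x y
    obtain ⟨s₀, hs₀⟩ := QuotientAddGroup.mk_surjective (y 0 - x 0)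
    have hs : ((Int.fract s₀ : ℝ) : UnitAddCircle) = y 0 - x 0 := by
      rw [← hs₀, Int.fract, AddCircle.coe_sub]
      simp
    have hy : y = x + Pi.single 0 ((Int.fract s₀ : ℝ) : UnitAddCircle) := by
      funext i
      rw [Subsingleton.elim i 0, hs]
      simp
    have hcd' : Continuous fun r : ℝ => pd 0 f (x + Pi.single 0 (r : UnitAddCircle)) :=
      (hf.continuous_pd 0).comp (continuous_single_shift x 0)
    have hftc := intervalIntegral.integral_eq_sub_of_hasDerivAt
      (a := 0) (b := Int.fract s₀) (fun r _ => hf.hasDerivAt_shift 0 x r)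
      (hcd'.intervalIntegrable _ _)
    have hy' : f y - f x = ∫ r in (0:ℝ)..Int.fract s₀,
        pd 0 f (x + Pi.single 0 (r : UnitAddCircle)) := by
      rw [hftc, ← hy]; simp
    have hle : |∫ r in (0:ℝ)..Int.fract s₀, pd 0 f (x + Pi.single 0 (r : UnitAddCircle))|
        ≤ ∫ r in (0:ℝ)..(0 + 1), |pd 0 f (x + Pi.single 0 (r : UnitAddCircle))| := by
      refine (intervalIntegral.abs_integral_le_integral_abs (Int.fract_nonneg _)).trans ?_
      refine intervalIntegral.integral_mono_interval le_rfl (Int.fract_nonneg _)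
        (by simpa using (Int.fract_lt_one s₀).le) (ae_of_all _ fun r => abs_nonneg _)
        (hcd'.abs.intervalIntegrable _ _)
    rw [hy']
    refine hle.trans (le_of_eq ?_)
    rw [UnitAddCircle.intervalIntegral_preimage 0
      (fun b : UnitAddCircle => |pd 0 f (x + (Pi.single 0 b : UnitAddTorus (Fin 1)))|)]
    have hmp := volume_preserving_funUnique (Fin 1) UnitAddCircle
    rw [← hmp.integral_comp (MeasurableEquiv.measurableEmbedding _)]
    rw [← integral_add_left_eq_self (fun z => |pd 0 f z|) x]
    refine integral_congr_ae (ae_of_all _ fun z => ?_)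
    have : (Pi.single 0 (z 0) : UnitAddTorus (Fin 1)) = z := by
      funext i
      rw [Subsingleton.elim i 0]; simp
    simp only [MeasurableEquiv.funUnique_apply]
    rw [show (default : Fin 1) = 0 from rfl, this]
  set A := ∫ z, |pd 0 f z| with hA
  have hdev : ∀ x, |f x - M| ≤ A := by
    intro x
    have h1 : f x - M = ∫ y, (f x - f y) := by
      rw [integral_sub (integrable_const _) (integrable_of_continuous hf.continuous)]
      simp [hM]
    rw [h1]
    have h2 := norm_integral_le_of_norm_le
      (μ := (volume : Measure (UnitAddTorus (Fin 1)))) (f := fun y => f x - f y)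
      (integrable_const A) (ae_of_all _ fun y => hosc y x)
    simpa using h2
  have hA2 : A ^ 2 ≤ M * ∫ z, ∑ i, (pd i f z) ^ 2 / f z := by
    have := sq_integral_le hcd hf.continuous hf0
    simpa [sq_abs] using this
  have hlog : ∀ z, f z * Real.log (f z) - f z * Real.log M
      ≤ M⁻¹ * (f z - M) ^ 2 + (f z - M) := by
    intro z
    rw [← mul_sub, ← Real.log_div (hf0 z).ne' hM0.ne']
    have h1 := Real.log_le_sub_one_of_pos (div_pos (hf0 z) hM0)
    have h2 := mul_le_mul_of_nonneg_left h1 (hf0 z).le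
    refine h2.trans (le_of_eq ?_)
    field_simp
    ring
  have cl : Continuous fun z => f z * Real.log (f z) :=
    hf.continuous.mul (hf.log hf0).continuous
  have cM : Continuous fun z => f z * Real.log M := hf.continuous.mul continuous_const
  have cs : Continuous fun z => M⁻¹ * (f z - M) ^ 2 :=
    continuous_const.mul ((hf.continuous.sub continuous_const).pow 2)
  have cd : Continuous fun z => f z - M := hf.continuous.sub continuous_const
  have h1 := integral_mono ((integrable_of_continuous cl).sub (integrable_of_continuous cM))
    ((integrable_of_continuous cs).add (integrable_of_continuous cd)) hlog
  simp only [Pi.sub_apply, Pi.add_apply] at h1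
  rw [integral_sub (integrable_of_continuous cl) (integrable_of_continuous cM),
    integral_mul_const, ← hM, integral_add (integrable_of_continuous cs)
    (integrable_of_continuous cd), integral_const_mul,
    integral_sub (integrable_of_continuous hf.continuous) (integrable_const _), ← hM] at h1
  have h2 : ∫ z, (f z - M) ^ 2 ≤ A ^ 2 := by
    have := integral_mono (integrable_of_continuous (f := fun z => (f z - M) ^ 2) (cd.pow 2))
      (integrable_const (μ := (volume : Measure (UnitAddTorus (Fin 1)))) (A ^ 2))
      (fun z => by
        have := hdev z
        rw [← sq_abs]
        exact pow_le_pow_left₀ (abs_nonneg _) this 2)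
    simpa using this
  have h3 : M⁻¹ * ∫ z, (f z - M) ^ 2 ≤ ∫ z, ∑ i, (pd i f z) ^ 2 / f z := by
    rw [inv_mul_le_iff₀ hM0]
    exact h2.trans hA2
  simp only [integral_const, probReal_univ, one_smul, sub_self, add_zero] at h1
  linarith

lemma entropyInequality_fin_zero : EntropyInequality (Fin 0) := by
  intro f _ _
  have h : ∀ g : UnitAddTorus (Fin 0) → ℝ, ∫ z, g z = g default := by
    intro g
    rw [show g = fun _ => g default from funext fun z => by rw [Subsingleton.elim z default]]
    simp
  simp [h]

/-- Entropy is the entropy of the marginal plus the integrated entropies of the slices. The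
inequality on the second factor is applied slice by slice, and Cauchy–Schwarz shows that taking the
marginal does not increase the Fisher information in x. -/
lemma EntropyInequality.sum {m k : ℕ} (hm : EntropyInequality (Fin m))
    (hk : EntropyInequality (Fin k)) : EntropyInequality (Fin m ⊕ Fin k) := by
  intro f hf hf0
  have hpos := marginal_pos hf.continuous hf0
  have clog : Continuous fun z => f z * Real.log (f z) :=
    hf.continuous.mul (hf.log hf0).continuous
  have cmlog : Continuous fun x => marginal f x * Real.log (marginal f x) :=
    hf.marginal.continuous.mul (hf.marginal.log hpos).continuous
  have cfi : ∀ i, Continuous fun z => (pd i f z) ^ 2 / f z := fun i =>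
    ((hf.continuous_pd i).pow 2).div hf.continuous fun z => (hf0 z).ne'
  have csy : Continuous fun z => ∑ j : Fin k, (pd (Sum.inr j) f z) ^ 2 / f z :=
    continuous_finsetSum _ fun j _ => cfi _
  have csx : Continuous fun z => ∑ j : Fin m, (pd (Sum.inl j) f z) ^ 2 / f z :=
    continuous_finsetSum _ fun j _ => cfi _
  have hmarg := hm (marginal f) hf.marginal hpos
  have hcond : ∀ x, marginal (fun z => f z * Real.log (f z)) x
      - marginal f x * Real.log (marginal f x)
      ≤ marginal (fun z => ∑ j : Fin k, (pd (Sum.inr j) f z) ^ 2 / f z) x := by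
    intro x
    have := hk _ (hf.slice x) (fun y => hf0 _)
    simp only [pd_slice] at this
    exact this
  have hI := integral_mono
    ((integrable_of_continuous (continuous_marginal clog)).sub (integrable_of_continuous cmlog))
    (integrable_of_continuous (continuous_marginal csy)) hcond
  simp only [Pi.sub_apply] at hI
  rw [integral_sub (integrable_of_continuous (continuous_marginal clog))
    (integrable_of_continuous cmlog),
    ← integral_eq_integral_marginal (integrable_of_continuous clog),
    ← integral_eq_integral_marginal (integrable_of_continuous csy)] at hI
  have hx : ∫ x, ∑ i, (pd i (marginal f) x) ^ 2 / marginal f x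
      ≤ ∫ z, ∑ j : Fin m, (pd (Sum.inl j) f z) ^ 2 / f z := by
    rw [integral_eq_integral_marginal (integrable_of_continuous csx)]
    refine integral_mono (integrable_of_continuous (continuous_finsetSum _ fun i _ =>
      ((hf.marginal.continuous_pd i).pow 2).div hf.marginal.continuous fun x => (hpos x).ne'))
      (integrable_of_continuous (continuous_marginal csx)) fun x => ?_
    have e : marginal (fun z => ∑ j : Fin m, (pd (Sum.inl j) f z) ^ 2 / f z) x
        = ∑ j : Fin m, marginal (fun z => (pd (Sum.inl j) f z) ^ 2 / f z) x :=
      integral_finsetSum _ fun j _ => integrable_of_continuous (continuous_slice (cfi _) x)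
    simp only [e]
    refine Finset.sum_le_sum fun i _ => ?_
    rw [div_le_iff₀' (hpos x), hf.pd_marginal]
    exact sq_integral_le (continuous_slice (hf.continuous_pd _) x)
      (continuous_slice hf.continuous x) (fun y => hf0 _)
  rw [← integral_eq_integral_marginal (integrable_of_continuous hf.continuous)] at hmarg
  have hsplit : ∫ z, ∑ i, (pd i f z) ^ 2 / f z
      = (∫ z, ∑ j : Fin m, (pd (Sum.inl j) f z) ^ 2 / f z)
        + ∫ z, ∑ j : Fin k, (pd (Sum.inr j) f z) ^ 2 / f z := by
    rw [← integral_add (integrable_of_continuous csx) (integrable_of_continuous csy)]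
    simp only [Fintype.sum_sum_type]
  rw [hsplit]
  linarith

lemma EntropyInequality.congr {ι ι' : Type} [Fintype ι] [DecidableEq ι] [Fintype ι']
    [DecidableEq ι'] (e : ι ≃ ι') (h : EntropyInequality ι) : EntropyInequality ι' := by
  intro f hf hf0
  let r : UnitAddTorus ι → UnitAddTorus ι' := fun z j => z (e.symm j)
  have hr : Continuous r := continuous_pi fun j => continuous_apply _
  have hmp := volume_measurePreserving_piCongrLeft (fun _ : ι' => UnitAddCircle) e
  have hre : ⇑(MeasurableEquiv.piCongrLeft (fun _ : ι' => UnitAddCircle) e) = r := by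
    funext z j
    obtain ⟨i, rfl⟩ := e.surjective j
    simp [r, MeasurableEquiv.coe_piCongrLeft, Equiv.piCongrLeft_apply_apply]
  have hint : ∀ g : UnitAddTorus ι' → ℝ, ∫ z, g (r z) = ∫ z, g z := by
    intro g
    rw [← hre]
    exact hmp.integral_comp (MeasurableEquiv.measurableEmbedding _) g
  have hs : ∀ (z : UnitAddTorus ι) i (s : UnitAddCircle),
      r (z + Pi.single i s) = r z + Pi.single (e i) s := by
    intro z i s
    funext j
    obtain ⟨i', rfl⟩ := e.surjective j
    by_cases hi : i' = i
    · subst hi; simp [r]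
    · simp [r, hi]
  have hpd : ∀ i z, pd i (fun z => f (r z)) z = pd (e i) f (r z) := by
    intro i z
    simp only [pd, hs]
  have hc : C1 (fun z => f (r z)) := by
    refine (C1.of_hasDerivAt (hf.continuous.comp hr) (fun i z => pd (e i) f (r z))
      (fun i => (hf.continuous_pd _).comp hr) fun i z => ?_).1
    simpa only [Function.comp_apply, hs] using hf.hasDerivAt (e i) (r z)
  have := h _ hc fun z => hf0 _
  simp only [hpd] at this
  rw [hint fun z => f z * Real.log (f z), hint f] at this
  refine this.trans (le_of_eq ?_)
  rw [← hint fun z => ∑ i, (pd i f z) ^ 2 / f z]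
  refine integral_congr_ae (ae_of_all _ fun z => ?_)
  exact e.sum_comp fun j => (pd j f (r z)) ^ 2 / f (r z)

lemma entropyInequality_fin (k : ℕ) : EntropyInequality (Fin k) := by
  induction k with
  | zero => exact entropyInequality_fin_zero
  | succ k ih => exact (ih.sum entropyInequality_fin_one).congr finSumFinEquiv

/-- A positive continuous probability density on the torus satisfies a logarithmic Sobolev
inequality, with a constant depending only on its bounds. -/
lemma lsi_densityMeasure_of_bounds {k : ℕ} {w : UnitAddTorus (Fin k) → ℝ} (hw : Continuous w)
    {a b : ℝ} (ha : 0 < a) (hb : 0 < b) (hwa : ∀ y, a ≤ w y) (hwb : ∀ y, w y ≤ b)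
    (hw1 : ∫ y, w y = 1) : LSI (densityMeasure w) (a / (2 * b)) := by
  have hw0 : ∀ y, 0 < w y := fun y => ha.trans_le (hwa y)
  rw [lsi_densityMeasure_iff hw hw0 (by positivity)]
  intro f hf hf0 hf1
  set M := ∫ y, f y with hM
  have hM0 : 0 < M := by
    refine (integral_pos_iff_support_of_nonneg (fun y => (hf0 y).le)
      (integrable_of_continuous hf.continuous)).2 ?_
    rw [show Function.support f = univ from Set.eq_univ_of_forall fun y => (hf0 y).ne']
    simp
  have clog : Continuous fun z => f z * Real.log (f z) :=
    hf.continuous.mul (hf.log hf0).continuous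
  have cb : Continuous fun z => f z * Real.log (f z) - f z * Real.log M - f z + M :=
    ((clog.sub (hf.continuous.mul continuous_const)).sub hf.continuous).add continuous_const
  have cfi : Continuous fun z => ∑ i, (pd i f z) ^ 2 / f z :=
    continuous_finsetSum _ fun i _ =>
      ((hf.continuous_pd i).pow 2).div hf.continuous fun z => (hf0 z).ne'
  -- The integrand is M times `klFun` of f/M, hence nonnegative. This sign is what allows the weight
  -- w to be replaced by its upper bound b.
  have hbn : ∀ z, 0 ≤ f z * Real.log (f z) - f z * Real.log M - f z + M := by
    intro z
    have h := klFun_nonneg (x := f z / M) (div_nonneg (hf0 z).le hM0.le)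
    rw [klFun_apply, Real.log_div (hf0 z).ne' hM0.ne'] at h
    have h2 := mul_nonneg hM0.le h
    have e : M * (f z / M * (Real.log (f z) - Real.log M) + 1 - f z / M)
      = f z * Real.log (f z) - f z * Real.log M - f z + M := by
      field_simp
      ring
    rwa [e] at h2
  -- The mean of f is 1 under w but M under Lebesgue measure. Centring at M instead of 1 only
  -- increases the integral, by M - 1 - ln M.
  have h1 : ∫ z, w z * klFun (f z)
      ≤ ∫ z, w z * (f z * Real.log (f z) - f z * Real.log M - f z + M) := by
    have cw1 : Continuous fun z => w z * klFun (f z) :=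
      hw.mul (continuous_klFun.comp hf.continuous)
    have cw2 := hw.mul cb
    have e : (∫ z, w z * (f z * Real.log (f z) - f z * Real.log M - f z + M))
        - ∫ z, w z * klFun (f z) = M - 1 - Real.log M := by
      rw [← integral_sub (integrable_of_continuous (f := fun z => w z *
        (f z * Real.log (f z) - f z * Real.log M - f z + M)) cw2) (integrable_of_continuous cw1)]
      have : ∀ z, w z * (f z * Real.log (f z) - f z * Real.log M - f z + M) - w z * klFun (f z)
          = (M - 1) * w z - Real.log M * (w z * f z) := by
        intro z; rw [klFun_apply]; ring
      simp only [this]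
      rw [integral_sub ((integrable_of_continuous hw).const_mul _)
        ((integrable_of_continuous (f := fun z => w z * f z) (hw.mul hf.continuous)).const_mul _),
        integral_const_mul, integral_const_mul, hw1, hf1]
      ring
    have := Real.log_le_sub_one_of_pos hM0
    linarith
  have h2 : ∫ z, w z * (f z * Real.log (f z) - f z * Real.log M - f z + M)
      ≤ ∫ z, b * (f z * Real.log (f z) - f z * Real.log M - f z + M) :=
    integral_mono (integrable_of_continuous (hw.mul cb))
      ((integrable_of_continuous cb).const_mul b)
      fun z => mul_le_mul_of_nonneg_right (hwb z) (hbn z)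
  have h3 : ∫ z, (f z * Real.log (f z) - f z * Real.log M - f z + M)
      = (∫ z, f z * Real.log (f z)) - M * Real.log M := by
    rw [integral_add (f := fun z => f z * Real.log (f z) - f z * Real.log M - f z)
      (integrable_of_continuous ((clog.sub (hf.continuous.mul continuous_const)).sub hf.continuous))
      (integrable_const _), integral_sub (f := fun z => f z * Real.log (f z) - f z * Real.log M)
      (integrable_of_continuous (clog.sub (hf.continuous.mul continuous_const)))
      (integrable_of_continuous hf.continuous), integral_sub (integrable_of_continuous clog)
      ((integrable_of_continuous hf.continuous).mul_const _), integral_mul_const, ← hM]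
    simp
  have h4 := entropyInequality_fin k f hf hf0
  have h5 : ∫ z, ∑ i, (pd i f z) ^ 2 / f z
      ≤ ∫ z, a⁻¹ * (w z * ∑ i, (pd i f z) ^ 2 / f z) := by
    refine integral_mono (integrable_of_continuous cfi)
      ((integrable_of_continuous (hw.mul cfi)).const_mul _) fun z => ?_
    have hs : 0 ≤ ∑ i, (pd i f z) ^ 2 / f z :=
      Finset.sum_nonneg fun i _ => div_nonneg (sq_nonneg _) (hf0 z).le
    have := mul_le_mul_of_nonneg_right (hwa z) hs
    simp only
    rw [inv_mul_eq_div, le_div_iff₀ ha]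
    linarith
  rw [integral_const_mul] at h2 h5
  rw [h3] at h2
  have h6 := mul_le_mul_of_nonneg_left (h4.trans h5) hb.le
  refine h1.trans (h2.trans (h6.trans (le_of_eq ?_)))
  field_simp

end TorusLSI

/-! ### Orthogonality relations for the Helmholtz projection and for the bias -/

section Bias

variable {ι : Type} [Fintype ι] [DecidableEq ι]

lemma memLp_two_of_continuous {f : UnitAddTorus ι → ℝ} (hf : Continuous f) :
    MemLp f 2 volume := by
  obtain ⟨C, -, hC⟩ := exists_bound_of_continuous hf
  exact MemLp.of_bound hf.aestronglyMeasurable C (ae_of_all _ hC)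

lemma integrable_mul_of_memLp {α : Type*} [MeasurableSpace α] {μ : Measure α} {f g : α → ℝ}
    (hf : MemLp f 2 μ) (hg : MemLp g 2 μ) : Integrable (fun x => f x * g x) μ :=
  hf.integrable_mul hg

lemma C1.isH1WithGrad {g : UnitAddTorus ι → ℝ} (hg : C1 g) :
    IsH1WithGrad g (fun x i => pd i g x) where
  memLp := memLp_two_of_continuous hg.continuous
  memLp_grad i := memLp_two_of_continuous (hg.continuous_pd i)
  weak_grad φ hφ i := hg.integral_mul_pd (hφ.of_le (by simp)).c1 i

lemma IsH1WithGrad.integrable_mul {g : UnitAddTorus ι → ℝ} {b : UnitAddTorus ι → ι → ℝ}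
    (h : IsH1WithGrad g b) {f : UnitAddTorus ι → ℝ} (hf : Continuous f) :
    Integrable fun x => g x * f x :=
  integrable_mul_of_memLp h.memLp (memLp_two_of_continuous hf)

lemma IsH1WithGrad.add_const_mul {g g' : UnitAddTorus ι → ℝ} {b b' : UnitAddTorus ι → ι → ℝ}
    (h : IsH1WithGrad g b) (h' : IsH1WithGrad g' b') (s : ℝ) :
    IsH1WithGrad (fun x => g x + s * g' x) (fun x i => b x i + s * b' x i) where
  memLp := h.memLp.add (h'.memLp.const_mul s)
  memLp_grad i := (h.memLp_grad i).add ((h'.memLp_grad i).const_mul s)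
  weak_grad φ hφ i := by
    have hc := (hφ.of_le (by simp)).c1
    have hb : ∀ {c : UnitAddTorus ι → ℝ}, MemLp c 2 volume → Integrable fun x => c x * φ x :=
      fun hc' => integrable_mul_of_memLp hc' (memLp_two_of_continuous hc.continuous)
    simp only [add_mul, mul_assoc]
    rw [integral_add (h.integrable_mul (hc.continuous_pd i))
      ((h'.integrable_mul (hc.continuous_pd i)).const_mul s),
      integral_add (hb (h.memLp_grad i)) ((hb (h'.memLp_grad i)).const_mul s),
      integral_const_mul, integral_const_mul, h.weak_grad φ hφ i, h'.weak_grad φ hφ i]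
    ring

lemma eq_zero_of_forall_quadratic_nonneg {X Y : ℝ} (h : ∀ s : ℝ, 0 ≤ -2 * s * X + s ^ 2 * Y) :
    X = 0 := by
  have hY : 0 < |Y| + 1 := by positivity
  -- With this s the linear term dominates the quadratic one whatever the sign and size of Y.
  have h1 := h (X / (|Y| + 1))
  have h2 : -2 * (X / (|Y| + 1)) * X + (X / (|Y| + 1)) ^ 2 * Y
      = (X / (|Y| + 1)) ^ 2 * (Y - 2 * (|Y| + 1)) := by
    field_simp
    ring
  rw [h2] at h1
  have h3 : Y - 2 * (|Y| + 1) < 0 := by linarith [le_abs_self Y, abs_nonneg Y]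
  have h4 : (X / (|Y| + 1)) ^ 2 = 0 := by
    by_contra hne
    have : 0 < (X / (|Y| + 1)) ^ 2 := lt_of_le_of_ne (sq_nonneg _) (Ne.symm hne)
    nlinarith
  have h5 := pow_eq_zero_iff (two_ne_zero) |>.1 h4
  rcases div_eq_zero_iff.1 h5 with h | h
  · exact h
  · exact absurd h hY.ne'

/-- The Helmholtz projection leaves a remainder orthogonal to gradients. -/
lemma IsHelmholtzProjection.integral_eq_zero {f b : UnitAddTorus ι → ι → ℝ}
    (h : IsHelmholtzProjection f b) {g' : UnitAddTorus ι → ℝ} {b' : UnitAddTorus ι → ι → ℝ}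
    (h' : IsH1WithGrad g' b') : ∫ x, ∑ i, (f x i - b x i) * b' x i = 0 := by
  obtain ⟨hf, g, hg, hg0, hmin⟩ := h
  have hgi : Integrable g := hg.memLp.integrable (by norm_num)
  have hgi' : Integrable g' := h'.memLp.integrable (by norm_num)
  have hr : ∀ i, MemLp (fun x => f x i - b x i) 2 volume := fun i =>
    (hf i).sub (hg.memLp_grad i)
  refine eq_zero_of_forall_quadratic_nonneg (Y := ∫ x, ∑ i, b' x i ^ 2) fun s => ?_
  -- Subtracting s times the mean of g' restores the zero mean of the perturbed potential without
  -- changing its gradient, so the perturbation is admissible for the minimization.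
  have hc := (C1.const (ι := ι) (∫ x, g' x)).isH1WithGrad
  have hv := (hg.add_const_mul h' s).add_const_mul hc (-s)
  have hz : ∫ x, (g x + s * g' x + -s * ∫ x, g' x) = 0 := by
    rw [integral_add (f := fun x => g x + s * g' x) (hgi.add (hgi'.const_mul s))
      (integrable_const _), integral_add hgi (hgi'.const_mul s), integral_const_mul, hg0]
    simp
  have h1 := hmin _ _ hv hz
  simp only [pd_const, mul_zero, add_zero] at h1
  have i1 : Integrable fun x => ∑ i, (f x i - b x i) ^ 2 :=
    integrable_finsetSum _ fun i _ => (hr i).integrable_sq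
  have i2 : Integrable fun x => ∑ i, (f x i - b x i) * b' x i :=
    integrable_finsetSum _ fun i _ => integrable_mul_of_memLp (hr i) (h'.memLp_grad i)
  have i3 : Integrable fun x => ∑ i, b' x i ^ 2 :=
    integrable_finsetSum _ fun i _ => (h'.memLp_grad i).integrable_sq
  have e : ∀ x, ∑ i, (f x i - (b x i + s * b' x i)) ^ 2
      = ∑ i, (f x i - b x i) ^ 2 + (-2 * s * ∑ i, (f x i - b x i) * b' x i
        + s ^ 2 * ∑ i, b' x i ^ 2) := by
    intro x
    rw [Finset.mul_sum, Finset.mul_sum, ← Finset.sum_add_distrib, ← Finset.sum_add_distrib]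
    exact Finset.sum_congr rfl fun i _ => by ring
  simp only [e] at h1
  rw [integral_add i1 (g := fun x => -2 * s * ∑ i, (f x i - b x i) * b' x i
        + s ^ 2 * ∑ i, b' x i ^ 2) ((i2.const_mul _).add (i3.const_mul _)),
    integral_add (i2.const_mul _) (i3.const_mul _), integral_const_mul, integral_const_mul] at h1
  linarith

variable {m : ℕ} {alg : Algorithm} {G B : UnitAddTorus (Fin m) → Fin m → ℝ}

lemma IsBias.memLp (h : IsBias alg G B) (hG : ∀ i, MemLp (fun x => G x i) 2 volume) (i : Fin m) :
    MemLp (fun x => B x i) 2 volume := by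
  cases alg with
  | abf =>
    refine (hG i).ae_eq ?_
    filter_upwards [show B =ᵐ[volume] G from h] with x hx
    rw [hx]
  | pabf =>
    obtain ⟨-, g, hg, -⟩ := show IsHelmholtzProjection G B from h
    exact hg.memLp_grad i

/-- This expresses weakly that B - G is divergence free, and it is how the drift disappears from the
marginal equation. -/
lemma IsBias.integral_sub_mul_pd (h : IsBias alg G B) {φ : UnitAddTorus (Fin m) → ℝ}
    (hφ : C1 φ) : ∫ x, ∑ i, (B x i - G x i) * pd i φ x = 0 := by
  cases alg with
  | abf =>
    rw [integral_eq_zero_of_ae]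
    filter_upwards [show B =ᵐ[volume] G from h] with x hx
    simp [hx]
  | pabf =>
    have h1 := (show IsHelmholtzProjection G B from h).integral_eq_zero hφ.isH1WithGrad
    rw [← neg_eq_zero, ← integral_neg, ← h1]
    simp only [← Finset.sum_neg_distrib]
    exact integral_congr_ae (ae_of_all _ fun x => Finset.sum_congr rfl fun i _ => by ring)

/-- For PABF, B - ∇a is itself the weak gradient of an H¹ function, hence orthogonal to B - G; for
ABF the first factor vanishes almost everywhere. -/
lemma IsBias.integral_sub_mul_sub (h : IsBias alg G B) {a : UnitAddTorus (Fin m) → ℝ}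
    (ha : C1 a) : ∫ x, ∑ i, (B x i - G x i) * (B x i - pd i a x) = 0 := by
  cases alg with
  | abf =>
    rw [integral_eq_zero_of_ae]
    filter_upwards [show B =ᵐ[volume] G from h] with x hx
    simp [hx]
  | pabf =>
    have h0 : IsHelmholtzProjection G B := h
    obtain ⟨-, g, hg, -⟩ := show IsHelmholtzProjection G B from h
    have h1 := h0.integral_eq_zero (hg.add_const_mul ha.isH1WithGrad (-1))
    rw [← neg_eq_zero, ← integral_neg, ← h1]
    simp only [← Finset.sum_neg_distrib]
    exact integral_congr_ae (ae_of_all _ fun x => Finset.sum_congr rfl fun i _ => by ring)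

/-- The bias associated with a gradient field is the field itself. -/
lemma IsBias.ae_eq_of_gradient {a : UnitAddTorus (Fin m) → ℝ} (ha : C1 a)
    (h : IsBias alg (fun x i => pd i a x) B) : B =ᵐ[volume] fun x i => pd i a x := by
  -- With G = ∇a the orthogonality relation reads ∫ |B - ∇a|² = 0.
  have h1 := h.integral_sub_mul_sub ha
  have hB := h.memLp fun i => memLp_two_of_continuous (ha.continuous_pd i)
  have hi : ∀ i, MemLp (fun x => B x i - pd i a x) 2 volume := fun i =>
    (hB i).sub (memLp_two_of_continuous (ha.continuous_pd i))
  rw [integral_eq_zero_iff_of_nonneg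
    (fun x => Finset.sum_nonneg fun i _ => mul_self_nonneg _)
    (integrable_finsetSum _ fun i _ => integrable_mul_of_memLp (hi i) (hi i))] at h1
  filter_upwards [h1] with x hx
  funext i
  have := (Finset.sum_eq_zero_iff_of_nonneg (fun i _ => mul_self_nonneg _)).1 hx i
    (Finset.mem_univ i)
  simpa [sub_eq_zero] using this

lemma isBias_gradient (alg : Algorithm) {a : UnitAddTorus (Fin m) → ℝ} (ha : C1 a) :
    IsBias alg (fun x i => pd i a x) (fun x i => pd i a x) := by
  cases alg with
  | abf => exact EventuallyEq.rfl
  | pabf =>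
    refine ⟨fun i => memLp_two_of_continuous (ha.continuous_pd i),
      fun x => a x + -1 * ∫ x, a x, ?_, ?_, fun g' b' _ _ => ?_⟩
    · have := ha.isH1WithGrad.add_const_mul (C1.const (∫ x, a x)).isH1WithGrad (-1)
      simpa only [pd_const, mul_zero, add_zero] using this
    · rw [integral_add (integrable_of_continuous ha.continuous) (integrable_const _)]
      simp
    · simp only [sub_self, ne_eq, OfNat.ofNat_ne_zero, not_false_eq_true, zero_pow,
        Finset.sum_const_zero, integral_zero]
      exact integral_nonneg fun x => Finset.sum_nonneg fun i _ => sq_nonneg _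

end Bias

/-! ### The biased Gibbs density: uniform marginal and zero current -/

section FreeEnergy

variable {m k : ℕ} {β : ℝ} {V : UnitAddTorus (Fin m ⊕ Fin k) → ℝ}

lemma C1.boltzmann (hV : C1 V) (β : ℝ) : C1 (fun z => Real.exp (-β * V z)) := (hV.const_mul _).exp

lemma marginal_boltzmann_pos (hV : C1 V) (β : ℝ) (x : UnitAddTorus (Fin m)) :
    0 < marginal (fun z => Real.exp (-β * V z)) x :=
  marginal_pos (hV.boltzmann β).continuous (fun _ => Real.exp_pos _) x

lemma C1.freeEnergy (hV : C1 V) (β : ℝ) : C1 (freeEnergy β V) :=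
  ((hV.boltzmann β).marginal.log (marginal_boltzmann_pos hV β)).const_mul _

lemma exp_sub_freeEnergy (hV : C1 V) (hβ : 0 < β) (z : UnitAddTorus (Fin m ⊕ Fin k)) :
    Real.exp (-β * (V z - freeEnergy β V (xi z)))
      = (marginal (fun z => Real.exp (-β * V z)) (xi z))⁻¹ * Real.exp (-β * V z) := by
  have h : β * freeEnergy β V (xi z)
      = - Real.log (marginal (fun z => Real.exp (-β * V z)) (xi z)) := by
    simp only [freeEnergy, marginal]
    field_simp
  rw [show -β * (V z - freeEnergy β V (xi z)) = β * freeEnergy β V (xi z) + -β * V z by ring,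
    Real.exp_add, h, Real.exp_neg, Real.exp_log (marginal_boltzmann_pos hV β _)]

lemma C1.gibbs_exponent (hV : C1 V) (β : ℝ) :
    C1 (fun z => -β * (V z - ABF.freeEnergy β V (xi z))) :=
  (hV.sub (hV.freeEnergy β).comp_xi).const_mul _

lemma marginal_exp_sub_freeEnergy (hV : C1 V) (hβ : 0 < β) (x : UnitAddTorus (Fin m)) :
    marginal (fun z => Real.exp (-β * (V z - freeEnergy β V (xi z)))) x = 1 := by
  have h := marginal_boltzmann_pos hV β x
  simp only [exp_sub_freeEnergy hV hβ]
  rw [marginal_xi_mul (fun x => (marginal (fun z => Real.exp (-β * V z)) x)⁻¹)]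
  exact inv_mul_cancel₀ h.ne'

/-- Adding A makes every fibre integral equal to one, so the normalization constant is one. -/
lemma muA_eq (hV : C1 V) (hβ : 0 < β) :
    muA β V = fun z => Real.exp (-β * (V z - freeEnergy β V (xi z))) := by
  have hZ : ∫ w : UnitAddTorus (Fin m ⊕ Fin k),
      Real.exp (- β * (V w - freeEnergy β V (xi w))) = 1 := by
    rw [integral_eq_integral_marginal (integrable_of_continuous (hV.gibbs_exponent β).exp.continuous)]
    simp only [marginal_exp_sub_freeEnergy hV hβ]
    simp
  funext z
  rw [muA, hZ, inv_one, one_mul]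

lemma C1.muA (hV : C1 V) (hβ : 0 < β) : C1 (muA β V) := by
  rw [muA_eq hV hβ]; exact (hV.gibbs_exponent β).exp

lemma muA_pos (hV : C1 V) (hβ : 0 < β) (z : UnitAddTorus (Fin m ⊕ Fin k)) : 0 < muA β V z := by
  rw [muA_eq hV hβ]; exact Real.exp_pos _

lemma marginal_muA (hV : C1 V) (hβ : 0 < β) (x : UnitAddTorus (Fin m)) :
    marginal (muA β V) x = 1 := by
  rw [muA_eq hV hβ]; exact marginal_exp_sub_freeEnergy hV hβ x

lemma integral_muA (hV : C1 V) (hβ : 0 < β) : ∫ z, muA β V z = 1 := by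
  rw [integral_eq_integral_marginal (integrable_of_continuous (hV.muA hβ).continuous)]
  simp [marginal_muA hV hβ]

lemma condMuA_eq (hV : C1 V) (hβ : 0 < β) (x : UnitAddTorus (Fin m)) :
    condMuA β V x = fun y => muA β V (Sum.elim x y) := by
  funext y
  rw [condMuA, marginal_muA hV hβ, div_one]

lemma log_muA (hV : C1 V) (hβ : 0 < β) :
    (fun z => Real.log (muA β V z)) = fun z => -β * (V z - freeEnergy β V (xi z)) := by
  rw [muA_eq hV hβ]
  simp

lemma pd_log_muA_inl (hV : C1 V) (hβ : 0 < β) (i : Fin m) (z : UnitAddTorus (Fin m ⊕ Fin k)) :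
    pd (Sum.inl i) (fun z => Real.log (muA β V z)) z
      = -β * (pd (Sum.inl i) V z - gradFreeEnergy β V (xi z) i) := by
  rw [log_muA hV hβ, (hV.sub (hV.freeEnergy β).comp_xi).pd_const_mul,
    hV.pd_sub (hV.freeEnergy β).comp_xi, pd_comp_xi_inl]
  rfl

lemma pd_log_muA_inr (hV : C1 V) (hβ : 0 < β) (j : Fin k) (z : UnitAddTorus (Fin m ⊕ Fin k)) :
    pd (Sum.inr j) (fun z => Real.log (muA β V z)) z = -β * pd (Sum.inr j) V z := by
  rw [log_muA hV hβ, (hV.sub (hV.freeEnergy β).comp_xi).pd_const_mul,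
    hV.pd_sub (hV.freeEnergy β).comp_xi, pd_comp_xi_inr]
  ring

lemma pd_muA (hV : C1 V) (hβ : 0 < β) (i : Fin m ⊕ Fin k) (z : UnitAddTorus (Fin m ⊕ Fin k)) :
    pd i (muA β V) z = muA β V z * pd i (fun z => Real.log (muA β V z)) z := by
  rw [(hV.muA hβ).pd_log (muA_pos hV hβ)]
  have := (muA_pos hV hβ z).ne'
  field_simp

lemma continuous_gradFreeEnergy (hV : C1 V) (β : ℝ) (i : Fin m) :
    Continuous fun x => gradFreeEnergy β V x i := (hV.freeEnergy β).continuous_pd i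

/-- The fluctuation of the force around the mean force is centered under `μ_A`. -/
lemma marginal_fluctuation_muA (hV : C1 V) (hβ : 0 < β) (i : Fin m) (x : UnitAddTorus (Fin m)) :
    marginal (fun z => (pd (Sum.inl i) V z - gradFreeEnergy β V (xi z) i) * muA β V z) x = 0 := by
  -- The identity is the derivative in x of the constant marginal of μ_A, taken under the integral.
  have h1 : pd i (marginal (muA β V)) x = 0 := by
    rw [show marginal (muA β V) = fun _ => 1 from funext (marginal_muA hV hβ), pd_const]
  rw [(hV.muA hβ).pd_marginal] at h1
  have e : pd (Sum.inl i) (muA β V) = fun z =>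
      -β * ((pd (Sum.inl i) V z - gradFreeEnergy β V (xi z) i) * muA β V z) := by
    funext z
    rw [pd_muA hV hβ, pd_log_muA_inl hV hβ]; ring
  rw [e, marginal_const_mul] at h1
  exact (mul_eq_zero.1 h1).resolve_left (neg_ne_zero.2 hβ.ne')

lemma meanForce_eq_div (p : UnitAddTorus (Fin m ⊕ Fin k) → ℝ) (x : UnitAddTorus (Fin m))
    (i : Fin m) : meanForce (gradForce V) p x i
      = marginal (fun z => pd (Sum.inl i) V z * p z) x / marginal p x := by
  simp only [meanForce, gradForce, neg_neg, mul_div_assoc']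
  exact integral_div _ _

lemma marginal_eq_zero_imp {p : UnitAddTorus (Fin m ⊕ Fin k) → ℝ} (hp : Continuous p)
    (hp0 : ∀ z, 0 ≤ p z) {x : UnitAddTorus (Fin m)} (h : marginal p x = 0) (y) :
    p (Sum.elim x y) = 0 := by
  have hc := continuous_slice hp x
  have h1 := (integral_eq_zero_iff_of_nonneg (fun y => hp0 _) (integrable_of_continuous hc)).1 h
  have h2 := (hc.ae_eq_iff_eq (μ := volume) (continuous_const (y := (0:ℝ)))).1 h1
  exact congrFun h2 y

/-- The product form survives where the marginal vanishes: a continuous nonnegative density is then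
zero on the whole fibre, so the conventional value of the quotient plays no role. -/
lemma meanForce_mul_marginal {p : UnitAddTorus (Fin m ⊕ Fin k) → ℝ} (hp : Continuous p)
    (hp0 : ∀ z, 0 ≤ p z) (x : UnitAddTorus (Fin m)) (i : Fin m) :
    meanForce (gradForce V) p x i * marginal p x
      = marginal (fun z => pd (Sum.inl i) V z * p z) x := by
  rw [meanForce_eq_div]
  by_cases h : marginal p x = 0
  · have h1 := marginal_eq_zero_imp hp hp0 h
    simp [marginal, h1]
  · exact div_mul_cancel₀ _ h

lemma meanForce_muA (hV : C1 V) (hβ : 0 < β) :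
    meanForce (gradForce V) (muA β V) = gradFreeEnergy β V := by
  funext x i
  have h := marginal_fluctuation_muA hV hβ i x
  have hc := (hV.muA hβ).continuous
  have hc1 : Continuous fun z => pd (Sum.inl i) V z * muA β V z := (hV.continuous_pd _).mul hc
  have hc2 : Continuous fun z => gradFreeEnergy β V (xi z) i * muA β V z :=
    ((continuous_gradFreeEnergy hV β i).comp continuous_xi).mul hc
  simp only [sub_mul] at h
  rw [marginal_sub hc1 hc2, marginal_xi_mul (fun x => gradFreeEnergy β V x i),
    marginal_muA hV hβ] at h
  rw [meanForce_eq_div, marginal_muA hV hβ]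
  linarith

lemma abs_marginal_le {f p : UnitAddTorus (Fin m ⊕ Fin k) → ℝ} (hp : Continuous p) {C : ℝ}
    (h : ∀ z, |f z| ≤ C * p z) (x : UnitAddTorus (Fin m)) : |marginal f x| ≤ C * marginal p x := by
  have := norm_integral_le_of_norm_le (μ := (volume : Measure (UnitAddTorus (Fin k))))
    (f := fun y => f (Sum.elim x y))
    ((integrable_of_continuous (continuous_slice hp x)).const_mul C) (ae_of_all _ fun y => h _)
  rwa [integral_const_mul] at this

lemma abs_meanForce_le {p : UnitAddTorus (Fin m ⊕ Fin k) → ℝ} (hp : Continuous p)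
    (hp0 : ∀ z, 0 ≤ p z) {C : ℝ} (hC0 : 0 ≤ C) {i : Fin m} (hC : ∀ z, |pd (Sum.inl i) V z| ≤ C)
    (x : UnitAddTorus (Fin m)) : |meanForce (gradForce V) p x i| ≤ C := by
  have h0 : 0 ≤ marginal p x := integral_nonneg fun y => hp0 _
  rw [meanForce_eq_div, abs_div, abs_of_nonneg h0]
  refine div_le_of_le_mul₀ h0 hC0 (abs_marginal_le hp (fun z => ?_) x)
  rw [abs_mul, abs_of_nonneg (hp0 z)]
  exact mul_le_mul_of_nonneg_right (hC z) (hp0 z)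

lemma measurable_meanForce (hV : C1 V) {p : UnitAddTorus (Fin m ⊕ Fin k) → ℝ} (hp : Continuous p)
    (i : Fin m) : Measurable fun x => meanForce (gradForce V) p x i := by
  simp only [meanForce_eq_div]
  exact (continuous_marginal ((hV.continuous_pd _).mul hp)).measurable.div
    (continuous_marginal hp).measurable

/-- A uniform logarithmic Sobolev inequality for the conditional measures. -/
lemma exists_lsi_condMuA (hV : C1 V) (hβ : 0 < β) :
    ∃ ρ : ℝ, 0 < ρ ∧ ∀ x : UnitAddTorus (Fin m), LSI (densityMeasure (condMuA β V x)) ρ := by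
  have hc := (hV.muA hβ).continuous
  obtain ⟨b, hb, hb'⟩ := exists_bound_of_continuous hc
  obtain ⟨a, ha, ha'⟩ := exists_bound_of_continuous (hc.inv₀ fun z => (muA_pos hV hβ z).ne')
  refine ⟨a⁻¹ / (2 * b), by positivity, fun x => ?_⟩
  rw [condMuA_eq hV hβ]
  refine lsi_densityMeasure_of_bounds (continuous_slice hc x) (inv_pos.2 ha) hb (fun y => ?_)
    (fun y => (le_abs_self _).trans (hb' _)) (marginal_muA hV hβ x)
  have h := ha' (Sum.elim x y)
  rw [Pi.inv_apply, abs_of_pos (inv_pos.2 (muA_pos hV hβ _))] at h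
  exact inv_le_of_inv_le₀ (muA_pos hV hβ _) h

/-- The probability current `-β⁻¹ ∇p + F p + B p` of the dynamics. -/
def current (β : ℝ) (F : UnitAddTorus (Fin m ⊕ Fin k) → (Fin m ⊕ Fin k) → ℝ)
    (p : UnitAddTorus (Fin m ⊕ Fin k) → ℝ) (B : UnitAddTorus (Fin m) → Fin m → ℝ)
    (z : UnitAddTorus (Fin m ⊕ Fin k)) (i : Fin m ⊕ Fin k) : ℝ :=
  -β⁻¹ * pd i p z + F z i * p z + Sum.elim (B (xi z)) (fun _ => 0) i * p z

lemma sum_pd_mul_current (β : ℝ) (F : UnitAddTorus (Fin m ⊕ Fin k) → (Fin m ⊕ Fin k) → ℝ)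
    (p φ : UnitAddTorus (Fin m ⊕ Fin k) → ℝ) (B : UnitAddTorus (Fin m) → Fin m → ℝ)
    (z : UnitAddTorus (Fin m ⊕ Fin k)) :
    ∑ i, pd i φ z * current β F p B z i
      = - β⁻¹ * ∑ i, pd i φ z * pd i p z + (∑ i, F z i * pd i φ z) * p z
        + (∑ i : Fin m, B (xi z) i * pd (Sum.inl i) φ z) * p z := by
  have h : ∑ i : Fin m, B (xi z) i * pd (Sum.inl i) φ z
      = ∑ i : Fin m ⊕ Fin k, Sum.elim (B (xi z)) (fun _ => 0) i * pd i φ z := by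
    simp [Fintype.sum_sum_type]
  rw [h, Finset.mul_sum, Finset.sum_mul, Finset.sum_mul, ← Finset.sum_add_distrib,
    ← Finset.sum_add_distrib]
  refine Finset.sum_congr rfl fun i _ => ?_
  rw [current]; ring

lemma current_muA (hV : C1 V) (hβ : 0 < β) (z : UnitAddTorus (Fin m ⊕ Fin k))
    (i : Fin m ⊕ Fin k) : current β (gradForce V) (muA β V) (gradFreeEnergy β V) z i = 0 := by
  rcases i with i | j
  · simp only [current, pd_muA hV hβ, pd_log_muA_inl hV hβ, gradForce, Sum.elim_inl]
    field_simp
    ring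
  · simp only [current, pd_muA hV hβ, pd_log_muA_inr hV hβ, gradForce, Sum.elim_inr]
    field_simp
    ring

/-- The pair `(μ_A, ∇A)` is a stationary state: its current vanishes identically. -/
lemma isStationary_muA (hV : C1 V) (hβ : 0 < β) (alg : Algorithm) :
    IsStationary alg β (gradForce V) (muA β V) (gradFreeEnergy β V) where
  nonneg _ _ z := (muA_pos hV hβ z).le
  mass _ _ := integral_muA hV hβ
  continuousOn := ((hV.muA hβ).continuous.comp continuous_snd).continuousOn
  isC_one _ _ := (hV.muA hβ).isC
  continuousOn_pd i := (((hV.muA hβ).continuous_pd i).comp continuous_snd).continuousOn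
  bias _ _ := by
    rw [meanForce_muA hV hβ]
    exact isBias_gradient alg (hV.freeEnergy β)
  equation φ _ t _ := by
    simp only [← sum_pd_mul_current, current_muA hV hβ, mul_zero, Finset.sum_const_zero,
      integral_zero]
    exact hasDerivAt_const _ _

end FreeEnergy

/-! ### Regularization by a small multiple of the equilibrium density -/

section Regularization

variable {m k : ℕ} {β δ : ℝ} {V p : UnitAddTorus (Fin m ⊕ Fin k) → ℝ}

/-- The regularized density `(1 - δ) p + δ μ_A`. -/
def mix (β : ℝ) (V : UnitAddTorus (Fin m ⊕ Fin k) → ℝ) (δ : ℝ)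
    (p : UnitAddTorus (Fin m ⊕ Fin k) → ℝ) (z : UnitAddTorus (Fin m ⊕ Fin k)) : ℝ :=
  (1 - δ) * p z + δ * muA β V z

/-- The logarithm of the density of `(1 - δ) p + δ μ_A` with respect to `μ_A`. -/
def logRatio (β : ℝ) (V : UnitAddTorus (Fin m ⊕ Fin k) → ℝ) (δ : ℝ)
    (p : UnitAddTorus (Fin m ⊕ Fin k) → ℝ) (z : UnitAddTorus (Fin m ⊕ Fin k)) : ℝ :=
  Real.log (mix β V δ p z) - Real.log (muA β V z)

/-- The difference between the local mean force and the gradient of the free energy. -/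
def forceGap (β : ℝ) (V p : UnitAddTorus (Fin m ⊕ Fin k) → ℝ) (x : UnitAddTorus (Fin m))
    (i : Fin m) : ℝ := meanForce (gradForce V) p x i - gradFreeEnergy β V x i

/-- The fluctuation `∂ᵢV - ∂ᵢA` of the force. -/
def fluctuation (β : ℝ) (V : UnitAddTorus (Fin m ⊕ Fin k) → ℝ) (i : Fin m)
    (z : UnitAddTorus (Fin m ⊕ Fin k)) : ℝ := pd (Sum.inl i) V z - gradFreeEnergy β V (xi z) i

lemma continuous_fluctuation (hV : C1 V) (i : Fin m) : Continuous (fluctuation β V i) :=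
  (hV.continuous_pd _).sub ((continuous_gradFreeEnergy hV β i).comp continuous_xi)

lemma C1.mix (hV : C1 V) (hβ : 0 < β) (hp : C1 p) (δ : ℝ) : C1 (mix β V δ p) :=
  (hp.const_mul _).add ((hV.muA hβ).const_mul _)

lemma pd_mix (hV : C1 V) (hβ : 0 < β) (hp : C1 p) (i : Fin m ⊕ Fin k)
    (z : UnitAddTorus (Fin m ⊕ Fin k)) :
    pd i (mix β V δ p) z = (1 - δ) * pd i p z + δ * pd i (muA β V) z := by
  rw [show mix β V δ p = fun z => (1 - δ) * p z + δ * muA β V z from rfl,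
    (hp.const_mul _).pd_add ((hV.muA hβ).const_mul _), hp.pd_const_mul, (hV.muA hβ).pd_const_mul]

lemma mul_muA_le_mix (hp0 : ∀ z, 0 ≤ p z) (hδ1 : δ ≤ 1) (z : UnitAddTorus (Fin m ⊕ Fin k)) :
    δ * muA β V z ≤ mix β V δ p z := by
  have := mul_nonneg (sub_nonneg.2 hδ1) (hp0 z)
  simp only [mix]; linarith

lemma mix_pos (hV : C1 V) (hβ : 0 < β) (hp0 : ∀ z, 0 ≤ p z) (hδ : 0 < δ) (hδ1 : δ ≤ 1)
    (z : UnitAddTorus (Fin m ⊕ Fin k)) : 0 < mix β V δ p z :=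
  lt_of_lt_of_le (mul_pos hδ (muA_pos hV hβ z)) (mul_muA_le_mix hp0 hδ1 z)

lemma marginal_mix (hV : C1 V) (hβ : 0 < β) (hp : Continuous p) (x : UnitAddTorus (Fin m)) :
    marginal (mix β V δ p) x = (1 - δ) * marginal p x + δ := by
  have hc1 : Continuous fun z => (1 - δ) * p z := continuous_const.mul hp
  have hc2 : Continuous fun z => δ * muA β V z := continuous_const.mul (hV.muA hβ).continuous
  have h := marginal_add hc1 hc2 x
  rw [marginal_const_mul, marginal_const_mul, marginal_muA hV hβ, mul_one] at h
  exact h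

lemma integral_mix (hV : C1 V) (hβ : 0 < β) (hp : Continuous p) (h1 : ∫ z, p z = 1) :
    ∫ z, mix β V δ p z = 1 := by
  simp only [mix]
  rw [integral_add ((integrable_of_continuous hp).const_mul _)
    ((integrable_of_continuous (hV.muA hβ).continuous).const_mul _), integral_const_mul,
    integral_const_mul, h1, integral_muA hV hβ]
  ring

lemma C1.logRatio (hV : C1 V) (hβ : 0 < β) (hp : C1 p) (hp0 : ∀ z, 0 ≤ p z) (hδ : 0 < δ)
    (hδ1 : δ ≤ 1) : C1 (logRatio β V δ p) :=
  ((hV.mix hβ hp δ).log (mix_pos hV hβ hp0 hδ hδ1)).sub ((hV.muA hβ).log (muA_pos hV hβ))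

lemma pd_logRatio (hV : C1 V) (hβ : 0 < β) (hp : C1 p) (hp0 : ∀ z, 0 ≤ p z) (hδ : 0 < δ)
    (hδ1 : δ ≤ 1) (i : Fin m ⊕ Fin k) (z : UnitAddTorus (Fin m ⊕ Fin k)) :
    pd i (logRatio β V δ p) z = (mix β V δ p z)⁻¹ * pd i (mix β V δ p) z
      - pd i (fun z => Real.log (muA β V z)) z := by
  rw [← (hV.mix hβ hp δ).pd_log (mix_pos hV hβ hp0 hδ hδ1)]
  exact ((hV.mix hβ hp δ).log (mix_pos hV hβ hp0 hδ hδ1)).pd_sub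
    ((hV.muA hβ).log (muA_pos hV hβ)) i z

/-- The contribution of δμ_A cancels because μ_A ∇ ln μ_A = ∇μ_A. The right side contains no
logarithm of p. -/
lemma mix_mul_pd_logRatio (hV : C1 V) (hβ : 0 < β) (hp : C1 p) (hp0 : ∀ z, 0 ≤ p z) (hδ : 0 < δ)
    (hδ1 : δ ≤ 1) (i : Fin m ⊕ Fin k) (z : UnitAddTorus (Fin m ⊕ Fin k)) :
    mix β V δ p z * pd i (logRatio β V δ p) z
      = (1 - δ) * (pd i p z - p z * pd i (fun z => Real.log (muA β V z)) z) := by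
  have h := (mix_pos hV hβ hp0 hδ hδ1 z).ne'
  rw [pd_logRatio hV hβ hp hp0 hδ hδ1, mul_sub, ← mul_assoc, mul_inv_cancel₀ h, one_mul,
    pd_mix hV hβ hp, pd_muA hV hβ, mix]
  ring

/-- The flux of the regularized density is a gradient flow part -β⁻¹ q ∇ℓ plus the error R of the
bias, which acts only on q - δμ_A = (1 - δ)p. -/
lemma sub_mul_current_eq (hV : C1 V) (hβ : 0 < β) (hp : C1 p) (hp0 : ∀ z, 0 ≤ p z) (hδ : 0 < δ)
    (hδ1 : δ ≤ 1) (B : UnitAddTorus (Fin m) → Fin m → ℝ) (i : Fin m ⊕ Fin k)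
    (z : UnitAddTorus (Fin m ⊕ Fin k)) :
    (1 - δ) * current β (gradForce V) p B z i
      = -β⁻¹ * (mix β V δ p z * pd i (logRatio β V δ p) z)
        + Sum.elim (fun i => (mix β V δ p z - δ * muA β V z)
          * (B (xi z) i - gradFreeEnergy β V (xi z) i)) (fun _ => 0) i := by
  rw [mix_mul_pd_logRatio hV hβ hp hp0 hδ hδ1]
  have e : mix β V δ p z - δ * muA β V z = (1 - δ) * p z := by rw [mix]; ring
  rw [e]
  rcases i with i | j
  · rw [pd_log_muA_inl hV hβ]
    simp only [current, gradForce, Sum.elim_inl]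
    field_simp
    ring
  · rw [pd_log_muA_inr hV hβ]
    simp only [current, gradForce, Sum.elim_inr]
    field_simp
    ring

lemma marginal_fluctuation_mul (hV : C1 V) (hp : Continuous p) (hp0 : ∀ z, 0 ≤ p z) (i : Fin m)
    (x : UnitAddTorus (Fin m)) :
    marginal (fun z => fluctuation β V i z * p z) x = forceGap β V p x i * marginal p x := by
  have hc1 : Continuous fun z => pd (Sum.inl i) V z * p z := (hV.continuous_pd _).mul hp
  have hc2 : Continuous fun z => gradFreeEnergy β V (xi z) i * p z :=
    ((continuous_gradFreeEnergy hV β i).comp continuous_xi).mul hp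
  simp only [fluctuation, sub_mul]
  rw [marginal_sub hc1 hc2, marginal_xi_mul (fun x => gradFreeEnergy β V x i),
    ← meanForce_mul_marginal hp hp0, forceGap]
  ring

/-- After averaging over a fibre, the x-derivative of ℓ is expressed by the marginal and the force
gap alone. This closes the estimate of the x-part of the entropy production. -/
lemma marginal_mix_mul_pd_logRatio (hV : C1 V) (hβ : 0 < β) (hp : C1 p) (hp0 : ∀ z, 0 ≤ p z)
    (hδ : 0 < δ) (hδ1 : δ ≤ 1) (i : Fin m) (x : UnitAddTorus (Fin m)) :
    marginal (fun z => mix β V δ p z * pd (Sum.inl i) (logRatio β V δ p) z) x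
      = (1 - δ) * (pd i (marginal p) x + β * (forceGap β V p x i * marginal p x)) := by
  have e : (fun z => mix β V δ p z * pd (Sum.inl i) (logRatio β V δ p) z)
      = fun z => (1 - δ) * (pd (Sum.inl i) p z + β * (fluctuation β V i z * p z)) := by
    funext z
    rw [mix_mul_pd_logRatio hV hβ hp hp0 hδ hδ1, pd_log_muA_inl hV hβ, fluctuation]
    ring
  have hc : Continuous fun z => β * (fluctuation β V i z * p z) :=
    continuous_const.mul ((continuous_fluctuation hV i).mul hp.continuous)
  rw [e, marginal_const_mul, marginal_add (hp.continuous_pd _) hc, marginal_const_mul,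
    marginal_fluctuation_mul hV hp.continuous hp0, hp.pd_marginal]

lemma marginal_fluctuation_mul_mix (hV : C1 V) (hβ : 0 < β) (hp : Continuous p)
    (hp0 : ∀ z, 0 ≤ p z) (i : Fin m) (x : UnitAddTorus (Fin m)) :
    marginal (fun z => fluctuation β V i z * mix β V δ p z) x
      = (1 - δ) * (forceGap β V p x i * marginal p x) := by
  have e : (fun z => fluctuation β V i z * mix β V δ p z)
      = fun z => (1 - δ) * (fluctuation β V i z * p z)
        + δ * (fluctuation β V i z * muA β V z) := by
    funext z; rw [mix]; ring
  have hf := continuous_fluctuation (β := β) hV i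
  have hc1 : Continuous fun z => (1 - δ) * (fluctuation β V i z * p z) :=
    continuous_const.mul (hf.mul hp)
  have hc2 : Continuous fun z => δ * (fluctuation β V i z * muA β V z) :=
    continuous_const.mul (hf.mul (hV.muA hβ).continuous)
  rw [e, marginal_add hc1 hc2, marginal_const_mul,
    marginal_const_mul, marginal_fluctuation_mul hV hp hp0,
    show marginal (fun z => fluctuation β V i z * muA β V z) x = 0 from
      marginal_fluctuation_muA hV hβ i x]
  ring

end Regularization

/-! ### Splitting of the entropy, Pinsker inequality on fibres, control of the mean force -/

section Pinsker

/-- With r = √f, the bound ln r ≥ 1 - 1/r gives (r - 1)² ≤ `klFun f`; then (f - 1)² = (r - 1)²(r +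
1)² and (r + 1)² ≤ 2(f + 1). -/
lemma sq_sub_one_le_mul_klFun {f : ℝ} (hf : 0 < f) :
    (f - 1) ^ 2 ≤ 2 * (f + 1) * klFun f := by
  have hs : 0 < Real.sqrt f := Real.sqrt_pos.2 hf
  have hsq : Real.sqrt f ^ 2 = f := Real.sq_sqrt hf.le
  set r := Real.sqrt f with hr
  have hlog : 1 - r⁻¹ ≤ Real.log r := Real.one_sub_inv_le_log_of_pos hs
  have hkl : (r - 1) ^ 2 ≤ klFun f := by
    rw [klFun_apply]
    have h1 : Real.log f = 2 * Real.log r := by rw [← hsq, Real.log_pow]; norm_num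
    have h2 : r ^ 2 * (1 - r⁻¹) ≤ r ^ 2 * Real.log r :=
      mul_le_mul_of_nonneg_left hlog (sq_nonneg _)
    have h3 : r ^ 2 * (1 - r⁻¹) = r ^ 2 - r := by field_simp
    rw [h1, ← hsq]
    nlinarith
  have h4 : (f - 1) ^ 2 = (r - 1) ^ 2 * (r + 1) ^ 2 := by rw [← hsq]; ring
  have h5 : (r + 1) ^ 2 ≤ 2 * (f + 1) := by nlinarith [sq_nonneg (r - 1)]
  rw [h4]
  calc (r - 1) ^ 2 * (r + 1) ^ 2 ≤ klFun f * (2 * (f + 1)) :=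
        mul_le_mul hkl h5 (sq_nonneg _) (klFun_nonneg hf.le)
    _ = 2 * (f + 1) * klFun f := by ring

variable {m k : ℕ} {β δ : ℝ} {V p : UnitAddTorus (Fin m ⊕ Fin k) → ℝ}

/-- The density of the conditional relative entropy of `(1 - δ) p + δ μ_A` given `ξ`. -/
def condEntropyDensity (β : ℝ) (V : UnitAddTorus (Fin m ⊕ Fin k) → ℝ) (δ : ℝ)
    (p : UnitAddTorus (Fin m ⊕ Fin k) → ℝ) (z : UnitAddTorus (Fin m ⊕ Fin k)) : ℝ :=
  mix β V δ p z * (logRatio β V δ p z - Real.log (marginal (mix β V δ p) (xi z)))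
    - mix β V δ p z + marginal (mix β V δ p) (xi z) * muA β V z

/-- The relative entropy of `(1 - δ) p + δ μ_A` with respect to `μ_A`. -/
def mixEntropy (β : ℝ) (V : UnitAddTorus (Fin m ⊕ Fin k) → ℝ) (δ : ℝ)
    (p : UnitAddTorus (Fin m ⊕ Fin k) → ℝ) : ℝ :=
  ∫ z, mix β V δ p z * logRatio β V δ p z

/-- The entropy of the marginal of `(1 - δ) p + δ μ_A`. -/
def marginalEntropy (β : ℝ) (V : UnitAddTorus (Fin m ⊕ Fin k) → ℝ) (δ : ℝ)
    (p : UnitAddTorus (Fin m ⊕ Fin k) → ℝ) : ℝ :=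
  ∫ x, marginal (mix β V δ p) x * Real.log (marginal (mix β V δ p) x)

/-- A density on the product torus with positive marginal, regularized by `δ`. -/
structure RegularDensity (β : ℝ) (V : UnitAddTorus (Fin m ⊕ Fin k) → ℝ) (δ a : ℝ)
    (p : UnitAddTorus (Fin m ⊕ Fin k) → ℝ) : Prop where
  beta_pos : 0 < β
  potential : C1 V
  c1 : C1 p
  nonneg : ∀ z, 0 ≤ p z
  mass : ∫ z, p z = 1
  delta_pos : 0 < δ
  delta_le : δ ≤ 1 / 2
  lower_pos : 0 < a
  lower : ∀ x, a ≤ marginal p x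

namespace RegularDensity

variable {a : ℝ} (h : RegularDensity β V δ a p)

include h

lemma delta_le_one : δ ≤ 1 := h.delta_le.trans (by norm_num)

lemma mix_pos (z) : 0 < mix β V δ p z :=
  ABF.mix_pos h.potential h.beta_pos h.nonneg h.delta_pos h.delta_le_one z

lemma c1_mix : C1 (mix β V δ p) := h.potential.mix h.beta_pos h.c1 δ

lemma c1_logRatio : C1 (logRatio β V δ p) :=
  h.potential.logRatio h.beta_pos h.c1 h.nonneg h.delta_pos h.delta_le_one

lemma muA_pos (z) : 0 < muA β V z := ABF.muA_pos h.potential h.beta_pos z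

lemma continuous_muA : Continuous (muA β V) := (h.potential.muA h.beta_pos).continuous

lemma marginal_mix (x) : marginal (mix β V δ p) x = (1 - δ) * marginal p x + δ :=
  ABF.marginal_mix h.potential h.beta_pos h.c1.continuous x

lemma marginal_mix_pos (x) : 0 < marginal (mix β V δ p) x :=
  marginal_pos h.c1_mix.continuous h.mix_pos x

lemma logRatio_eq (z) : logRatio β V δ p z = Real.log (mix β V δ p z / muA β V z) := by
  rw [logRatio, Real.log_div (h.mix_pos z).ne' (h.muA_pos z).ne']

lemma c1_log_marginal_xi : C1 fun z : UnitAddTorus (Fin m ⊕ Fin k) =>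
    Real.log (marginal (mix β V δ p) (xi z)) :=
  (h.c1_mix.marginal.log h.marginal_mix_pos).comp_xi

lemma continuous_condEntropyDensity : Continuous (condEntropyDensity β V δ p) :=
  ((h.c1_mix.continuous.mul (h.c1_logRatio.continuous.sub h.c1_log_marginal_xi.continuous)).sub
    h.c1_mix.continuous).add ((h.c1_mix.marginal.continuous.comp continuous_xi).mul
      h.continuous_muA)

/-- The correction -q + Qμ_A, with Q the marginal of q, integrates to zero on every fibre and turns
the integrand into a pointwise nonnegative one. -/
lemma condEntropyDensity_eq_klFun (z) : condEntropyDensity β V δ p z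
    = marginal (mix β V δ p) (xi z) * muA β V z
      * klFun (mix β V δ p z / (marginal (mix β V δ p) (xi z) * muA β V z)) := by
  have hQ := h.marginal_mix_pos (xi z)
  have hμ := h.muA_pos z
  have hq := h.mix_pos z
  rw [klFun_apply, Real.log_div hq.ne' (mul_pos hQ hμ).ne', Real.log_mul hQ.ne' hμ.ne',
    condEntropyDensity, logRatio]
  field_simp
  ring

lemma condEntropyDensity_nonneg (z) : 0 ≤ condEntropyDensity β V δ p z := by
  have hQ := h.marginal_mix_pos (xi z)
  have hμ := h.muA_pos z
  have hq := h.mix_pos z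
  rw [h.condEntropyDensity_eq_klFun]
  exact mul_nonneg (mul_pos hQ hμ).le (klFun_nonneg (div_pos hq (mul_pos hQ hμ)).le)

/-- A weak form of Pinsker's inequality for the conditional measures. -/
lemma sq_integral_abs_sub_le (x) :
    (marginal (fun z => |mix β V δ p z - marginal (mix β V δ p) (xi z) * muA β V z|) x) ^ 2
      ≤ 4 * marginal (mix β V δ p) x * marginal (condEntropyDensity β V δ p) x := by
  have cq := h.c1_mix.continuous
  have cQμ : Continuous fun z => marginal (mix β V δ p) (xi z) * muA β V z :=
    (h.c1_mix.marginal.continuous.comp continuous_xi).mul h.continuous_muA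
  have cf : Continuous fun z => |mix β V δ p z - marginal (mix β V δ p) (xi z) * muA β V z| :=
    (cq.sub cQμ).abs
  have cg : Continuous fun z => 2 * (mix β V δ p z + marginal (mix β V δ p) (xi z) * muA β V z) :=
    continuous_const.mul (cq.add cQμ)
  have hg0 : ∀ z, 0 < 2 * (mix β V δ p z + marginal (mix β V δ p) (xi z) * muA β V z) := fun z =>
    mul_pos two_pos (add_pos (h.mix_pos z) (mul_pos (h.marginal_mix_pos _) (h.muA_pos z)))
  -- Cauchy–Schwarz with the weight 2(q + Qμ_A), whose fibre integral is 4Q. The quotient that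
  -- appears is bounded pointwise by the conditional entropy density through
  -- `sq_sub_one_le_mul_klFun`.
  have h1 := sq_integral_le (continuous_slice cf x) (continuous_slice cg x) fun y => hg0 _
  have e2 : marginal (fun z => 2 * (mix β V δ p z
      + marginal (mix β V δ p) (xi z) * muA β V z)) x = 4 * marginal (mix β V δ p) x := by
    rw [marginal_const_mul, marginal_add cq cQμ, marginal_xi_mul,
      marginal_muA h.potential h.beta_pos]
    ring
  have h3 : marginal (fun z => |mix β V δ p z - marginal (mix β V δ p) (xi z) * muA β V z| ^ 2
      / (2 * (mix β V δ p z + marginal (mix β V δ p) (xi z) * muA β V z))) x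
      ≤ marginal (condEntropyDensity β V δ p) x := by
    refine integral_mono (integrable_of_continuous (continuous_slice
      ((cf.pow 2).div cg fun z => (hg0 z).ne') x))
      (integrable_of_continuous (continuous_slice h.continuous_condEntropyDensity x)) fun y => ?_
    beta_reduce
    generalize (Sum.elim x y : UnitAddTorus (Fin m ⊕ Fin k)) = z
    have hQμ := mul_pos (h.marginal_mix_pos (xi z)) (h.muA_pos z)
    have hq := h.mix_pos z
    rw [h.condEntropyDensity_eq_klFun, sq_abs, div_le_iff₀ (hg0 z)]
    have h4 := sq_sub_one_le_mul_klFun (div_pos hq hQμ)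
    set b := marginal (mix β V δ p) (xi z) * muA β V z
    set q := mix β V δ p z
    have h5 := mul_le_mul_of_nonneg_left h4 (sq_nonneg b)
    have e1 : b ^ 2 * (q / b - 1) ^ 2 = (q - b) ^ 2 := by field_simp
    have e2 : b ^ 2 * (2 * (q / b + 1) * klFun (q / b))
        = b * klFun (q / b) * (2 * (q + b)) := by field_simp
    rw [e1, e2] at h5
    exact h5
  calc _ ≤ _ := h1
    _ = 4 * marginal (mix β V δ p) x
        * marginal (fun z => |mix β V δ p z - marginal (mix β V δ p) (xi z) * muA β V z| ^ 2
      / (2 * (mix β V δ p z + marginal (mix β V δ p) (xi z) * muA β V z))) x := by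
        rw [← e2]; rfl
    _ ≤ _ := mul_le_mul_of_nonneg_left h3
        (mul_nonneg (by norm_num) (h.marginal_mix_pos x).le)

lemma integral_marginal_mix : ∫ x, marginal (mix β V δ p) x = 1 := by
  rw [← integral_eq_integral_marginal (integrable_of_continuous h.c1_mix.continuous),
    integral_mix h.potential h.beta_pos h.c1.continuous h.mass]

/-- The chain rule for relative entropy. Since μ_A has uniform marginal, the marginal part is simply
∫ Q ln Q. -/
lemma integral_condEntropyDensity :
    ∫ z, condEntropyDensity β V δ p z = mixEntropy β V δ p - marginalEntropy β V δ p := by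
  have cq := h.c1_mix.continuous
  have cl : Continuous fun z => mix β V δ p z * logRatio β V δ p z :=
    cq.mul h.c1_logRatio.continuous
  have clQ : Continuous fun z =>
      Real.log (marginal (mix β V δ p) (xi z)) * mix β V δ p z :=
    h.c1_log_marginal_xi.continuous.mul cq
  have cQμ : Continuous fun z => marginal (mix β V δ p) (xi z) * muA β V z :=
    (h.c1_mix.marginal.continuous.comp continuous_xi).mul h.continuous_muA
  have e : ∀ z, condEntropyDensity β V δ p z = mix β V δ p z * logRatio β V δ p z
      - Real.log (marginal (mix β V δ p) (xi z)) * mix β V δ p z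
      - mix β V δ p z + marginal (mix β V δ p) (xi z) * muA β V z := by
    intro z; rw [condEntropyDensity]; ring
  simp only [e]
  rw [integral_add (f := fun z => mix β V δ p z * logRatio β V δ p z
      - Real.log (marginal (mix β V δ p) (xi z)) * mix β V δ p z
      - mix β V δ p z) (integrable_of_continuous ((cl.sub clQ).sub cq))
      (integrable_of_continuous cQμ),
    integral_sub (f := fun z => mix β V δ p z * logRatio β V δ p z
      - Real.log (marginal (mix β V δ p) (xi z)) * mix β V δ p z)
      (integrable_of_continuous (cl.sub clQ)) (integrable_of_continuous cq),
    integral_sub (integrable_of_continuous cl) (integrable_of_continuous clQ),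
    integral_mix h.potential h.beta_pos h.c1.continuous h.mass,
    integral_eq_integral_marginal (integrable_of_continuous cQμ),
    integral_eq_integral_marginal (integrable_of_continuous clQ)]
  simp only [marginal_xi_mul, marginal_xi_mul (fun x => Real.log (marginal (mix β V δ p) x)),
    marginal_muA h.potential h.beta_pos, mul_one, h.integral_marginal_mix]
  simp only [mixEntropy, marginalEntropy, mul_comm]
  ring

lemma continuous_marginal_mix_mul_log : Continuous fun x =>
    marginal (mix β V δ p) x * Real.log (marginal (mix β V δ p) x) :=
  h.c1_mix.marginal.continuous.mul (h.c1_mix.marginal.log h.marginal_mix_pos).continuous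

lemma marginalEntropy_nonneg : 0 ≤ marginalEntropy β V δ p := by
  have hc := h.c1_mix.marginal.continuous
  have h1 : ∫ x, (marginal (mix β V δ p) x - 1) ≤ marginalEntropy β V δ p := by
    refine integral_mono (integrable_of_continuous (hc.sub continuous_const))
      (integrable_of_continuous h.continuous_marginal_mix_mul_log) fun x => ?_
    have hkl := klFun_nonneg (h.marginal_mix_pos x).le
    rw [klFun_apply] at hkl
    simp only
    linarith
  rw [integral_sub (integrable_of_continuous hc) (integrable_const _),
    h.integral_marginal_mix] at h1
  simpa using h1

/-- Q ln Q ≤ Q(Q - 1) = (Q - 1)² + (Q - 1), where the last term has zero integral and Q - 1 = (1 -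
δ)(S - 1). -/
lemma marginalEntropy_le : marginalEntropy β V δ p ≤ ∫ x, (marginal p x - 1) ^ 2 := by
  have hc := h.c1_mix.marginal.continuous
  have hcp := h.c1.marginal.continuous
  have h1 : marginalEntropy β V δ p
      ≤ ∫ x, ((marginal p x - 1) ^ 2 + (marginal (mix β V δ p) x - 1)) := by
    refine integral_mono (integrable_of_continuous h.continuous_marginal_mix_mul_log)
      (integrable_of_continuous (((hcp.sub continuous_const).pow 2).add
        (hc.sub continuous_const))) fun x => ?_
    have hQ := h.marginal_mix_pos x
    have hl := mul_le_mul_of_nonneg_left (Real.log_le_sub_one_of_pos hQ) hQ.le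
    have e : marginal (mix β V δ p) x - 1 = (1 - δ) * (marginal p x - 1) := by
      rw [h.marginal_mix]; ring
    have hδ2 : (1 - δ) ^ 2 ≤ 1 := by nlinarith [h.delta_pos, h.delta_le]
    have h2 : (marginal (mix β V δ p) x - 1) ^ 2 ≤ (marginal p x - 1) ^ 2 := by
      rw [e, mul_pow]
      nlinarith [sq_nonneg (marginal p x - 1)]
    simp only
    nlinarith
  have hc1 : Continuous fun x => marginal (mix β V δ p) x - 1 := hc.sub continuous_const
  rw [integral_add (f := fun x => (marginal p x - 1) ^ 2)
    (integrable_of_continuous ((hcp.sub continuous_const).pow 2))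
    (integrable_of_continuous hc1),
    integral_sub (integrable_of_continuous hc) (integrable_const _),
    h.integral_marginal_mix] at h1
  simpa using h1

lemma mixEntropy_nonneg : 0 ≤ mixEntropy β V δ p := by
  have h1 := integral_nonneg (μ := volume) (f := condEntropyDensity β V δ p)
    h.condEntropyDensity_nonneg
  rw [h.integral_condEntropyDensity] at h1
  linarith [h.marginalEntropy_nonneg]

lemma integral_marginal_condEntropyDensity_le :
    ∫ x, marginal (condEntropyDensity β V δ p) x ≤ mixEntropy β V δ p := by
  rw [← integral_eq_integral_marginal (integrable_of_continuous h.continuous_condEntropyDensity),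
    h.integral_condEntropyDensity]
  linarith [h.marginalEntropy_nonneg]

lemma continuous_forceGap (i : Fin m) : Continuous fun x => forceGap β V p x i := by
  have hpos : ∀ x, marginal p x ≠ 0 := fun x => (h.lower_pos.trans_le (h.lower x)).ne'
  simp only [forceGap, meanForce_eq_div]
  exact ((continuous_marginal ((h.potential.continuous_pd _).mul h.c1.continuous)).div
    h.c1.marginal.continuous hpos).sub (continuous_gradFreeEnergy h.potential β i)

lemma abs_forceGap_le {C : ℝ} {i : Fin m} (hC : ∀ z, |fluctuation β V i z| ≤ C) (x) :
    |forceGap β V p x i| ≤ C := by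
  have hpos : 0 < marginal p x := h.lower_pos.trans_le (h.lower x)
  have h1 := abs_marginal_le (f := fun z => fluctuation β V i z * p z) h.c1.continuous (C := C)
    (fun z => by
      rw [abs_mul, abs_of_nonneg (h.nonneg z)]
      exact mul_le_mul_of_nonneg_right (hC z) (h.nonneg z)) x
  rw [marginal_fluctuation_mul h.potential h.c1.continuous h.nonneg, abs_mul,
    abs_of_pos hpos] at h1
  exact le_of_mul_le_mul_right h1 hpos

/-- The force gap is controlled by the conditional entropy. -/
lemma sq_forceGap_le {C : ℝ} {i : Fin m} (hC : ∀ z, |fluctuation β V i z| ≤ C) (x) :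
    forceGap β V p x i ^ 2
      ≤ 16 * C ^ 2 * ((1 + a⁻¹) * a⁻¹) * marginal (condEntropyDensity β V δ p) x := by
  have hS : 0 < marginal p x := h.lower_pos.trans_le (h.lower x)
  have ha := h.lower_pos
  have hf := continuous_fluctuation (β := β) h.potential i
  have cq := h.c1_mix.continuous
  have cQμ : Continuous fun z => marginal (mix β V δ p) (xi z) * muA β V z :=
    (h.c1_mix.marginal.continuous.comp continuous_xi).mul h.continuous_muA
  -- The fluctuation is centred on fibres under μ_A, so Qμ_A can be subtracted from q for free; the
  -- force gap thus measures only how far the conditional laws are from those of μ_A.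
  have e1 : marginal (fun z => fluctuation β V i z
      * (mix β V δ p z - marginal (mix β V δ p) (xi z) * muA β V z)) x
      = (1 - δ) * (forceGap β V p x i * marginal p x) := by
    have e : (fun z => fluctuation β V i z
        * (mix β V δ p z - marginal (mix β V δ p) (xi z) * muA β V z))
        = fun z => fluctuation β V i z * mix β V δ p z
          - marginal (mix β V δ p) (xi z) * (fluctuation β V i z * muA β V z) := by
      funext z; ring
    have hc1 : Continuous fun z => fluctuation β V i z * mix β V δ p z := hf.mul cq
    have hc2 : Continuous fun z =>
        marginal (mix β V δ p) (xi z) * (fluctuation β V i z * muA β V z) :=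
      (h.c1_mix.marginal.continuous.comp continuous_xi).mul (hf.mul h.continuous_muA)
    rw [e, marginal_sub hc1 hc2, marginal_fluctuation_mul_mix h.potential h.beta_pos
      h.c1.continuous h.nonneg, marginal_xi_mul,
      show marginal (fun z => fluctuation β V i z * muA β V z) x = 0 from
        marginal_fluctuation_muA h.potential h.beta_pos i x]
    ring
  have h1 := abs_marginal_le (f := fun z => fluctuation β V i z
      * (mix β V δ p z - marginal (mix β V δ p) (xi z) * muA β V z)) (cq.sub cQμ).abs (C := C)
    (fun z => by
      rw [abs_mul]
      exact mul_le_mul_of_nonneg_right (hC z) (abs_nonneg _)) x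
  rw [e1] at h1
  have h2 := pow_le_pow_left₀ (abs_nonneg _) h1 2
  rw [sq_abs, mul_pow C] at h2
  have h3 := mul_le_mul_of_nonneg_left (h.sq_integral_abs_sub_le x) (sq_nonneg C)
  have h4 := h2.trans h3
  set H := marginal (condEntropyDensity β V δ p) x with hH
  have hH0 : 0 ≤ H := integral_nonneg fun y => h.condEntropyDensity_nonneg _
  set D := forceGap β V p x i
  set S := marginal p x
  have haS : a ≤ S := h.lower x
  -- Q = (1 - δ)S + δ, and the added δ is at most 1 ≤ S/a.
  have hQ : marginal (mix β V δ p) x ≤ (1 + a⁻¹) * S := by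
    rw [h.marginal_mix]
    have h6 : 1 ≤ a⁻¹ * S := by rw [inv_mul_eq_div, one_le_div ha]; exact haS
    have h7 := h.delta_pos
    have h8 := h.delta_le
    nlinarith
  -- The restriction δ ≤ 1/2 enters here and turns the Pinsker constant 4 into 16.
  have hδ : (1:ℝ) / 4 ≤ (1 - δ) ^ 2 := by nlinarith [h.delta_le]
  have h5 : S ^ 2 * D ^ 2 ≤ 16 * C ^ 2 * ((1 + a⁻¹) * S * H) := by
    have h6 : 4 * marginal (mix β V δ p) x * H ≤ 4 * ((1 + a⁻¹) * S) * H :=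
      mul_le_mul_of_nonneg_right (by linarith) hH0
    have h7 := mul_le_mul_of_nonneg_left h6 (sq_nonneg C)
    have h8 : (1:ℝ) / 4 * (S ^ 2 * D ^ 2) ≤ (1 - δ) ^ 2 * (S ^ 2 * D ^ 2) :=
      mul_le_mul_of_nonneg_right hδ (by positivity)
    have e9 : ((1 - δ) * (D * S)) ^ 2 = (1 - δ) ^ 2 * (S ^ 2 * D ^ 2) := by ring
    rw [e9] at h4
    linarith
  have h6 : S * D ^ 2 ≤ 16 * C ^ 2 * ((1 + a⁻¹) * H) := by
    have : S * (S * D ^ 2) ≤ S * (16 * C ^ 2 * ((1 + a⁻¹) * H)) := by linarith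
    exact le_of_mul_le_mul_left this hS
  have h7 : a * D ^ 2 ≤ 16 * C ^ 2 * ((1 + a⁻¹) * H) :=
    (mul_le_mul_of_nonneg_right haS (sq_nonneg _)).trans h6
  have h8 : D ^ 2 ≤ a⁻¹ * (16 * C ^ 2 * ((1 + a⁻¹) * H)) := by
    rw [inv_mul_eq_div, le_div_iff₀ ha]; linarith
  linarith

lemma integral_sq_forceGap_le {C : ℝ} {i : Fin m} (hC : ∀ z, |fluctuation β V i z| ≤ C) :
    ∫ x, forceGap β V p x i ^ 2
      ≤ 16 * C ^ 2 * ((1 + a⁻¹) * a⁻¹) * mixEntropy β V δ p := by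
  have ha := h.lower_pos
  have h1 : ∫ x, forceGap β V p x i ^ 2
      ≤ ∫ x, 16 * C ^ 2 * ((1 + a⁻¹) * a⁻¹) * marginal (condEntropyDensity β V δ p) x :=
    integral_mono (integrable_of_continuous ((h.continuous_forceGap i).pow 2))
      ((integrable_of_continuous (continuous_marginal h.continuous_condEntropyDensity)).const_mul _)
      fun x => h.sq_forceGap_le hC x
  rw [integral_const_mul] at h1
  refine h1.trans (mul_le_mul_of_nonneg_left h.integral_marginal_condEntropyDensity_le ?_)
  positivity

/-- Consequence of the logarithmic Sobolev inequality for the conditional measures. -/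
lemma two_mul_entropy_le {ρ : ℝ} (hρ : 0 < ρ)
    (hlsi : ∀ x : UnitAddTorus (Fin m), LSI (densityMeasure (condMuA β V x)) ρ) :
    2 * ρ * (mixEntropy β V δ p - marginalEntropy β V δ p)
      ≤ ∫ z, ∑ j : Fin k, mix β V δ p z * pd (Sum.inr j) (logRatio β V δ p) z ^ 2 := by
  have hl := h.c1_logRatio
  have cI : Continuous fun z =>
      ∑ j : Fin k, mix β V δ p z * pd (Sum.inr j) (logRatio β V δ p) z ^ 2 :=
    continuous_finsetSum _ fun j _ => h.c1_mix.continuous.mul ((hl.continuous_pd _).pow 2)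
  rw [← h.integral_condEntropyDensity,
    integral_eq_integral_marginal (integrable_of_continuous h.continuous_condEntropyDensity),
    integral_eq_integral_marginal (integrable_of_continuous cI), ← integral_const_mul]
  refine integral_mono ((integrable_of_continuous
    (continuous_marginal h.continuous_condEntropyDensity)).const_mul _)
    (integrable_of_continuous (continuous_marginal cI)) fun x => ?_
  have hQ := h.marginal_mix_pos x
  set Q := marginal (mix β V δ p) x with hQdef
  have h1 := hlsi x
  rw [condMuA_eq h.potential h.beta_pos, lsi_densityMeasure_iff
    (continuous_slice h.continuous_muA x) (fun y => h.muA_pos _) hρ] at h1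
  -- The LSI is tested on q/(Qμ_A), the density of the conditional law of q with respect to that of
  -- μ_A, written as an exponential. Multiplying by Q and integrating in x then gives the claim.
  have hcℓ : C1 fun y : UnitAddTorus (Fin k) =>
      logRatio β V δ p (Sum.elim x y) - Real.log Q := (hl.slice x).sub (C1.const _)
  have hμf : ∀ y, muA β V (Sum.elim x y)
      * Real.exp (logRatio β V δ p (Sum.elim x y) - Real.log Q)
      = Q⁻¹ * mix β V δ p (Sum.elim x y) := by
    intro y
    rw [Real.exp_sub, Real.exp_log hQ, h.logRatio_eq,
      Real.exp_log (div_pos (h.mix_pos _) (h.muA_pos _))]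
    have := (h.muA_pos (Sum.elim x y)).ne'
    field_simp
  have h2 := h1 (fun y => Real.exp (logRatio β V δ p (Sum.elim x y) - Real.log Q)) hcℓ.exp
    (fun y => Real.exp_pos _) (by
      simp only [hμf]
      rw [integral_const_mul]
      exact inv_mul_cancel₀ hQ.ne')
  have e1 : ∀ y, muA β V (Sum.elim x y)
      * klFun (Real.exp (logRatio β V δ p (Sum.elim x y) - Real.log Q))
      = Q⁻¹ * condEntropyDensity β V δ p (Sum.elim x y) := by
    intro y
    rw [klFun_apply, Real.log_exp, mul_sub, mul_add, ← mul_assoc, hμf, condEntropyDensity,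
      xi_sumElim, ← hQdef]
    field_simp
    ring
  have e2 : ∀ y, muA β V (Sum.elim x y) * ∑ j : Fin k,
      (pd j (fun y => Real.exp (logRatio β V δ p (Sum.elim x y) - Real.log Q)) y) ^ 2
        / Real.exp (logRatio β V δ p (Sum.elim x y) - Real.log Q)
      = Q⁻¹ * ∑ j : Fin k, mix β V δ p (Sum.elim x y)
        * pd (Sum.inr j) (logRatio β V δ p) (Sum.elim x y) ^ 2 := by
    intro y
    rw [Finset.mul_sum, Finset.mul_sum]
    refine Finset.sum_congr rfl fun j _ => ?_
    rw [hcℓ.pd_exp, (hl.slice x).pd_sub (C1.const _), pd_const, pd_slice, sub_zero,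
      ← mul_assoc, ← hμf, mul_pow]
    have := (Real.exp_pos (logRatio β V δ p (Sum.elim x y) - Real.log Q)).ne'
    field_simp
  simp only [e1, e2] at h2
  rw [integral_const_mul, integral_const_mul] at h2
  have h3 : Q⁻¹ * marginal (condEntropyDensity β V δ p) x
      ≤ Q⁻¹ * (1 / (2 * ρ) * marginal (fun z => ∑ j : Fin k, mix β V δ p z
        * pd (Sum.inr j) (logRatio β V δ p) z ^ 2) x) := by
    refine le_of_le_of_eq h2 ?_
    simp only [marginal]
    ring
  have h4 := le_of_mul_le_mul_left h3 (inv_pos.2 hQ)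
  have h5 := mul_le_mul_of_nonneg_left h4 (show 0 ≤ 2 * ρ by positivity)
  refine h5.trans (le_of_eq ?_)
  field_simp

end RegularDensity

end Pinsker

/-! ### The bias error as a projection of the force gap -/

section BiasGap

variable {m k : ℕ} {β : ℝ} {V p : UnitAddTorus (Fin m ⊕ Fin k) → ℝ} {alg : Algorithm}
  {B : UnitAddTorus (Fin m) → Fin m → ℝ}

lemma memLp_meanForce (hV : C1 V) (hp : Continuous p) (hp0 : ∀ z, 0 ≤ p z) (i : Fin m) :
    MemLp (fun x => meanForce (gradForce V) p x i) 2 volume := by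
  obtain ⟨C, hC0, hC⟩ := exists_bound_of_continuous (hV.continuous_pd (Sum.inl i))
  exact MemLp.of_bound (measurable_meanForce hV hp i).aestronglyMeasurable C
    (ae_of_all _ fun x => abs_meanForce_le hp hp0 hC0.le hC x)

lemma memLp_forceGap (hV : C1 V) (hp : Continuous p) (hp0 : ∀ z, 0 ≤ p z) (i : Fin m) :
    MemLp (fun x => forceGap β V p x i) 2 volume :=
  (memLp_meanForce hV hp hp0 i).sub
    (memLp_two_of_continuous (continuous_gradFreeEnergy hV β i))

lemma IsBias.memLp_sub_gradFreeEnergy (hV : C1 V) (hp : Continuous p) (hp0 : ∀ z, 0 ≤ p z)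
    (hB : IsBias alg (meanForce (gradForce V) p) B) (i : Fin m) :
    MemLp (fun x => B x i - gradFreeEnergy β V x i) 2 volume :=
  (hB.memLp (memLp_meanForce hV hp hp0) i).sub
    (memLp_two_of_continuous (continuous_gradFreeEnergy hV β i))

lemma IsBias.integral_gap_mul (hV : C1 V) (hB : IsBias alg (meanForce (gradForce V) p) B) :
    ∫ x, ∑ i, ((B x i - gradFreeEnergy β V x i) - forceGap β V p x i)
      * (B x i - gradFreeEnergy β V x i) = 0 := by
  rw [← hB.integral_sub_mul_sub (hV.freeEnergy β)]
  refine integral_congr_ae (ae_of_all _ fun x => Finset.sum_congr rfl fun i _ => ?_)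
  simp only [forceGap, gradFreeEnergy]
  ring

/-- Projections contract: from ∫ (R - D)·R = 0 and |R|² ≤ |D|² + 2(R - D)·R. -/
lemma IsBias.integral_sq_sub_gradFreeEnergy_le (hV : C1 V) (hp : Continuous p)
    (hp0 : ∀ z, 0 ≤ p z) (hB : IsBias alg (meanForce (gradForce V) p) B) :
    ∫ x, ∑ i, (B x i - gradFreeEnergy β V x i) ^ 2 ≤ ∫ x, ∑ i, forceGap β V p x i ^ 2 := by
  have hR := fun i => hB.memLp_sub_gradFreeEnergy (β := β) hV hp hp0 i
  have hD := fun i => memLp_forceGap (β := β) hV hp hp0 i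
  have i1 : Integrable fun x => ∑ i, forceGap β V p x i ^ 2 :=
    integrable_finsetSum _ fun i _ => (hD i).integrable_sq
  have i2 : Integrable fun x => ∑ i, 2 * (((B x i - gradFreeEnergy β V x i)
      - forceGap β V p x i) * (B x i - gradFreeEnergy β V x i)) :=
    integrable_finsetSum _ fun i _ =>
      (integrable_mul_of_memLp ((hR i).sub (hD i)) (hR i)).const_mul 2
  have h1 : ∫ x, ∑ i, (B x i - gradFreeEnergy β V x i) ^ 2
      ≤ ∫ x, (∑ i, forceGap β V p x i ^ 2 + ∑ i, 2 * (((B x i - gradFreeEnergy β V x i)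
      - forceGap β V p x i) * (B x i - gradFreeEnergy β V x i))) := by
    refine integral_mono (integrable_finsetSum _ fun i _ => (hR i).integrable_sq) (i1.add i2)
      fun x => ?_
    simp only [← Finset.sum_add_distrib]
    refine Finset.sum_le_sum fun i _ => ?_
    nlinarith [sq_nonneg ((B x i - gradFreeEnergy β V x i) - forceGap β V p x i)]
  rw [integral_add i1 i2] at h1
  simp only [← Finset.mul_sum] at h1
  rw [integral_const_mul, hB.integral_gap_mul hV] at h1
  linarith

/-- Pointwise D·R - |D|² ≤ (R - D)·R, and the right side integrates to zero. This sign removes the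
leading x-term of the entropy production, for ABF (R = D) and PABF alike. -/
lemma IsBias.integral_forceGap_mul_sub_nonpos (hV : C1 V) (hp : Continuous p)
    (hp0 : ∀ z, 0 ≤ p z) (hB : IsBias alg (meanForce (gradForce V) p) B) :
    ∫ x, ∑ i, (forceGap β V p x i * (B x i - gradFreeEnergy β V x i)
      - forceGap β V p x i ^ 2) ≤ 0 := by
  have hR := fun i => hB.memLp_sub_gradFreeEnergy (β := β) hV hp hp0 i
  have hD := fun i => memLp_forceGap (β := β) hV hp hp0 i
  rw [← hB.integral_gap_mul (β := β) hV]
  refine integral_mono (integrable_finsetSum _ fun i _ =>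
      (integrable_mul_of_memLp (hD i) (hR i)).sub (hD i).integrable_sq)
    (integrable_finsetSum _ fun i _ => integrable_mul_of_memLp ((hR i).sub (hD i)) (hR i))
    fun x => Finset.sum_le_sum fun i _ => ?_
  nlinarith [sq_nonneg ((B x i - gradFreeEnergy β V x i) - forceGap β V p x i)]

end BiasGap

/-! ### Estimate of the entropy production -/

section Production

variable {m k : ℕ} {β δ η a : ℝ} {V p : UnitAddTorus (Fin m ⊕ Fin k) → ℝ} {alg : Algorithm}
  {B : UnitAddTorus (Fin m) → Fin m → ℝ}

/-- The cross term η²μRL is split by Young's inequality; as η²μ ≤ q, it costs η/2 of the coefficient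
of qL² and the small term η/2 R²μ. This is why δ is taken to be η². The rest of -β⁻¹qL² is made
linear in qL by discarding the square q(L - βD)². -/
lemma quadratic_production_le {β η q μ L R D : ℝ} (hβ : 0 < β) (hη : 0 < η) (hηβ : η ≤ 2 * β⁻¹)
    (hq : 0 < q) (hμ : 0 ≤ μ) (hqμ : η ^ 2 * μ ≤ q) :
    -β⁻¹ * (q * L ^ 2) + (q - η ^ 2 * μ) * R * L
      ≤ (R - 2 * (1 - η * β / 2) * D) * (q * L) + (1 - η * β / 2) * β * D ^ 2 * q
        + η / 2 * R ^ 2 * μ := by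
  have hκ : 0 ≤ (1 - η * β / 2) * β⁻¹ := by
    have : (1 - η * β / 2) * β⁻¹ = β⁻¹ - η / 2 := by field_simp
    rw [this]; linarith
  have h1 : -(η ^ 2 * μ * R * L) ≤ η / 2 * (R ^ 2 * μ) + η / 2 * (q * L ^ 2) := by
    have h2 : 0 ≤ η / 2 * (μ * (R + η * L) ^ 2) := by positivity
    have h3 : η / 2 * (η ^ 2 * μ * L ^ 2) ≤ η / 2 * (q * L ^ 2) :=
      mul_le_mul_of_nonneg_left (mul_le_mul_of_nonneg_right hqμ (sq_nonneg _)) (by positivity)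
    nlinarith
  have h4 : 0 ≤ (1 - η * β / 2) * β⁻¹ * (q * (L - β * D) ^ 2) :=
    mul_nonneg hκ (by positivity)
  have h5 : (1 - η * β / 2) * β⁻¹ * (q * (L - β * D) ^ 2)
      = β⁻¹ * (q * L ^ 2) - η / 2 * (q * L ^ 2) - 2 * (1 - η * β / 2) * D * (q * L)
        + (1 - η * β / 2) * β * D ^ 2 * q := by
    field_simp
    ring
  nlinarith

/-- Here P stands for ∂ᵢS. After writing S = 1 + (S - 1), the left side is a multiple of D·R - D²,
plus products carrying P or S - 1, plus terms of order η. The products are split by Young's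
inequality with parameter τ. -/
lemma young_production_le {β η τ C S D R P : ℝ} (hβ : 0 < β) (hη : 0 < η) (hηβ : η ≤ 2 * β⁻¹)
    (hη1 : η ^ 2 ≤ 1) (hτ : 0 < τ) (hS : 0 ≤ S) (hD : |D| ≤ C) :
    (R - 2 * (1 - η * β / 2) * D) * ((1 - η ^ 2) * (P + β * (D * S)))
      + (1 - η * β / 2) * β * D ^ 2 * ((1 - η ^ 2) * S + η ^ 2) + η / 2 * R ^ 2
    ≤ (1 - η ^ 2) * β * (D * R - D ^ 2) + τ * (R ^ 2 + 3 * D ^ 2)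
      + (P ^ 2 + β ^ 2 * C ^ 2 * (S - 1) ^ 2) / τ + (P ^ 2 + η * β / 2 * C ^ 2)
      + η * β ^ 2 / 2 * C ^ 2 * S + β * η ^ 2 * C ^ 2 + η / 2 * R ^ 2 := by
  have hD2 : D ^ 2 ≤ C ^ 2 := by
    rw [← sq_abs D]; exact pow_le_pow_left₀ (abs_nonneg _) hD 2
  set κ := η * β / 2 with hκ
  have hκ0 : 0 < κ := by positivity
  have hκ1 : κ ≤ 1 := by
    have := mul_le_mul_of_nonneg_right hηβ hβ.le
    rw [mul_assoc, inv_mul_cancel₀ hβ.ne'] at this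
    rw [hκ]; linarith
  set d := 1 - η ^ 2 with hd
  have hd0 : 0 ≤ d := by rw [hd]; linarith
  have hd1 : d ≤ 1 := by rw [hd]; nlinarith
  have young : ∀ x y : ℝ, x * y ≤ τ / 4 * y ^ 2 + x ^ 2 / τ := by
    intro x y
    have : 0 ≤ (τ / 2 * y - x) ^ 2 / τ := by positivity
    have e : (τ / 2 * y - x) ^ 2 / τ = τ / 4 * y ^ 2 - x * y + x ^ 2 / τ := by
      field_simp; ring
    linarith
  have e1 : (R - 2 * (1 - κ) * D) * (d * (P + β * (D * S)))
      + (1 - κ) * β * D ^ 2 * (d * S + η ^ 2) + η / 2 * R ^ 2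
      = d * β * (D * R - D ^ 2)
        + d * (P * (R - 2 * D) + β * (S - 1) * D * (R - D) + 2 * κ * (P * D))
        + d * (κ * β * (S * D ^ 2)) + (1 - κ) * (β * η ^ 2 * D ^ 2) + η / 2 * R ^ 2 := by ring
  rw [e1]
  have y1 := young P (R - 2 * D)
  have y2 := young (β * (S - 1) * D) (R - D)
  have hT0 : 0 ≤ τ * (R ^ 2 + 3 * D ^ 2) + (P ^ 2 + β ^ 2 * C ^ 2 * (S - 1) ^ 2) / τ
      + (P ^ 2 + κ * C ^ 2) := by positivity
  have y3 : (β * (S - 1) * D) ^ 2 / τ ≤ β ^ 2 * C ^ 2 * (S - 1) ^ 2 / τ := by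
    refine div_le_div_of_nonneg_right ?_ hτ.le
    have := mul_le_mul_of_nonneg_left hD2 (show 0 ≤ (β * (S - 1)) ^ 2 by positivity)
    nlinarith
  have y4 : 2 * κ * (P * D) ≤ P ^ 2 + κ * C ^ 2 := by
    have h1 : 0 ≤ κ * (P - D) ^ 2 := by positivity
    have h2 : κ * P ^ 2 ≤ 1 * P ^ 2 := mul_le_mul_of_nonneg_right hκ1 (sq_nonneg _)
    have h3 : κ * D ^ 2 ≤ κ * C ^ 2 := mul_le_mul_of_nonneg_left hD2 hκ0.le
    nlinarith
  have y5 : τ / 4 * (R - 2 * D) ^ 2 + τ / 4 * (R - D) ^ 2 ≤ τ * (R ^ 2 + 3 * D ^ 2) := by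
    have : 0 ≤ τ / 4 * ((R + 2 * D) ^ 2 + (R + D) ^ 2 + 2 * D ^ 2) := by positivity
    nlinarith
  have hT : P * (R - 2 * D) + β * (S - 1) * D * (R - D) + 2 * κ * (P * D)
      ≤ τ * (R ^ 2 + 3 * D ^ 2) + (P ^ 2 + β ^ 2 * C ^ 2 * (S - 1) ^ 2) / τ
      + (P ^ 2 + κ * C ^ 2) := by
    rw [add_div]; linarith
  have z1 := (mul_le_mul_of_nonneg_left hT hd0).trans (mul_le_of_le_one_left hT0 hd1)
  have z2 : d * (κ * β * (S * D ^ 2)) ≤ η * β ^ 2 / 2 * C ^ 2 * S := by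
    have h1 : κ * β * (S * D ^ 2) ≤ κ * β * (S * C ^ 2) := by gcongr
    have h2 : 0 ≤ κ * β * (S * D ^ 2) := by positivity
    have h3 := mul_le_of_le_one_left h2 hd1
    have e : κ * β * (S * C ^ 2) = η * β ^ 2 / 2 * C ^ 2 * S := by rw [hκ]; ring
    linarith
  have z3 : (1 - κ) * (β * η ^ 2 * D ^ 2) ≤ β * η ^ 2 * C ^ 2 := by
    have h1 : β * η ^ 2 * D ^ 2 ≤ β * η ^ 2 * C ^ 2 := by gcongr
    have h2 : (1 - κ) * (β * η ^ 2 * D ^ 2) ≤ β * η ^ 2 * D ^ 2 :=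
      mul_le_of_le_one_left (by positivity) (by linarith)
    linarith
  linarith

/-- Integrated form of the entropy production in a biased direction. -/
lemma RegularDensity.integral_production_inl_le (h : RegularDensity β V (η ^ 2) a p) (hη : 0 < η)
    (hηβ : η ≤ 2 * β⁻¹) {R : UnitAddTorus (Fin m) → ℝ} (hR : MemLp R 2 volume) (i : Fin m) :
    ∫ z, (-β⁻¹ * (mix β V (η ^ 2) p z * pd (Sum.inl i) (logRatio β V (η ^ 2) p) z ^ 2)
      + (mix β V (η ^ 2) p z - η ^ 2 * muA β V z) * R (xi z)
        * pd (Sum.inl i) (logRatio β V (η ^ 2) p) z)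
    ≤ ∫ x, ((R x - 2 * (1 - η * β / 2) * forceGap β V p x i)
        * ((1 - η ^ 2) * (pd i (marginal p) x + β * (forceGap β V p x i * marginal p x)))
      + (1 - η * β / 2) * β * forceGap β V p x i ^ 2 * ((1 - η ^ 2) * marginal p x + η ^ 2)
      + η / 2 * R x ^ 2) := by
  have cq := h.c1_mix.continuous
  have cμ := h.continuous_muA
  have cL := h.c1_logRatio.continuous_pd (Sum.inl i)
  have cD := h.continuous_forceGap i
  have cqL : Continuous fun z => mix β V (η ^ 2) p z
    * pd (Sum.inl i) (logRatio β V (η ^ 2) p) z := cq.mul cL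
  have hxi : ∀ {f : UnitAddTorus (Fin m) → ℝ}, Integrable f →
      Integrable fun z : UnitAddTorus (Fin m ⊕ Fin k) => f (xi z) := fun hf =>
    measurePreserving_xi.integrable_comp_of_integrable hf
  have hR1 : Integrable R := hR.integrable one_le_two
  have j1 : Integrable fun z => (R (xi z) - 2 * (1 - η * β / 2) * forceGap β V p (xi z) i)
      * (mix β V (η ^ 2) p z * pd (Sum.inl i) (logRatio β V (η ^ 2) p) z) := by
    simp only [mul_comm _ (mix β V (η ^ 2) p _ * _)]
    exact integrable_continuous_mul cqL
      (hxi (hR1.sub ((integrable_of_continuous cD).const_mul _)))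
  have j2 : Integrable fun z => (1 - η * β / 2) * β * forceGap β V p (xi z) i ^ 2
      * mix β V (η ^ 2) p z :=
    integrable_of_continuous ((continuous_const.mul ((cD.comp continuous_xi).pow 2)).mul cq)
  have j3 : Integrable fun z => η / 2 * R (xi z) ^ 2 * muA β V z := by
    simp only [mul_comm _ (muA β V _)]
    exact integrable_continuous_mul cμ (hxi (hR.integrable_sq.const_mul _))
  have j0 : Integrable fun z => (-β⁻¹ * (mix β V (η ^ 2) p z
        * pd (Sum.inl i) (logRatio β V (η ^ 2) p) z ^ 2)
      + (mix β V (η ^ 2) p z - η ^ 2 * muA β V z) * R (xi z)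
        * pd (Sum.inl i) (logRatio β V (η ^ 2) p) z) := by
    refine (integrable_of_continuous (continuous_const.mul (cq.mul (cL.pow 2)))).add ?_
    have := integrable_continuous_mul ((cq.sub (continuous_const.mul cμ)).mul cL) (hxi hR1)
      (f := fun z => (mix β V (η ^ 2) p z - η ^ 2 * muA β V z)
        * pd (Sum.inl i) (logRatio β V (η ^ 2) p) z)
    refine this.congr (ae_of_all _ fun z => ?_)
    ring
  have h1 := integral_mono j0 ((j1.add j2).add j3) fun z =>
    quadratic_production_le h.beta_pos hη hηβ (h.mix_pos z) (h.muA_pos z).le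
      (mul_muA_le_mix h.nonneg h.delta_le_one z)
      (L := pd (Sum.inl i) (logRatio β V (η ^ 2) p) z) (R := R (xi z))
      (D := forceGap β V p (xi z) i)
  refine h1.trans (le_of_eq ?_)
  have k1 := integrable_marginal j1
  have k2 := integrable_marginal j2
  have k3 := integrable_marginal j3
  have e1 : marginal (fun z => (R (xi z) - 2 * (1 - η * β / 2) * forceGap β V p (xi z) i)
      * (mix β V (η ^ 2) p z * pd (Sum.inl i) (logRatio β V (η ^ 2) p) z))
      = fun x => (R x - 2 * (1 - η * β / 2) * forceGap β V p x i)
        * ((1 - η ^ 2) * (pd i (marginal p) x + β * (forceGap β V p x i * marginal p x))) := by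
    funext x
    rw [marginal_xi_mul (fun x => R x - 2 * (1 - η * β / 2) * forceGap β V p x i),
      marginal_mix_mul_pd_logRatio h.potential h.beta_pos h.c1 h.nonneg h.delta_pos
      h.delta_le_one]
  have e2 : marginal (fun z => (1 - η * β / 2) * β * forceGap β V p (xi z) i ^ 2
      * mix β V (η ^ 2) p z) = fun x => (1 - η * β / 2) * β * forceGap β V p x i ^ 2
        * ((1 - η ^ 2) * marginal p x + η ^ 2) := by
    funext x
    rw [marginal_xi_mul (fun x => (1 - η * β / 2) * β * forceGap β V p x i ^ 2), h.marginal_mix]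
  have e3 : marginal (fun z => η / 2 * R (xi z) ^ 2 * muA β V z)
      = fun x => η / 2 * R x ^ 2 := by
    funext x
    rw [marginal_xi_mul (fun x => η / 2 * R x ^ 2), marginal_muA h.potential h.beta_pos, mul_one]
  rw [e1] at k1
  rw [e2] at k2
  rw [e3] at k3
  refine ((integral_add' (j1.add j2) j3).trans (congrArg (· + _) (integral_add' j1 j2))).trans
    (Eq.trans ?_ ((integral_add (k1.add k2) k3).trans
      (congrArg (· + _) (integral_add k1 k2))).symm)
  rw [integral_eq_integral_marginal j1, integral_eq_integral_marginal j2,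
    integral_eq_integral_marginal j3, e1, e2, e3]

lemma RegularDensity.integral_sq_le (h : RegularDensity β V δ a p) :
    ∫ x, (marginal p x - 1) ^ 2 ≤ ∫ x, ∑ i, pd i (marginal p) x ^ 2 := by
  have hS := h.c1.marginal
  have hu : C1 fun x => marginal p x - 1 := hS.sub (C1.const _)
  have h0 : ∫ x, (marginal p x - 1) = 0 := by
    rw [integral_sub (integrable_of_continuous hS.continuous) (integrable_const _),
      ← integral_eq_integral_marginal (integrable_of_continuous h.c1.continuous), h.mass]
    simp
  have h1 := hu.poincare h0
  have e : ∀ i x, pd i (fun x => marginal p x - 1) x = pd i (marginal p) x := by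
    intro i x
    rw [hS.pd_sub (C1.const _), pd_const, sub_zero]
  simp only [e] at h1
  have h2 : 0 ≤ ∫ x, (marginal p x - 1) ^ 2 := integral_nonneg fun x => sq_nonneg _
  have h3 : (1:ℝ) ≤ 4 * Real.pi ^ 2 := by nlinarith [Real.pi_gt_three]
  exact (le_mul_of_one_le_left h2 h3).trans h1

/-- The total contribution of the biased directions to the entropy production. -/
lemma RegularDensity.sum_integral_production_le (h : RegularDensity β V (η ^ 2) a p) (hη : 0 < η)
    (hηβ : η ≤ 2 * β⁻¹) (hB : IsBias alg (meanForce (gradForce V) p) B) {C τ : ℝ} (hτ : 0 < τ)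
    (hC : ∀ i z, |fluctuation β V i z| ≤ C) :
    ∑ i : Fin m, ∫ z, (-β⁻¹ * (mix β V (η ^ 2) p z
        * pd (Sum.inl i) (logRatio β V (η ^ 2) p) z ^ 2)
      + (mix β V (η ^ 2) p z - η ^ 2 * muA β V z) * (B (xi z) i - gradFreeEnergy β V (xi z) i)
        * pd (Sum.inl i) (logRatio β V (η ^ 2) p) z)
    ≤ 4 * τ * (m * (16 * C ^ 2 * ((1 + a⁻¹) * a⁻¹))) * mixEntropy β V (η ^ 2) p
      + (1 + (1 + m * β ^ 2 * C ^ 2) / τ) * (∫ x, ∑ i, pd i (marginal p) x ^ 2)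
      + m * C ^ 2 * (β ^ 2 + 2 * β + 1) * η := by
  have hβ := h.beta_pos
  have hη1 : η ^ 2 ≤ 1 := h.delta_le_one
  have hη2 : η ^ 2 ≤ η := by nlinarith
  have hR := fun i => hB.memLp_sub_gradFreeEnergy (β := β) h.potential h.c1.continuous h.nonneg i
  have cD := h.continuous_forceGap
  have hS := h.c1.marginal
  have i1 : Integrable fun x => (1 - η ^ 2) * β * ∑ i, (forceGap β V p x i
      * (B x i - gradFreeEnergy β V x i) - forceGap β V p x i ^ 2) :=
    (integrable_finsetSum _ fun i _ => (integrable_mul_of_memLp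
      (memLp_two_of_continuous (cD i)) (hR i)).sub
        (integrable_of_continuous ((cD i).pow 2))).const_mul _
  have i2 : Integrable fun x => (τ + η / 2) * ∑ i, (B x i - gradFreeEnergy β V x i) ^ 2 :=
    (integrable_finsetSum _ fun i _ => (hR i).integrable_sq).const_mul _
  have i3 : Integrable fun x => 3 * τ * ∑ i, forceGap β V p x i ^ 2 :=
    (integrable_finsetSum _ fun i _ => integrable_of_continuous ((cD i).pow 2)).const_mul _
  have i4 : Integrable fun x => (1 + 1 / τ) * ∑ i, pd i (marginal p) x ^ 2 :=
    (integrable_finsetSum _ fun i _ =>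
      integrable_of_continuous ((hS.continuous_pd i).pow 2)).const_mul _
  have i5 : Integrable fun x => (m * β ^ 2 * C ^ 2) / τ * (marginal p x - 1) ^ 2 :=
    (integrable_of_continuous ((hS.continuous.sub continuous_const).pow 2)).const_mul _
  have i6 : Integrable fun x => η * β ^ 2 / 2 * C ^ 2 * m * marginal p x :=
    (integrable_of_continuous hS.continuous).const_mul _
  have i7 : Integrable fun _ : UnitAddTorus (Fin m) =>
      m * C ^ 2 * (η * β / 2 + β * η ^ 2) := integrable_const _
  have hmass : ∫ x, marginal p x = 1 := by
    rw [← integral_eq_integral_marginal (integrable_of_continuous h.c1.continuous), h.mass]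
  have key : ∑ i : Fin m, ∫ z, (-β⁻¹ * (mix β V (η ^ 2) p z
        * pd (Sum.inl i) (logRatio β V (η ^ 2) p) z ^ 2)
      + (mix β V (η ^ 2) p z - η ^ 2 * muA β V z) * (B (xi z) i - gradFreeEnergy β V (xi z) i)
        * pd (Sum.inl i) (logRatio β V (η ^ 2) p) z)
      ≤ (1 - η ^ 2) * β * (∫ x, ∑ i, (forceGap β V p x i
        * (B x i - gradFreeEnergy β V x i) - forceGap β V p x i ^ 2))
      + (τ + η / 2) * (∫ x, ∑ i, (B x i - gradFreeEnergy β V x i) ^ 2)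
      + 3 * τ * (∫ x, ∑ i, forceGap β V p x i ^ 2)
      + (1 + 1 / τ) * (∫ x, ∑ i, pd i (marginal p) x ^ 2)
      + (m * β ^ 2 * C ^ 2) / τ * (∫ x, (marginal p x - 1) ^ 2)
      + η * β ^ 2 / 2 * C ^ 2 * m
      + m * C ^ 2 * (η * β / 2 + β * η ^ 2) := by
    have hS0 : ∀ x, 0 ≤ marginal p x := fun x => h.lower_pos.le.trans (h.lower x)
    have j0 : ∀ i, Integrable fun x =>
        ((B x i - gradFreeEnergy β V x i) - 2 * (1 - η * β / 2) * forceGap β V p x i)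
          * ((1 - η ^ 2) * (pd i (marginal p) x + β * (forceGap β V p x i * marginal p x)))
        + (1 - η * β / 2) * β * forceGap β V p x i ^ 2 * ((1 - η ^ 2) * marginal p x + η ^ 2)
        + η / 2 * (B x i - gradFreeEnergy β V x i) ^ 2 := fun i =>
      ((integrable_mul_of_memLp ((hR i).sub ((memLp_two_of_continuous (cD i)).const_mul _))
        (memLp_two_of_continuous (continuous_const.mul ((hS.continuous_pd i).add
          (continuous_const.mul ((cD i).mul hS.continuous)))))).add
        (integrable_of_continuous ((continuous_const.mul ((cD i).pow 2)).mul
          ((continuous_const.mul hS.continuous).add continuous_const)))).add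
        ((hR i).integrable_sq.const_mul _)
    have h1 : ∀ x, ∑ i, (((B x i - gradFreeEnergy β V x i)
            - 2 * (1 - η * β / 2) * forceGap β V p x i)
          * ((1 - η ^ 2) * (pd i (marginal p) x + β * (forceGap β V p x i * marginal p x)))
        + (1 - η * β / 2) * β * forceGap β V p x i ^ 2 * ((1 - η ^ 2) * marginal p x + η ^ 2)
        + η / 2 * (B x i - gradFreeEnergy β V x i) ^ 2)
        ≤ (1 - η ^ 2) * β * ∑ i, (forceGap β V p x i
        * (B x i - gradFreeEnergy β V x i) - forceGap β V p x i ^ 2)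
      + (τ + η / 2) * ∑ i, (B x i - gradFreeEnergy β V x i) ^ 2
      + 3 * τ * ∑ i, forceGap β V p x i ^ 2
      + (1 + 1 / τ) * ∑ i, pd i (marginal p) x ^ 2
      + (m * β ^ 2 * C ^ 2) / τ * (marginal p x - 1) ^ 2
      + η * β ^ 2 / 2 * C ^ 2 * m * marginal p x
      + m * C ^ 2 * (η * β / 2 + β * η ^ 2) := by
      intro x
      refine (Finset.sum_le_sum fun i _ => young_production_le hβ hη hηβ hη1 hτ (hS0 x)
        (h.abs_forceGap_le (hC i) x)).trans (le_of_eq ?_)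
      simp only [Finset.sum_add_distrib, ← Finset.mul_sum, ← Finset.sum_div, Finset.sum_const,
        Finset.card_univ, Fintype.card_fin, nsmul_eq_mul]
      ring
    calc _ ≤ _ := Finset.sum_le_sum fun i _ => h.integral_production_inl_le hη hηβ (hR i) i
      _ = _ := (integral_finsetSum _ fun i _ => j0 i).symm
      _ ≤ _ := integral_mono (integrable_finsetSum _ fun i _ => j0 i)
          ((((((i1.add i2).add i3).add i4).add i5).add i6).add i7) h1
      _ = _ := by
          rw [integral_add' (((((i1.add i2).add i3).add i4).add i5).add i6) i7,
            integral_add' ((((i1.add i2).add i3).add i4).add i5) i6,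
            integral_add' (((i1.add i2).add i3).add i4) i5,
            integral_add' ((i1.add i2).add i3) i4, integral_add' (i1.add i2) i3,
            integral_add' i1 i2]
          simp only [integral_const_mul, hmass, integral_const, probReal_univ, one_smul, mul_one]
  -- A crude bound suffices where the coefficient is η/2; the next bound, in terms of the entropy,
  -- is needed where it is τ.
  have hDm : ∫ x, ∑ i, forceGap β V p x i ^ 2 ≤ m * C ^ 2 := by
    have := integral_mono (μ := volume) (integrable_finsetSum Finset.univ fun i _ =>
        integrable_of_continuous ((cD i).pow 2)) (integrable_const (m * C ^ 2)) fun x => by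
      have : ∑ i, forceGap β V p x i ^ 2 ≤ ∑ i : Fin m, C ^ 2 :=
        Finset.sum_le_sum fun i _ => by
          rw [← sq_abs]; exact pow_le_pow_left₀ (abs_nonneg _) (h.abs_forceGap_le (hC i) x) 2
      simpa using this
    simpa using this
  have hDE : ∫ x, ∑ i, forceGap β V p x i ^ 2
      ≤ m * (16 * C ^ 2 * ((1 + a⁻¹) * a⁻¹)) * mixEntropy β V (η ^ 2) p := by
    have i0 : ∀ i ∈ Finset.univ, Integrable fun x => forceGap β V p x i ^ 2 := fun i _ =>
      integrable_of_continuous ((cD i).pow 2)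
    rw [integral_finsetSum _ i0]
    refine (Finset.sum_le_sum fun i _ => h.integral_sq_forceGap_le (hC i)).trans (le_of_eq ?_)
    simp
    ring
  have hRD := hB.integral_sq_sub_gradFreeEnergy_le (β := β) h.potential h.c1.continuous h.nonneg
  have hneg := hB.integral_forceGap_mul_sub_nonpos (β := β) h.potential h.c1.continuous h.nonneg
  have hPoin := h.integral_sq_le
  set E := mixEntropy β V (η ^ 2) p
  set Dd := ∫ x, ∑ i, forceGap β V p x i ^ 2
  set Rr := ∫ x, ∑ i, (B x i - gradFreeEnergy β V x i) ^ 2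
  set Y := ∫ x, ∑ i, pd i (marginal p) x ^ 2
  set U := ∫ x, (marginal p x - 1) ^ 2
  have t1 : (1 - η ^ 2) * β * (∫ x, ∑ i, (forceGap β V p x i
        * (B x i - gradFreeEnergy β V x i) - forceGap β V p x i ^ 2)) ≤ 0 :=
    mul_nonpos_of_nonneg_of_nonpos (mul_nonneg (by linarith) hβ.le) hneg
  have t2 : (τ + η / 2) * Rr ≤ (τ + η / 2) * Dd := mul_le_mul_of_nonneg_left hRD (by positivity)
  have t3 : η / 2 * Dd ≤ η / 2 * (m * C ^ 2) := mul_le_mul_of_nonneg_left hDm (by positivity)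
  have t4 : 4 * τ * Dd ≤ 4 * τ * (m * (16 * C ^ 2 * ((1 + a⁻¹) * a⁻¹)) * E) :=
    mul_le_mul_of_nonneg_left hDE (by positivity)
  have t5 : (m * β ^ 2 * C ^ 2) / τ * U ≤ (m * β ^ 2 * C ^ 2) / τ * Y :=
    mul_le_mul_of_nonneg_left hPoin (by positivity)
  have t6 : m * C ^ 2 * (β * η ^ 2) ≤ m * C ^ 2 * (β * η) := by gcongr
  have t7 : 0 ≤ m * C ^ 2 * β * η := by positivity
  have t8 : 0 ≤ m * C ^ 2 * β ^ 2 * η := by positivity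
  have t9 : 0 ≤ m * C ^ 2 * η := by positivity
  have e1 : (1 + (1 + m * β ^ 2 * C ^ 2) / τ) * Y
      = (1 + 1 / τ) * Y + (m * β ^ 2 * C ^ 2) / τ * Y := by ring
  rw [e1]
  nlinarith

/-- The entropy production of the regularized density splits over the two groups of variables. -/
lemma RegularDensity.integral_production_eq (h : RegularDensity β V δ a p)
    (hB : IsBias alg (meanForce (gradForce V) p) B) :
    ∫ z, ∑ i, pd i (logRatio β V δ p) z * ((1 - δ) * current β (gradForce V) p B z i)
      = ∑ i : Fin m, (∫ z, (-β⁻¹ * (mix β V δ p z * pd (Sum.inl i) (logRatio β V δ p) z ^ 2)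
        + (mix β V δ p z - δ * muA β V z) * (B (xi z) i - gradFreeEnergy β V (xi z) i)
          * pd (Sum.inl i) (logRatio β V δ p) z))
        - β⁻¹ * ∫ z, ∑ j : Fin k, mix β V δ p z * pd (Sum.inr j) (logRatio β V δ p) z ^ 2 := by
  have cq := h.c1_mix.continuous
  have cL := h.c1_logRatio.continuous_pd
  have hR := fun i => (hB.memLp_sub_gradFreeEnergy (β := β) h.potential h.c1.continuous
    h.nonneg i).integrable one_le_two
  have j1 : ∀ i : Fin m, Integrable fun z =>
      (-β⁻¹ * (mix β V δ p z * pd (Sum.inl i) (logRatio β V δ p) z ^ 2)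
        + (mix β V δ p z - δ * muA β V z) * (B (xi z) i - gradFreeEnergy β V (xi z) i)
          * pd (Sum.inl i) (logRatio β V δ p) z) := by
    intro i
    refine (integrable_of_continuous (continuous_const.mul (cq.mul ((cL _).pow 2)))).add ?_
    have := integrable_continuous_mul
      ((cq.sub (continuous_const.mul h.continuous_muA)).mul (cL (Sum.inl i)))
      (measurePreserving_xi.integrable_comp_of_integrable (hR i))
      (f := fun z => (mix β V δ p z - δ * muA β V z) * pd (Sum.inl i) (logRatio β V δ p) z)
    refine this.congr (ae_of_all _ fun z => ?_)
    simp only [Function.comp_apply]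
    ring
  have j2 : Integrable fun z =>
      ∑ j : Fin k, mix β V δ p z * pd (Sum.inr j) (logRatio β V δ p) z ^ 2 :=
    integrable_finsetSum _ fun j _ => integrable_of_continuous (cq.mul ((cL _).pow 2))
  rw [← integral_finsetSum _ fun i _ => j1 i, ← integral_const_mul,
    ← integral_sub (integrable_finsetSum _ fun i _ => j1 i) (j2.const_mul _)]
  refine integral_congr_ae (ae_of_all _ fun z => ?_)
  simp only [sub_mul_current_eq h.potential h.beta_pos h.c1 h.nonneg h.delta_pos h.delta_le_one,
    Fintype.sum_sum_type, Sum.elim_inl, Sum.elim_inr]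
  rw [sub_eq_add_neg (Finset.sum _ _), Finset.mul_sum, ← Finset.sum_neg_distrib]
  congr 1
  · exact Finset.sum_congr rfl fun i _ => by ring
  · exact Finset.sum_congr rfl fun i _ => by ring

/-- Entropy production estimate for the regularized density. -/
lemma exists_production_le {ρ : ℝ} (hV : C1 V) (hβ : 0 < β) (hρ : 0 < ρ)
    (hlsi : ∀ x : UnitAddTorus (Fin m), LSI (densityMeasure (condMuA β V x)) ρ) (ha : 0 < a) :
    ∃ K : ℝ, 0 < K ∧ ∀ (alg : Algorithm) (p : UnitAddTorus (Fin m ⊕ Fin k) → ℝ)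
      (B : UnitAddTorus (Fin m) → Fin m → ℝ) (η θ : ℝ), 0 < η → η ≤ 2 * β⁻¹ → 0 < θ →
      RegularDensity β V (η ^ 2) a p → IsBias alg (meanForce (gradForce V) p) B →
      ∫ z, ∑ i, pd i (logRatio β V (η ^ 2) p) z
          * ((1 - η ^ 2) * current β (gradForce V) p B z i)
        ≤ -(2 * ρ * β⁻¹ - θ) * mixEntropy β V (η ^ 2) p
          + K * (1 + 1 / θ) * (∫ x, ∑ i, pd i (marginal p) x ^ 2) + K * η := by
  choose C hC0 hC using fun i : Fin m =>
    exists_bound_of_continuous (continuous_fluctuation (β := β) hV i)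
  set c := ∑ i, C i with hc
  have hc0 : 0 ≤ c := Finset.sum_nonneg fun i _ => (hC0 i).le
  have hcb : ∀ i z, |fluctuation β V i z| ≤ c := fun i z =>
    (hC i z).trans (Finset.single_le_sum (fun i _ => (hC0 i).le) (Finset.mem_univ i))
  set M := (m : ℝ) * (16 * c ^ 2 * ((1 + a⁻¹) * a⁻¹)) with hM
  have hM0 : 0 ≤ M := by positivity
  refine ⟨1 + 2 * ρ * β⁻¹ + (1 + m * β ^ 2 * c ^ 2) * (4 * M + 1)
    + m * c ^ 2 * (β ^ 2 + 2 * β + 1), by positivity, ?_⟩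
  intro alg p B η θ hη hηβ hθ h hB
  -- This τ makes 4τM at most θ, so the force gap costs at most θ of the decay rate; the 1 keeps the
  -- denominator positive.
  have hτ : 0 < θ / (4 * M + 1) := by positivity
  have h1 := h.sum_integral_production_le hη hηβ hB hτ hcb
  have h2 := h.two_mul_entropy_le hρ hlsi
  -- LSI on fibres misses the entropy of the marginal, which is instead paid for by ∫ |∇S|².
  have h3 := h.marginalEntropy_le.trans h.integral_sq_le
  have hE := h.mixEntropy_nonneg
  rw [h.integral_production_eq hB]
  rw [← hM] at h1
  have hY : 0 ≤ ∫ x, ∑ i, pd i (marginal p) x ^ 2 :=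
    integral_nonneg fun x => Finset.sum_nonneg fun i _ => sq_nonneg _
  set Y := ∫ x, ∑ i, pd i (marginal p) x ^ 2
  set E := mixEntropy β V (η ^ 2) p
  set W := marginalEntropy β V (η ^ 2) p
  set I := ∫ z, ∑ j : Fin k, mix β V (η ^ 2) p z * pd (Sum.inr j) (logRatio β V (η ^ 2) p) z ^ 2
  have t1 : 4 * (θ / (4 * M + 1)) * M * E ≤ θ * E := by
    refine mul_le_mul_of_nonneg_right ?_ hE
    have e : 4 * (θ / (4 * M + 1)) * M = θ * (4 * M) / (4 * M + 1) := by ring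
    rw [e, div_le_iff₀ (by positivity)]
    nlinarith
  have t2 : β⁻¹ * (2 * ρ * (E - W)) ≤ β⁻¹ * I := mul_le_mul_of_nonneg_left h2 (by positivity)
  have t3 : 2 * ρ * β⁻¹ * W ≤ 2 * ρ * β⁻¹ * Y := mul_le_mul_of_nonneg_left h3 (by positivity)
  have e4 : (1 + (1 + m * β ^ 2 * c ^ 2) / (θ / (4 * M + 1))) * Y
      = Y + (1 + m * β ^ 2 * c ^ 2) * (4 * M + 1) * (1 / θ) * Y := by
    field_simp
  rw [e4] at h1
  have hρβ : 0 ≤ 2 * ρ * β⁻¹ := by positivity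
  set b1 := 2 * ρ * β⁻¹
  have hb2 : 0 ≤ (1 + m * β ^ 2 * c ^ 2) * (4 * M + 1) := by positivity
  set b2 := (1 + m * β ^ 2 * c ^ 2) * (4 * M + 1)
  have hb3 : 0 ≤ m * c ^ 2 * (β ^ 2 + 2 * β + 1) := by positivity
  set b3 := m * c ^ 2 * (β ^ 2 + 2 * β + 1)
  have hθ' : 0 ≤ 1 / θ := by positivity
  set r := 1 / θ
  have s1 : 0 ≤ b1 * r * Y := by positivity
  have s2 : 0 ≤ b2 * Y := by positivity
  have s3 : 0 ≤ b3 * Y := by positivity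
  have s4 : 0 ≤ b3 * r * Y := by positivity
  have s5 : 0 ≤ r * Y := by positivity
  have s6 : 0 ≤ b1 * η := by positivity
  have s7 : 0 ≤ b2 * η := by positivity
  have t2' : b1 * (E - W) ≤ β⁻¹ * I := by
    refine le_trans (le_of_eq ?_) t2
    simp only [b1]; ring
  nlinarith

end Production

/-! ### Affine images and marginals of weak flows -/

section FlowOperations

variable {ι : Type} [Fintype ι] [DecidableEq ι] {q : ℝ → UnitAddTorus ι → ℝ}
  {J : ℝ → UnitAddTorus ι → ι → ℝ}

/-- The added function is constant in time and contributes no flux. It is used with c = 1 - δ and f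
= δμ_A. -/
lemma WeakFlow.const_mul_add (h : WeakFlow q J) (c : ℝ) {f : UnitAddTorus ι → ℝ} (hf : C1 f) :
    WeakFlow (fun t z => c * q t z + f z) (fun t z i => c * J t z i) where
  c1 t ht := ((h.c1 t ht).const_mul c).add hf
  continuousOn := (continuousOn_const.mul h.continuousOn).add
    (hf.continuous.comp continuous_snd).continuousOn
  continuousOn_pd i := by
    refine ((continuousOn_const (c := c)).mul (h.continuousOn_pd i)).add
      ((hf.continuous_pd i).comp continuous_snd).continuousOn |>.congr fun r hr => ?_
    have hc := h.c1 r.1 hr.1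
    exact ((hc.const_mul c).pd_add hf i r.2).trans (by rw [hc.pd_const_mul]; rfl)
  integrable t ht i := (h.integrable t ht i).const_mul c
  bound t ht := by
    obtain ⟨C, r, hr, hC⟩ := h.bound t ht
    refine ⟨|c| * C, r, hr, fun s hs => ⟨(hC s hs).1, ?_⟩⟩
    simp only [abs_mul, integral_const_mul, ← Finset.mul_sum]
    exact mul_le_mul_of_nonneg_left (hC s hs).2 (abs_nonneg c)
  equation φ hφ t ht := by
    have hφc : Continuous φ := (hφ.of_le (by simp) : IsC 1 φ).c1.continuous
    have h1 := ((h.equation φ hφ t ht).const_mul c).add_const (∫ z, φ z * f z)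
    have e : ∫ z, ∑ i, pd i φ z * (c * J t z i) = c * ∫ z, ∑ i, pd i φ z * J t z i := by
      rw [← integral_const_mul]
      refine integral_congr_ae (ae_of_all _ fun z => ?_)
      simp only [Finset.mul_sum]
      exact Finset.sum_congr rfl fun i _ => by ring
    rw [e]
    refine h1.congr_of_eventuallyEq ?_
    filter_upwards [lt_mem_nhds ht] with s hs
    have hqc := (h.c1 s hs).continuous
    have hc1 : Continuous fun z => c * (φ z * q s z) := continuous_const.mul (hφc.mul hqc)
    have hc2 : Continuous fun z => φ z * f z := hφc.mul hf.continuous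
    rw [← integral_const_mul, ← integral_add (integrable_of_continuous hc1)
      (integrable_of_continuous hc2)]
    exact integral_congr_ae (ae_of_all _ fun z => by ring)

variable {m k : ℕ} {p : ℝ → UnitAddTorus (Fin m ⊕ Fin k) → ℝ}
  {I : ℝ → UnitAddTorus (Fin m ⊕ Fin k) → (Fin m ⊕ Fin k) → ℝ}

lemma continuousOn_marginal {U : Set ℝ} {f : ℝ → UnitAddTorus (Fin m ⊕ Fin k) → ℝ}
    (hf : ContinuousOn (fun r : ℝ × UnitAddTorus (Fin m ⊕ Fin k) => f r.1 r.2) (U ×ˢ univ)) :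
    ContinuousOn (fun r : ℝ × UnitAddTorus (Fin m) => marginal (f r.1) r.2) (U ×ˢ univ) := by
  refine continuousOn_integral_of_compact_support
    (f := fun (r : ℝ × UnitAddTorus (Fin m)) (y : UnitAddTorus (Fin k)) => f r.1 (Sum.elim r.2 y))
    (k := univ) isCompact_univ ?_ (fun _ y _ hy => absurd (mem_univ y) hy)
  refine hf.comp (f := fun r : (ℝ × UnitAddTorus (Fin m)) × UnitAddTorus (Fin k) =>
    (r.1.1, (Sum.elim r.1.2 r.2 : UnitAddTorus (Fin m ⊕ Fin k)))) ?_ ?_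
  · refine Continuous.continuousOn (continuous_fst.fst.prodMk ?_)
    exact continuous_sumElim.comp (continuous_fst.snd.prodMk continuous_snd)
  · exact fun r hr => ⟨hr.1.1, mem_univ _⟩

lemma integral_abs_marginal_le {f : UnitAddTorus (Fin m ⊕ Fin k) → ℝ} (hf : Integrable f) :
    ∫ x, |marginal f x| ≤ ∫ z, |f z| := by
  rw [integral_eq_integral_marginal hf.abs]
  exact integral_mono (integrable_marginal hf).abs (integrable_marginal hf.abs)
    fun x => abs_integral_le_integral_abs

/-- The marginal of a weak flow is a weak flow. -/
lemma WeakFlow.marginal (h : WeakFlow p I) :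
    WeakFlow (fun t => marginal (p t))
      (fun t x i => ABF.marginal (fun z => I t z (Sum.inl i)) x) where
  c1 t ht := (h.c1 t ht).marginal
  continuousOn := continuousOn_marginal h.continuousOn
  continuousOn_pd i := (continuousOn_marginal (f := fun t => pd (Sum.inl i) (p t))
    (h.continuousOn_pd (Sum.inl i))).congr fun r hr => (h.c1 r.1 hr.1).pd_marginal i r.2
  integrable t ht i := integrable_marginal (h.integrable t ht (Sum.inl i))
  bound t ht := by
    obtain ⟨C, r, hr, hC⟩ := h.bound t ht
    refine ⟨C, r, hr, fun s hs => ⟨(hC s hs).1, le_trans ?_ (hC s hs).2⟩⟩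
    rw [Fintype.sum_sum_type]
    refine le_add_of_le_of_nonneg (Finset.sum_le_sum fun i _ =>
      integral_abs_marginal_le (h.integrable s (hC s hs).1 (Sum.inl i)))
      (Finset.sum_nonneg fun j _ => integral_nonneg fun z => abs_nonneg _)
  equation φ hφ t ht := by
    have hφ1 : C1 φ := (hφ.of_le (by simp) : IsC 1 φ).c1
    -- Test functions of x alone see only the fibre averages of the first m components of the flux.
    have h1 := h.equation _ hφ.comp_xi t ht
    have e : ∫ z, ∑ i, pd i (fun z => φ (xi z)) z * I t z i
        = ∫ x, ∑ i, pd i φ x * ABF.marginal (fun z => I t z (Sum.inl i)) x := by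
      simp only [Fintype.sum_sum_type, pd_comp_xi_inl, pd_comp_xi_inr, zero_mul,
        Finset.sum_const_zero, add_zero]
      have j1 : ∀ i : Fin m, Integrable fun z => pd i φ (xi z) * I t z (Sum.inl i) := fun i =>
        integrable_continuous_mul ((hφ1.continuous_pd i).comp continuous_xi)
          (h.integrable t ht _)
      have j2 : ∀ i : Fin m, Integrable fun x =>
          pd i φ x * ABF.marginal (fun z => I t z (Sum.inl i)) x := fun i =>
        integrable_continuous_mul (hφ1.continuous_pd i)
          (integrable_marginal (h.integrable t ht _))
      rw [integral_finsetSum _ fun i _ => j1 i, integral_finsetSum _ fun i _ => j2 i]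
      refine Finset.sum_congr rfl fun i _ => ?_
      rw [integral_eq_integral_marginal (j1 i)]
      simp only [marginal_xi_mul]
    rw [e] at h1
    refine h1.congr_of_eventuallyEq ?_
    filter_upwards [lt_mem_nhds ht] with s hs
    have hc : Continuous fun z => φ (xi z) * p s z :=
      (hφ1.continuous.comp continuous_xi).mul (h.c1 s hs).continuous
    rw [integral_eq_integral_marginal (integrable_of_continuous hc)]
    exact integral_congr_ae (ae_of_all _ fun x => (marginal_xi_mul φ (p s) x).symm)

end FlowOperations

/-! ### Solutions as weak flows with locally bounded flux in L¹ -/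

section SolutionFlow

variable {m k : ℕ} {β : ℝ} {V : UnitAddTorus (Fin m ⊕ Fin k) → ℝ} {alg : Algorithm}
  {p : ℝ → UnitAddTorus (Fin m ⊕ Fin k) → ℝ} {B : ℝ → UnitAddTorus (Fin m) → Fin m → ℝ}

/-- The bias is bounded in `L¹` uniformly with respect to the density. -/
lemma exists_integral_abs_bias_le (hV : C1 V) : ∃ C : ℝ, 0 ≤ C ∧
    ∀ (alg : Algorithm) (p : UnitAddTorus (Fin m ⊕ Fin k) → ℝ)
      (B : UnitAddTorus (Fin m) → Fin m → ℝ), Continuous p → (∀ z, 0 ≤ p z) →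
      IsBias alg (meanForce (gradForce V) p) B → ∀ i, ∫ x, |B x i| ≤ C := by
  choose a ha0 ha using fun i : Fin m => exists_bound_of_continuous (hV.continuous_pd (Sum.inl i))
  choose b hb0 hb using fun i : Fin m =>
    exists_bound_of_continuous (continuous_gradFreeEnergy hV 1 i)
  refine ⟨∑ i, (a i + b i) ^ 2 + (1 + ∑ i, b i), ?_, fun alg p B hp hp0 hB i => ?_⟩
  · have := Finset.sum_nonneg fun i (_ : i ∈ Finset.univ) => (hb0 i).le
    have := Finset.sum_nonneg fun i (_ : i ∈ Finset.univ) => sq_nonneg (a i + b i)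
    linarith
  -- The value 1 of the inverse temperature is arbitrary: any fixed gradient field can serve as the
  -- reference with which the projection is compared.
  have hR := hB.memLp_sub_gradFreeEnergy (β := 1) hV hp hp0
  have hD : ∀ x, ∑ i, forceGap 1 V p x i ^ 2 ≤ ∑ i, (a i + b i) ^ 2 := fun x =>
    Finset.sum_le_sum fun i _ => by
      rw [← sq_abs]
      refine pow_le_pow_left₀ (abs_nonneg _) ((abs_sub _ _).trans (add_le_add ?_ (hb i x))) 2
      exact abs_meanForce_le hp hp0 (ha0 i).le (ha i) x
  have h1 := (hB.integral_sq_sub_gradFreeEnergy_le (β := 1) hV hp hp0).trans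
    ((integral_mono (integrable_finsetSum _ fun i _ =>
      (memLp_forceGap (β := 1) hV hp hp0 i).integrable_sq) (integrable_const _) hD))
  have iR : Integrable fun x => ∑ i, (B x i - gradFreeEnergy 1 V x i) ^ 2 :=
    integrable_finsetSum _ fun i _ => (hR i).integrable_sq
  have h2 : ∫ x, |B x i| ≤ ∫ x, (∑ i, (B x i - gradFreeEnergy 1 V x i) ^ 2 + (1 + ∑ i, b i)) := by
    refine integral_mono
      ((hB.memLp (memLp_meanForce hV hp hp0) i).integrable one_le_two).abs
      (iR.add (integrable_const _)) fun x => ?_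
    have h3 : (B x i - gradFreeEnergy 1 V x i) ^ 2
        ≤ ∑ i, (B x i - gradFreeEnergy 1 V x i) ^ 2 :=
      Finset.single_le_sum (f := fun i => (B x i - gradFreeEnergy 1 V x i) ^ 2)
        (fun i _ => sq_nonneg _) (Finset.mem_univ i)
    have h4 : |gradFreeEnergy 1 V x i| ≤ ∑ i, b i := (hb i x).trans
      (Finset.single_le_sum (fun i _ => (hb0 i).le) (Finset.mem_univ i))
    have h5 : |B x i| ≤ |B x i - gradFreeEnergy 1 V x i| + |gradFreeEnergy 1 V x i| := by
      simpa using abs_add_le (B x i - gradFreeEnergy 1 V x i) (gradFreeEnergy 1 V x i)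
    have h6 : |B x i - gradFreeEnergy 1 V x i| ≤ (B x i - gradFreeEnergy 1 V x i) ^ 2 + 1 := by
      rw [← sq_abs]; nlinarith [sq_nonneg (|B x i - gradFreeEnergy 1 V x i| - 1),
        abs_nonneg (B x i - gradFreeEnergy 1 V x i)]
    simp only
    linarith
  rw [integral_add iR (integrable_const _)] at h2
  simp only [integral_const, probReal_univ, one_smul] at h1 h2
  linarith

namespace IsSolution

variable (h : IsSolution alg β (gradForce V) p B)

include h

lemma continuous_density {t : ℝ} (ht : 0 ≤ t) : Continuous (p t) :=
  h.continuousOn.comp_continuous (f := fun z => (t, z)) (by fun_prop)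
    fun z => ⟨ht, mem_univ _⟩

lemma c1 {t : ℝ} (ht : 0 < t) : C1 (p t) := (h.isC_one t ht).c1

lemma integrable_bias (hV : C1 V) {t : ℝ} (ht : 0 ≤ t) (i : Fin m) :
    Integrable fun x => B t x i :=
  ((h.bias t ht).memLp (memLp_meanForce hV (h.continuous_density ht) (h.nonneg t ht))
    i).integrable one_le_two

lemma integrable_bias_xi (hV : C1 V) {t : ℝ} (ht : 0 ≤ t) (i : Fin m ⊕ Fin k) :
    Integrable fun z : UnitAddTorus (Fin m ⊕ Fin k) =>
      (Sum.elim (B t (xi z)) (fun _ => 0) i : ℝ) := by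
  rcases i with i | j
  · exact measurePreserving_xi.integrable_comp_of_integrable (h.integrable_bias hV ht i)
  · exact integrable_const 0

lemma integrable_current (hV : C1 V) {t : ℝ} (ht : 0 < t) (i : Fin m ⊕ Fin k) :
    Integrable fun z => current β (gradForce V) (p t) (B t) z i := by
  have hc := (h.c1 ht).continuous
  refine ((integrable_of_continuous (continuous_const.mul ((h.c1 ht).continuous_pd i))).add
    (integrable_of_continuous ((hV.continuous_pd i).neg.mul hc))).add ?_
  simp only [mul_comm _ (p t _)]
  exact integrable_continuous_mul hc (h.integrable_bias_xi hV ht.le i)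

/-- The densities of a solution form a weak flow. -/
lemma weakFlow (hV : C1 V) :
    WeakFlow p (fun t => current β (gradForce V) (p t) (B t)) where
  c1 t ht := h.c1 ht
  continuousOn := h.continuousOn.mono (prod_mono_left Ioi_subset_Ici_self)
  continuousOn_pd := h.continuousOn_pd
  integrable t ht := h.integrable_current hV ht
  bound t ht := by
    -- The density and its gradient are bounded uniformly on a compact time interval away from zero,
    -- whereas the bias is estimated only in L¹: a projection need not be bounded.
    have hK : IsCompact (Icc (t / 2) (2 * t) ×ˢ
        (univ : Set (UnitAddTorus (Fin m ⊕ Fin k)))) := isCompact_Icc.prod isCompact_univ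
    have hsub : Icc (t / 2) (2 * t) ⊆ Ioi 0 := fun s hs => lt_of_lt_of_le (by positivity) hs.1
    obtain ⟨Cp, hCp⟩ := hK.exists_bound_of_continuousOn
      (h.continuousOn.mono (prod_mono_left (hsub.trans Ioi_subset_Ici_self)))
    choose Cd hCd using fun i => hK.exists_bound_of_continuousOn
      ((h.continuousOn_pd i).mono (prod_mono_left hsub))
    choose Cv _ hCv using fun i => exists_bound_of_continuous (hV.continuous_pd i)
    obtain ⟨Cb, hCb0, hCb⟩ := exists_integral_abs_bias_le hV
    refine ⟨∑ i, (|β⁻¹| * Cd i + Cv i * Cp + Cp * Cb), t / 2, by positivity, fun s hs => ?_⟩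
    rw [Metric.mem_ball, Real.dist_eq, abs_lt] at hs
    have hsI : s ∈ Icc (t / 2) (2 * t) := ⟨by linarith [hs.1], by linarith [hs.2]⟩
    have hs0 : 0 < s := hsub hsI
    have hCp0 : 0 ≤ Cp := (norm_nonneg _).trans (hCp (s, 0) ⟨hsI, mem_univ _⟩)
    refine ⟨hs0, Finset.sum_le_sum fun i _ => ?_⟩
    have hb := h.integrable_bias_xi hV hs0.le i
    have hb1 : ∫ z : UnitAddTorus (Fin m ⊕ Fin k),
        |(Sum.elim (B s (xi z)) (fun _ => 0) i : ℝ)| ≤ Cb := by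
      rcases i with i | j
      · rw [integral_eq_integral_marginal hb.abs]
        simp only [marginal, xi_sumElim, Sum.elim_inl, integral_const, probReal_univ, one_smul]
        exact hCb alg (p s) (B s) (h.continuous_density hs0.le) (h.nonneg s hs0.le)
          (h.bias s hs0.le) i
      · simpa using hCb0
    have h1 : ∫ z, |current β (gradForce V) (p s) (B s) z i|
        ≤ ∫ z : UnitAddTorus (Fin m ⊕ Fin k), (|β⁻¹| * Cd i + Cv i * Cp
          + Cp * |(Sum.elim (B s (xi z)) (fun _ => 0) i : ℝ)|) := by
      refine integral_mono (h.integrable_current hV hs0 i).abs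
        ((integrable_const _).add (hb.abs.const_mul _)) fun z => ?_
      have hp : |p s z| ≤ Cp := hCp (s, z) ⟨hsI, mem_univ _⟩
      have hd : |pd i (p s) z| ≤ Cd i := hCd i (s, z) ⟨hsI, mem_univ _⟩
      simp only [current, gradForce]
      refine (abs_add_le _ _).trans (add_le_add ((abs_add_le _ _).trans (add_le_add ?_ ?_)) ?_)
      · rw [abs_mul, abs_neg]
        exact mul_le_mul_of_nonneg_left hd (abs_nonneg _)
      · rw [abs_mul, abs_neg]
        exact mul_le_mul (hCv i z) hp (abs_nonneg _) ((abs_nonneg _).trans (hCv i z))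
      · rw [abs_mul, mul_comm]
        exact mul_le_mul_of_nonneg_right hp (abs_nonneg _)
    rw [integral_add (integrable_const _) (hb.abs.const_mul _), integral_const_mul,
      integral_const, probReal_univ, one_smul] at h1
    have := mul_le_mul_of_nonneg_left hb1 hCp0
    linarith
  equation φ hφ t ht := by
    simp only [sum_pd_mul_current]
    exact h.equation φ hφ t ht

end IsSolution

end SolutionFlow

/-! ### Powers of the positive part -/

section PositivePart

lemma hasDerivAt_max_zero_pow (n : ℕ) (x : ℝ) :
    HasDerivAt (fun x : ℝ => max x 0 ^ (n + 2)) ((n + 2 : ℕ) * max x 0 ^ (n + 1)) x := by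
  rcases lt_trichotomy x 0 with hx | rfl | hx
  · rw [max_eq_right hx.le, zero_pow (by omega), mul_zero]
    refine (hasDerivAt_const x (0 : ℝ)).congr_of_eventuallyEq ?_
    filter_upwards [gt_mem_nhds hx] with y hy
    rw [max_eq_right hy.le, zero_pow (by omega)]
  · have hc : Continuous fun x : ℝ => max x 0 ^ (n + 1) := by fun_prop
    rw [hasDerivAt_iff_tendsto_slope]
    simp only [max_self, ne_eq, Nat.add_eq_zero_iff, one_ne_zero, and_false, not_false_eq_true,
      zero_pow, mul_zero]
    have h0 := (hc.tendsto 0).mono_left (nhdsWithin_le_nhds (s := {0}ᶜ))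
    simp only [max_self, ne_eq, Nat.add_eq_zero_iff, one_ne_zero, and_false, not_false_eq_true,
      zero_pow] at h0
    refine h0.congr' ?_
    filter_upwards [self_mem_nhdsWithin] with y hy
    have hy0 : y ≠ 0 := hy
    rw [slope_def_field, max_self, zero_pow (by omega), sub_zero, sub_zero, eq_div_iff hy0]
    rcases le_total y 0 with h | h
    · simp [max_eq_right h]
    · rw [max_eq_left h]; ring
  · rw [max_eq_left hx.le]
    refine (hasDerivAt_pow (n + 2) x).congr_of_eventuallyEq ?_
    filter_upwards [lt_mem_nhds hx] with y hy
    rw [max_eq_left hy.le]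

lemma hasDerivAt_max_sub_pow (n : ℕ) (a x : ℝ) :
    HasDerivAt (fun x : ℝ => max (a - x) 0 ^ (n + 2))
      (-((n + 2 : ℕ) * max (a - x) 0 ^ (n + 1))) x := by
  have h := (hasDerivAt_max_zero_pow n (a - x)).comp x ((hasDerivAt_id x).const_sub a)
  rw [mul_neg_one] at h
  exact h

lemma max_sub_pow_three_convex (a s t : ℝ) :
    -3 * max (a - s) 0 ^ 2 * (t - s) ≤ max (a - t) 0 ^ 3 - max (a - s) 0 ^ 3 := by
  have hs0 : 0 ≤ max (a - s) 0 := le_max_right _ _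
  have ht0 : 0 ≤ max (a - t) 0 := le_max_right _ _
  have ht : a - t ≤ max (a - t) 0 := le_max_left _ _
  rcases le_total (a - s) 0 with h | h
  · rw [max_eq_right h]
    simp
  · rw [max_eq_left h] at hs0 ⊢
    set y := max (a - t) 0
    -- The factorization y³ - 3c²y + 2c³ = (y - c)²(y + 2c) with c = a - s expresses the convexity
    -- of the cube.
    have h1 : 0 ≤ (y - (a - s)) ^ 2 * (y + 2 * (a - s)) := by positivity
    have h2 : 0 ≤ (a - s) ^ 2 * (y - (a - t)) := mul_nonneg (sq_nonneg _) (by linarith)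
    nlinarith

end PositivePart

/-! ### The marginal equation: dissipation and minimum principle -/

section Marginal

variable {m k : ℕ} {β : ℝ} {V : UnitAddTorus (Fin m ⊕ Fin k) → ℝ} {alg : Algorithm}
  {p : ℝ → UnitAddTorus (Fin m ⊕ Fin k) → ℝ} {B : ℝ → UnitAddTorus (Fin m) → Fin m → ℝ}

lemma marginal_current_inl (hV : C1 V) {p : UnitAddTorus (Fin m ⊕ Fin k) → ℝ} (hp : C1 p)
    (hp0 : ∀ z, 0 ≤ p z) (B : UnitAddTorus (Fin m) → Fin m → ℝ) (i : Fin m)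
    (x : UnitAddTorus (Fin m)) :
    marginal (fun z => current β (gradForce V) p B z (Sum.inl i)) x
      = -β⁻¹ * pd i (marginal p) x
        + (B x i - meanForce (gradForce V) p x i) * marginal p x := by
  have c1 : Continuous fun y : UnitAddTorus (Fin k) => -β⁻¹ * pd (Sum.inl i) p (Sum.elim x y) :=
    continuous_const.mul (continuous_slice (hp.continuous_pd _) x)
  have c2 : Continuous fun y : UnitAddTorus (Fin k) =>
      pd (Sum.inl i) V (Sum.elim x y) * p (Sum.elim x y) :=
    (continuous_slice (hV.continuous_pd _) x).mul (continuous_slice hp.continuous x)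
  have c3 : Continuous fun y : UnitAddTorus (Fin k) => B x i * p (Sum.elim x y) :=
    continuous_const.mul (continuous_slice hp.continuous x)
  have e : ∀ y, current β (gradForce V) p B (Sum.elim x y) (Sum.inl i)
      = -β⁻¹ * pd (Sum.inl i) p (Sum.elim x y)
        - pd (Sum.inl i) V (Sum.elim x y) * p (Sum.elim x y) + B x i * p (Sum.elim x y) := by
    intro y
    simp only [current, gradForce, xi_sumElim, Sum.elim_inl]
    ring
  rw [sub_mul, meanForce_mul_marginal hp.continuous hp0, hp.pd_marginal]
  simp only [marginal, e]
  rw [integral_add (f := fun y => -β⁻¹ * pd (Sum.inl i) p (Sum.elim x y)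
        - pd (Sum.inl i) V (Sum.elim x y) * p (Sum.elim x y))
    (integrable_of_continuous (c1.sub c2)) (integrable_of_continuous c3),
    integral_sub (integrable_of_continuous c1) (integrable_of_continuous c2),
    integral_const_mul, integral_const_mul]
  ring

namespace IsSolution

variable (h : IsSolution alg β (gradForce V) p B)

include h

lemma mass_marginal {t : ℝ} (ht : 0 ≤ t) : ∫ x, marginal (p t) x = 1 := by
  rw [← integral_eq_integral_marginal (integrable_of_continuous (h.continuous_density ht)),
    h.mass t ht]

/-- Dissipation of convex functionals of the marginal density, which solves the heat equation up
to a divergence free drift. -/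
lemma hasDerivAt_integral_comp_marginal (hV : C1 V) {Φ g g' ψ : ℝ → ℝ}
    (hconv : ∀ a b, g a * (b - a) ≤ Φ b - Φ a) (hΦ : Continuous Φ)
    (hg : ∀ a, HasDerivAt g (g' a) a) (hg' : Continuous g')
    (hψ : ∀ a, HasDerivAt ψ (g' a * a) a) {t : ℝ} (ht : 0 < t) :
    HasDerivAt (fun s => ∫ x, Φ (marginal (p s) x))
      (-β⁻¹ * ∫ x, g' (marginal (p t) x) * ∑ i, pd i (marginal (p t)) x ^ 2) t := by
  have hS := (h.c1 ht).marginal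
  have h1 := (h.weakFlow hV).marginal.hasDerivAt_integral_comp (S := univ)
    (fun _ _ _ => mem_univ _) (fun a _ b _ => hconv a b) hΦ.continuousOn (fun a _ => hg a)
    hg'.continuousOn ht
  convert h1 using 1
  -- The drift contributes (B - G)·∇S multiplied by g'(S)S. Since ψ is a primitive of s g'(s), this
  -- is (B - G)·∇ψ(S), whose integral vanishes.
  have hψS := hS.comp_aux (s := univ) (fun _ => mem_univ _) (fun a _ => hψ a)
    (hg'.mul continuous_id).continuousOn
  have h2 := (h.bias t ht.le).integral_sub_mul_pd hψS.1
  have hBG : ∀ i, Integrable fun x => B t x i - meanForce (gradForce V) (p t) x i := fun i =>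
    (h.integrable_bias hV ht.le i).sub ((memLp_meanForce hV (h.continuous_density ht.le)
      (h.nonneg t ht.le) i).integrable one_le_two)
  have i2 : Integrable fun x => ∑ i, (B t x i - meanForce (gradForce V) (p t) x i)
      * pd i (fun x => ψ (marginal (p t) x)) x :=
    integrable_finsetSum _ fun i _ => by
      simp only [mul_comm (B t _ i - _)]
      exact integrable_continuous_mul (hψS.1.continuous_pd i) (hBG i)
  have i1 : Integrable fun x => -β⁻¹ * (g' (marginal (p t) x)
      * ∑ i, pd i (marginal (p t)) x ^ 2) :=
    integrable_of_continuous (continuous_const.mul ((hg'.comp hS.continuous).mul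
      (continuous_finsetSum _ fun i _ => (hS.continuous_pd i).pow 2)))
  rw [← integral_const_mul, ← add_zero (∫ x, -β⁻¹ * _), ← h2, ← integral_add i1 i2]
  refine integral_congr_ae (ae_of_all _ fun x => ?_)
  simp only [marginal_current_inl hV (h.c1 ht) (h.nonneg t ht.le), hψS.2, Finset.mul_sum,
    ← Finset.sum_add_distrib]
  exact Finset.sum_congr rfl fun i _ => by ring

lemma continuousOn_integral_comp_marginal {Φ : ℝ → ℝ} (hΦ : Continuous Φ) :
    ContinuousOn (fun t => ∫ x, Φ (marginal (p t) x)) (Ici 0) :=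
  continuousOn_integral_Ici (hΦ.comp_continuousOn (continuousOn_marginal h.continuousOn))

lemma hasDerivAt_integral_sq (hV : C1 V) {t : ℝ} (ht : 0 < t) :
    HasDerivAt (fun s => ∫ x, (marginal (p s) x - 1) ^ 2)
      (-(2 * β⁻¹) * ∫ x, ∑ i, pd i (marginal (p t)) x ^ 2) t := by
  have h1 := h.hasDerivAt_integral_comp_marginal hV (Φ := fun s => (s - 1) ^ 2)
    (g := fun s => 2 * (s - 1)) (g' := fun _ => 2) (ψ := fun s => s ^ 2)
    (fun a b => by nlinarith [sq_nonneg (b - a)]) (by fun_prop)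
    (fun a => by simpa using ((hasDerivAt_id a).sub_const 1).const_mul 2)
    continuous_const (fun a => by simpa using hasDerivAt_pow 2 a) ht
  rw [integral_const_mul] at h1
  convert h1 using 1
  ring

/-- The minimum of the marginal density does not decrease. -/
lemma le_marginal (hV : C1 V) (hβ : 0 < β) {a : ℝ} (ha : ∀ x, a ≤ marginal (p 0) x) {t : ℝ}
    (ht : 0 ≤ t) (x : UnitAddTorus (Fin m)) : a ≤ marginal (p t) x := by
  -- The cube is used because the second derivative of Φ must be continuous. The integral starts at
  -- zero, cannot increase and is nonnegative, so S stays above a.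
  have hΦ : Continuous fun s : ℝ => max (a - s) 0 ^ 3 := by fun_prop
  have hder := fun s (hs : 0 < s) => h.hasDerivAt_integral_comp_marginal hV
    (Φ := fun s => max (a - s) 0 ^ 3) (g := fun s => -3 * max (a - s) 0 ^ 2)
    (g' := fun s => 6 * max (a - s) 0)
    (ψ := fun s => -3 * a * max (a - s) 0 ^ 2 + 2 * max (a - s) 0 ^ 3)
    (max_sub_pow_three_convex a) hΦ
    (fun s => ((hasDerivAt_max_sub_pow 0 a s).const_mul (-3)).congr_deriv (by push_cast; ring))
    (by fun_prop)
    (fun s => (((hasDerivAt_max_sub_pow 0 a s).const_mul (-3 * a)).add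
        ((hasDerivAt_max_sub_pow 1 a s).const_mul 2)).congr_deriv <| by
      push_cast
      rcases le_total (a - s) 0 with h | h
      · simp [max_eq_right h]
      · rw [max_eq_left h]; ring) hs
  have hanti : AntitoneOn (fun t => ∫ x, max (a - marginal (p t) x) 0 ^ 3) (Ici 0) := by
    refine antitoneOn_of_deriv_nonpos (convex_Ici 0)
      (h.continuousOn_integral_comp_marginal hΦ) ?_ ?_
    · rw [interior_Ici]
      exact fun s hs => (hder s hs).differentiableAt.differentiableWithinAt
    · rw [interior_Ici]
      intro s hs
      rw [(hder s hs).deriv]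
      refine mul_nonpos_of_nonpos_of_nonneg (by simpa using hβ.le)
        (integral_nonneg fun x => mul_nonneg (mul_nonneg (by norm_num) (le_max_right _ _))
          (Finset.sum_nonneg fun i _ => sq_nonneg _))
  have h0 : ∫ x, max (a - marginal (p 0) x) 0 ^ 3 = 0 := by
    have : ∀ x, max (a - marginal (p 0) x) 0 ^ 3 = 0 := fun x => by
      rw [max_eq_right (sub_nonpos.2 (ha x))]; norm_num
    simp [this]
  have h1 := hanti self_mem_Ici ht ht
  simp only [h0] at h1
  have hcont : Continuous fun x => max (a - marginal (p t) x) 0 ^ 3 :=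
    hΦ.comp (continuous_marginal (h.continuous_density ht))
  have hnn : 0 ≤ fun x => max (a - marginal (p t) x) 0 ^ 3 := fun x =>
    pow_nonneg (le_max_right _ _) 3
  have h2 := (integral_eq_zero_iff_of_nonneg hnn (integrable_of_continuous hcont)).1
    (le_antisymm h1 (integral_nonneg hnn))
  have h3 : max (a - marginal (p t) x) 0 ^ 3 = 0 := congrFun ((hcont.ae_eq_iff_eq _ continuous_const).1 h2) x
  have h4 : max (a - marginal (p t) x) 0 = 0 := pow_eq_zero_iff three_ne_zero |>.1 h3
  have := max_eq_right_iff.1 h4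
  linarith

end IsSolution

end Marginal

/-! ### Time derivative of the regularized entropy -/

section EntropyFlow

variable {m k : ℕ} {β δ : ℝ} {V : UnitAddTorus (Fin m ⊕ Fin k) → ℝ} {alg : Algorithm}
  {p : ℝ → UnitAddTorus (Fin m ⊕ Fin k) → ℝ} {B : ℝ → UnitAddTorus (Fin m) → Fin m → ℝ}

lemma mul_log_convex {a b : ℝ} (ha : 0 < a) (hb : 0 < b) :
    (Real.log a + 1) * (b - a) ≤ b * Real.log b - a * Real.log a := by
  have h := mul_le_mul_of_nonneg_left (Real.log_le_sub_one_of_pos (div_pos ha hb)) hb.le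
  rw [Real.log_div ha.ne' hb.ne', mul_sub, mul_sub, mul_div_cancel₀ _ hb.ne'] at h
  linarith

namespace IsSolution

variable (h : IsSolution alg β (gradForce V) p B)

include h

/-- Time derivative of the relative entropy of the regularized density. -/
lemma hasDerivAt_mixEntropy (hV : C1 V) (hβ : 0 < β) (hδ : 0 < δ) (hδ1 : δ ≤ 1) {t : ℝ}
    (ht : 0 < t) :
    HasDerivAt (fun s => mixEntropy β V δ (p s))
      (∫ z, ∑ i, pd i (logRatio β V δ (p t)) z
        * ((1 - δ) * current β (gradForce V) (p t) (B t) z i)) t := by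
  have hw : WeakFlow (fun t => mix β V δ (p t))
      (fun t z i => (1 - δ) * current β (gradForce V) (p t) (B t) z i) :=
    (h.weakFlow hV).const_mul_add (1 - δ) ((hV.muA hβ).const_mul δ)
  have hpos : ∀ t, 0 < t → ∀ z, mix β V δ (p t) z ∈ Ioi (0:ℝ) := fun t ht =>
    mix_pos hV hβ (h.nonneg t ht.le) hδ hδ1
  have hlμ := (hV.muA hβ).log (muA_pos hV hβ)
  have h1 := hw.hasDerivAt_integral_comp hpos (Φ := fun s => s * Real.log s)
    (g := fun s => Real.log s + 1) (g' := fun s => s⁻¹)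
    (fun a ha b hb => mul_log_convex ha hb) Real.continuous_mul_log.continuousOn
    (fun a ha => (Real.hasDerivAt_log (ne_of_gt ha)).add_const 1)
    (continuousOn_inv₀.mono fun a ha => ne_of_gt ha) ht
  -- The relative entropy is the convex functional ∫ q ln q minus the linear functional ∫ q ln μ_A;
  -- each has its own derivative formula.
  have h2 := h1.sub (hw.hasDerivAt_integral_mul hlμ ht)
  have hq := (hw.c1 t ht)
  have i1 : Integrable fun z => ∑ i, (mix β V δ (p t) z)⁻¹ * pd i (mix β V δ (p t)) z
      * ((1 - δ) * current β (gradForce V) (p t) (B t) z i) :=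
    integrable_finsetSum _ fun i _ => integrable_continuous_mul
      ((hq.continuous.inv₀ fun z => (hpos t ht z).ne').mul (hq.continuous_pd i))
      (hw.integrable t ht i)
  have i2 : Integrable fun z => ∑ i, pd i (fun z => Real.log (muA β V z)) z
      * ((1 - δ) * current β (gradForce V) (p t) (B t) z i) :=
    integrable_finsetSum _ fun i _ => hw.integrable_pd_mul hlμ ht i
  rw [← integral_sub i1 i2] at h2
  have e : ∫ z, ∑ i, pd i (logRatio β V δ (p t)) z
        * ((1 - δ) * current β (gradForce V) (p t) (B t) z i)
      = ∫ z, (∑ i, (mix β V δ (p t) z)⁻¹ * pd i (mix β V δ (p t)) z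
          * ((1 - δ) * current β (gradForce V) (p t) (B t) z i)
        - ∑ i, pd i (fun z => Real.log (muA β V z)) z
          * ((1 - δ) * current β (gradForce V) (p t) (B t) z i)) := by
    refine integral_congr_ae (ae_of_all _ fun z => ?_)
    simp only [← Finset.sum_sub_distrib,
      pd_logRatio hV hβ (h.c1 ht) (h.nonneg t ht.le) hδ hδ1]
    exact Finset.sum_congr rfl fun i _ => by ring
  rw [e]
  refine h2.congr_of_eventuallyEq ?_
  filter_upwards [lt_mem_nhds ht] with s hs
  have hqs := (hw.c1 s hs).continuous
  have c1 : Continuous fun z => mix β V δ (p s) z * Real.log (mix β V δ (p s) z) :=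
    Real.continuous_mul_log.comp hqs
  have c2 : Continuous fun z => Real.log (muA β V z) * mix β V δ (p s) z :=
    hlμ.continuous.mul hqs
  rw [Pi.sub_apply, ← integral_sub (integrable_of_continuous c1) (integrable_of_continuous c2)]
  refine integral_congr_ae (ae_of_all _ fun z => ?_)
  simp only [logRatio]
  ring

lemma continuousOn_mixEntropy (hV : C1 V) (hβ : 0 < β) :
    ContinuousOn (fun t => mixEntropy β V δ (p t)) (Ici 0) := by
  have hμ := (hV.muA hβ).continuous
  have hmix : ContinuousOn (fun r : ℝ × UnitAddTorus (Fin m ⊕ Fin k) => mix β V δ (p r.1) r.2)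
      (Ici 0 ×ˢ univ) :=
    (continuousOn_const.mul h.continuousOn).add
      (continuous_const.mul (hμ.comp continuous_snd)).continuousOn
  refine continuousOn_integral_Ici (h := fun t z => mix β V δ (p t) z * logRatio β V δ (p t) z) ?_
  refine ((Real.continuous_mul_log.comp_continuousOn hmix).sub (hmix.mul
    (((hV.muA hβ).log (muA_pos hV hβ)).continuous.comp continuous_snd).continuousOn)).congr
    fun r _ => ?_
  simp only [logRatio, mul_sub]
  rfl

end IsSolution

end EntropyFlow

/-! ### Gronwall's lemma and the choice of the Lyapunov functional -/

section Gronwall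

/-- The rate r may have either sign. The dependence on c may be crude, since c tends to zero at
fixed T in the application. -/
lemma gronwall_le {X X' : ℝ → ℝ} {r c T : ℝ} (hT : 0 ≤ T) (hc : 0 ≤ c)
    (hX : ContinuousOn X (Ici 0)) (hd : ∀ t, 0 < t → HasDerivAt X (X' t) t)
    (hle : ∀ t, 0 < t → X' t ≤ -r * X t + c) :
    X T ≤ Real.exp (-r * T) * (X 0 + c * Real.exp (|r| * T) * T) := by
  have hexp : ∀ t, HasDerivAt (fun t => Real.exp (r * t)) (Real.exp (r * t) * r) t := fun t => by
    simpa using ((hasDerivAt_id t).const_mul r).exp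
  have hder : ∀ t, 0 < t → HasDerivAt (fun t => Real.exp (r * t) * X t)
      (Real.exp (r * t) * r * X t + Real.exp (r * t) * X' t) t := fun t ht =>
    (hexp t).mul (hd t ht)
  have hint : interior (Icc 0 T) ⊆ Ioi 0 := by
    rw [interior_Icc]; exact fun t ht => ht.1
  have h1 := (convex_Icc 0 T).image_sub_le_mul_sub_of_deriv_le
    (f := fun t => Real.exp (r * t) * X t) (C := c * Real.exp (|r| * T))
    ((Continuous.continuousOn (by fun_prop)).mul (hX.mono Icc_subset_Ici_self))
    (fun t ht => (hder t (hint ht)).differentiableAt.differentiableWithinAt)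
    (fun t ht => by
      rw [(hder t (hint ht)).deriv]
      have h2 := hle t (hint ht)
      have h3 : Real.exp (r * t) ≤ Real.exp (|r| * T) := by
        refine Real.exp_le_exp.2 ((mul_le_mul_of_nonneg_right (le_abs_self r)
          (le_of_lt (hint ht))).trans (mul_le_mul_of_nonneg_left ?_ (abs_nonneg r)))
        rw [interior_Icc] at ht
        exact ht.2.le
      have h4 := mul_le_mul_of_nonneg_left h2 (Real.exp_pos (r * t)).le
      have h5 := mul_le_mul_of_nonneg_left h3 hc
      linarith) 0 (left_mem_Icc.2 hT) T (right_mem_Icc.2 hT) hT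
  simp only [mul_zero, Real.exp_zero, one_mul, sub_zero] at h1
  have h2 := mul_le_mul_of_nonneg_left h1 (Real.exp_pos (-r * T)).le
  rw [mul_sub, ← mul_assoc, ← Real.exp_add, show -r * T + r * T = 0 by ring, Real.exp_zero,
    one_mul] at h2
  linarith

/-- The weight κ must satisfy both 4π²K(1 + 1/ε) ≤ εκ and K(1 + 1/ε) ≤ 2β⁻¹κ. As κ is at least KM(1
+ 1/ε)², the first follows from M ≥ 4π² and the second from M ≥ β/2. Thus εκ has to be of order 1/ε,
which is the origin of the prefactor 1 + 1/ε². -/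
lemma entropy_decay_rate {β ρ ε K κ E N Y η P M : ℝ} (hβ : 0 < β) (hε : 0 < ε) (hK : 0 < K)
    (hM : M = 4 * Real.pi ^ 2 + β / 2) (hκ : κ = 2 * K * M * (1 + 1 / ε ^ 2)) (hE : 0 ≤ E)
    (hN : 0 ≤ N) (hY : 4 * Real.pi ^ 2 * N ≤ Y)
    (hP : P ≤ -(2 * ρ * β⁻¹ - ε) * E + K * (1 + 1 / ε) * Y + K * η) :
    P + κ * (-(2 * β⁻¹) * Y)
      ≤ -(min (8 * Real.pi ^ 2) (2 * ρ) * β⁻¹ - ε) * (E + κ * N) + K * η := by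
  have hβ' : 0 < β⁻¹ := inv_pos.2 hβ
  have hπ : 0 < Real.pi ^ 2 := by positivity
  have hM0 : 0 < M := by rw [hM]; positivity
  have hκ0 : 0 < κ := by rw [hκ]; positivity
  have hY0 : 0 ≤ Y := le_trans (by positivity) hY
  have hL1 : min (8 * Real.pi ^ 2) (2 * ρ) * β⁻¹ ≤ 8 * Real.pi ^ 2 * β⁻¹ :=
    mul_le_mul_of_nonneg_right (min_le_left _ _) hβ'.le
  have hL2 : min (8 * Real.pi ^ 2) (2 * ρ) * β⁻¹ ≤ 2 * ρ * β⁻¹ :=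
    mul_le_mul_of_nonneg_right (min_le_right _ _) hβ'.le
  set Λ := min (8 * Real.pi ^ 2) (2 * ρ) * β⁻¹
  have hκ1 : K * M * (1 + 1 / ε) ^ 2 ≤ κ := by
    have : 0 ≤ K * M * (1 - 1 / ε) ^ 2 := by positivity
    have e : 2 * K * M * (1 + 1 / ε ^ 2)
        = K * M * (1 + 1 / ε) ^ 2 + K * M * (1 - 1 / ε) ^ 2 := by
      field_simp; ring
    rw [hκ, e]; linarith
  have hM1 : 4 * Real.pi ^ 2 ≤ M := by rw [hM]; linarith
  have hM2 : β / 2 ≤ M := by rw [hM]; linarith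
  have hκ2 : K * (1 + 1 / ε) * (4 * Real.pi ^ 2) ≤ ε * κ := by
    have h1 := mul_le_mul_of_nonneg_left hκ1 hε.le
    have e : ε * (K * M * (1 + 1 / ε) ^ 2) = K * (1 + 1 / ε) * M * (1 + ε) := by
      field_simp; ring
    rw [e] at h1
    have h2 : K * (1 + 1 / ε) * (4 * Real.pi ^ 2) ≤ K * (1 + 1 / ε) * M :=
      mul_le_mul_of_nonneg_left hM1 (by positivity)
    have h3 : K * (1 + 1 / ε) * M ≤ K * (1 + 1 / ε) * M * (1 + ε) :=
      le_mul_of_one_le_right (by positivity) (by linarith)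
    linarith
  have hκ3 : K * (1 + 1 / ε) ≤ 2 * β⁻¹ * κ := by
    have h1 : K * (1 + 1 / ε) * (β / 2) ≤ κ := by
      have h2 : K * (1 + 1 / ε) * (β / 2) ≤ K * (1 + 1 / ε) * M :=
        mul_le_mul_of_nonneg_left hM2 (by positivity)
      have h4 : (0:ℝ) < 1 / ε := by positivity
      have h3 : K * (1 + 1 / ε) * M ≤ K * (1 + 1 / ε) * M * (1 + 1 / ε) :=
        le_mul_of_one_le_right (by positivity) (by linarith)
      nlinarith
    have h5 := mul_le_mul_of_nonneg_left h1 (show 0 ≤ 2 * β⁻¹ by positivity)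
    have e : 2 * β⁻¹ * (K * (1 + 1 / ε) * (β / 2)) = K * (1 + 1 / ε) := by field_simp
    linarith
  have hdiss : K * (1 + 1 / ε) * Y - 2 * β⁻¹ * κ * Y ≤ -(Λ - ε) * (κ * N) := by
    -- If Λ ≤ ε the right side is nonnegative, so it is enough that the dissipation of κN absorbs
    -- the gradient term. Otherwise that dissipation is split: a rate of 8π²β⁻¹ - ε is kept for N
    -- and the reserve ε absorbs the gradient term.
    rcases le_total Λ ε with h | h
    · have h1 := mul_le_mul_of_nonneg_right hκ3 hY0
      have h2 : 0 ≤ (ε - Λ) * (κ * N) := mul_nonneg (by linarith) (by positivity)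
      linarith
    · have h1 : (Λ - ε) * κ * (4 * Real.pi ^ 2 * N) ≤ (Λ - ε) * κ * Y :=
        mul_le_mul_of_nonneg_left hY (mul_nonneg (by linarith) hκ0.le)
      have h2 : (Λ - ε) * κ * Y ≤ (8 * Real.pi ^ 2 * β⁻¹ - ε) * κ * Y := by gcongr
      have h3 := mul_le_mul_of_nonneg_right hκ2 hY0
      have h4 : 4 * Real.pi ^ 2 * (K * (1 + 1 / ε) * Y - 2 * β⁻¹ * κ * Y)
          ≤ 4 * Real.pi ^ 2 * (-(Λ - ε) * (κ * N)) := by linarith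
      exact le_of_mul_le_mul_left h4 (by positivity)
  have hE2 : -(2 * ρ * β⁻¹ - ε) * E ≤ -(Λ - ε) * E :=
    mul_le_mul_of_nonneg_right (by linarith) hE
  linarith

end Gronwall

/-! ### Removal of the regularization, convergence and uniqueness -/

section Convergence

variable {m k : ℕ} {β : ℝ} {V : UnitAddTorus (Fin m ⊕ Fin k) → ℝ} {alg : Algorithm}

/-- Continuity of s ln s up to s = 0 allows δ to tend to zero even where p vanishes. -/
lemma continuous_mixEntropy (hV : C1 V) (hβ : 0 < β) {p : UnitAddTorus (Fin m ⊕ Fin k) → ℝ}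
    (hp : Continuous p) : Continuous fun δ => mixEntropy β V δ p := by
  have hμ := (hV.muA hβ).continuous
  have hlμ := ((hV.muA hβ).log (muA_pos hV hβ)).continuous
  have hmix : Continuous fun r : ℝ × UnitAddTorus (Fin m ⊕ Fin k) => mix β V r.1 p r.2 :=
    ((continuous_const.sub continuous_fst).mul (hp.comp continuous_snd)).add
      (continuous_fst.mul (hμ.comp continuous_snd))
  have h1 : Continuous (Function.uncurry fun (δ : ℝ) z => mix β V δ p z * logRatio β V δ p z) := by
    refine ((Real.continuous_mul_log.comp hmix).sub
      (hmix.mul (hlμ.comp continuous_snd))).congr fun r => ?_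
    simp only [Function.uncurry, logRatio, mul_sub]
    rfl
  have h2 := continuous_parametric_integral_of_continuous
    (μ := (volume : Measure (UnitAddTorus (Fin m ⊕ Fin k)))) h1 isCompact_univ
  simp only [Measure.restrict_univ] at h2
  exact h2

lemma mixEntropy_zero_eq (hV : C1 V) (hβ : 0 < β) {p : UnitAddTorus (Fin m ⊕ Fin k) → ℝ}
    (hp : Continuous p) (h1 : ∫ z, p z = 1) :
    mixEntropy β V 0 p = ∫ z, muA β V z * klFun (p z / muA β V z) := by
  have hμ := (hV.muA hβ).continuous
  have hlμ := ((hV.muA hβ).log (muA_pos hV hβ)).continuous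
  have e : ∀ z, muA β V z * klFun (p z / muA β V z)
      = mix β V 0 p z * logRatio β V 0 p z + (muA β V z - p z) := by
    intro z
    have hμz := (muA_pos hV hβ z).ne'
    have hm : mix β V 0 p z = p z := by simp [mix]
    rw [klFun_apply, logRatio, hm]
    -- Where p vanishes, the convention for the logarithm of zero is harmless because it is
    -- multiplied by zero; both sides equal μ_A.
    by_cases hz : p z = 0
    · simp [hz]
    · rw [Real.log_div hz hμz]
      field_simp
      ring
  have c1 : Continuous fun z => mix β V 0 p z * logRatio β V 0 p z := by
    have : Continuous fun z => p z * Real.log (p z) - p z * Real.log (muA β V z) :=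
      (Real.continuous_mul_log.comp hp).sub (hp.mul hlμ)
    refine this.congr fun z => ?_
    simp only [logRatio, mix, sub_zero, one_mul, zero_mul, add_zero]
    ring
  simp only [e]
  have c2 : Continuous fun z => muA β V z - p z := hμ.sub hp
  rw [integral_add (integrable_of_continuous c1) (integrable_of_continuous c2),
    integral_sub (integrable_of_continuous hμ) (integrable_of_continuous hp), h1,
    integral_muA hV hβ, sub_self, add_zero, mixEntropy]

lemma mixEntropy_zero_nonneg (hV : C1 V) (hβ : 0 < β) {p : UnitAddTorus (Fin m ⊕ Fin k) → ℝ}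
    (hp : Continuous p) (hp0 : ∀ z, 0 ≤ p z) (h1 : ∫ z, p z = 1) : 0 ≤ mixEntropy β V 0 p := by
  rw [mixEntropy_zero_eq hV hβ hp h1]
  exact integral_nonneg fun z => mul_nonneg (muA_pos hV hβ z).le
    (klFun_nonneg (div_nonneg (hp0 z) (muA_pos hV hβ z).le))

lemma klDiv_muA (hV : C1 V) (hβ : 0 < β) {p : UnitAddTorus (Fin m ⊕ Fin k) → ℝ}
    (hp : Continuous p) (hp0 : ∀ z, 0 ≤ p z) (h1 : ∫ z, p z = 1) :
    klDiv (densityMeasure p) (densityMeasure (muA β V)) = ENNReal.ofReal (mixEntropy β V 0 p) := by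
  rw [klDiv_densityMeasure hp (hV.muA hβ).continuous hp0 (muA_pos hV hβ),
    mixEntropy_zero_eq hV hβ hp h1]

lemma eq_muA_of_mixEntropy_nonpos (hV : C1 V) (hβ : 0 < β)
    {p : UnitAddTorus (Fin m ⊕ Fin k) → ℝ} (hp : Continuous p) (hp0 : ∀ z, 0 ≤ p z)
    (h1 : ∫ z, p z = 1) (h : mixEntropy β V 0 p ≤ 0) : p = muA β V := by
  have hμ := (hV.muA hβ).continuous
  have hc : Continuous fun z => muA β V z * klFun (p z / muA β V z) :=
    hμ.mul (continuous_klFun.comp (hp.div hμ fun z => (muA_pos hV hβ z).ne'))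
  have hnn : 0 ≤ fun z => muA β V z * klFun (p z / muA β V z) := fun z =>
    mul_nonneg (muA_pos hV hβ z).le (klFun_nonneg (div_nonneg (hp0 z) (muA_pos hV hβ z).le))
  rw [mixEntropy_zero_eq hV hβ hp h1] at h
  have h2 := (integral_eq_zero_iff_of_nonneg hnn (integrable_of_continuous hc)).1
    (le_antisymm h (integral_nonneg hnn))
  funext z
  have h3 : muA β V z * klFun (p z / muA β V z) = 0 :=
    congrFun ((hc.ae_eq_iff_eq _ continuous_const).1 h2) z
  have hμz := muA_pos hV hβ z
  have h4 := (klFun_eq_zero_iff (div_nonneg (hp0 z) hμz.le)).1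
    ((mul_eq_zero.1 h3).resolve_left hμz.ne')
  rwa [div_eq_one_iff_eq hμz.ne'] at h4

namespace IsSolution

variable {p : ℝ → UnitAddTorus (Fin m ⊕ Fin k) → ℝ} {B : ℝ → UnitAddTorus (Fin m) → Fin m → ℝ}
  (h : IsSolution alg β (gradForce V) p B)

include h

lemma poincare_marginal {t : ℝ} (ht : 0 < t) :
    4 * Real.pi ^ 2 * ∫ x, (marginal (p t) x - 1) ^ 2
      ≤ ∫ x, ∑ i, pd i (marginal (p t)) x ^ 2 := by
  have hS := (h.c1 ht).marginal
  have hu : C1 fun x => marginal (p t) x - 1 := hS.sub (C1.const _)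
  have h1 := hu.poincare (by
    rw [integral_sub (integrable_of_continuous hS.continuous) (integrable_const _),
      h.mass_marginal ht.le]
    simp)
  simpa only [hS.pd_sub (C1.const _), pd_const, sub_zero] using h1

/-- Exponential decay of the relative entropy. -/
lemma exists_mixEntropy_le (hV : C1 V) (hβ : 0 < β) {ρ : ℝ} (hρ : 0 < ρ)
    (hlsi : ∀ x : UnitAddTorus (Fin m), LSI (densityMeasure (condMuA β V x)) ρ)
    (hpos : ∀ x, 0 < marginal (p 0) x) :
    ∃ K : ℝ, 0 < K ∧ ∀ ε : ℝ, 0 < ε → ∀ t : ℝ, 0 ≤ t →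
      mixEntropy β V 0 (p t) ≤ K * (1 + 1 / ε ^ 2)
        * Real.exp (-(min (8 * Real.pi ^ 2) (2 * ρ) * β⁻¹ - ε) * t) := by
  have hc0 := h.continuous_density le_rfl
  obtain ⟨a, ha, ha0⟩ : ∃ a : ℝ, 0 < a ∧ ∀ x, a ≤ marginal (p 0) x := by
    have hc := continuous_marginal hc0
    obtain ⟨C, hC0, hC⟩ := exists_bound_of_continuous (hc.inv₀ fun x => (hpos x).ne')
    refine ⟨C⁻¹, inv_pos.2 hC0, fun x => ?_⟩
    have hx := hC x
    rw [Pi.inv_apply, abs_of_pos (inv_pos.2 (hpos x))] at hx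
    exact inv_le_of_inv_le₀ (hpos x) hx
  obtain ⟨K, hK, hprod⟩ := exists_production_le (k := k) hV hβ hρ hlsi ha
  set M := 4 * Real.pi ^ 2 + β / 2 with hM
  have hM0 : 0 < M := by rw [hM]; positivity
  set N : ℝ → ℝ := fun t => ∫ x, (marginal (p t) x - 1) ^ 2 with hNdef
  have hN : ∀ t, 0 ≤ N t := fun t => integral_nonneg fun x => sq_nonneg _
  have hE0 : 0 ≤ mixEntropy β V 0 (p 0) :=
    mixEntropy_zero_nonneg hV hβ hc0 (h.nonneg 0 le_rfl) (h.mass 0 le_rfl)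
  -- The constant must not depend on ε. Only κ does, through 1 + 1/ε², so the initial value E + κN
  -- is bounded by this constant times 1 + 1/ε²; the final 1 ensures positivity.
  refine ⟨mixEntropy β V 0 (p 0) + 2 * K * M * N 0 + 1, by have := hN 0; positivity,
    fun ε hε T hT => ?_⟩
  set κ := 2 * K * M * (1 + 1 / ε ^ 2) with hκ
  have hκ0 : 0 < κ := by rw [hκ]; positivity
  set r := min (8 * Real.pi ^ 2) (2 * ρ) * β⁻¹ - ε with hr
  have hreg : ∀ η : ℝ, 0 < η → η ≤ 1 / 2 → ∀ t, 0 < t → RegularDensity β V (η ^ 2) a (p t) :=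
    fun η hη hη1 t ht =>
    { beta_pos := hβ
      potential := hV
      c1 := h.c1 ht
      nonneg := h.nonneg t ht.le
      mass := h.mass t ht.le
      delta_pos := by positivity
      delta_le := by nlinarith
      lower_pos := ha
      lower := fun x => h.le_marginal hV hβ ha0 ht.le x }
  have key : ∀ η : ℝ, 0 < η → η ≤ 1 / 2 → η ≤ 2 * β⁻¹ →
      mixEntropy β V (η ^ 2) (p T) + κ * N T ≤ Real.exp (-r * T)
        * ((mixEntropy β V (η ^ 2) (p 0) + κ * N 0) + K * η * Real.exp (|r| * T) * T) := by
    intro η hη hη1 hηβ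
    refine gronwall_le (X := fun t => mixEntropy β V (η ^ 2) (p t) + κ * N t) hT (by positivity)
      ((h.continuousOn_mixEntropy hV hβ).add (continuousOn_const.mul
        (h.continuousOn_integral_comp_marginal (Φ := fun s => (s - 1) ^ 2) (by fun_prop))))
      (fun t ht => (h.hasDerivAt_mixEntropy hV hβ (by positivity) (by nlinarith) ht).add
        ((h.hasDerivAt_integral_sq hV ht).const_mul κ)) fun t ht => ?_
    exact entropy_decay_rate hβ hε hK hM hκ (hreg η hη hη1 t ht).mixEntropy_nonneg (hN t)
      (h.poincare_marginal ht) (hprod alg (p t) (B t) η ε hη hηβ hε (hreg η hη hη1 t ht)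
        (h.bias t ht.le))
  have hlim : ∀ {q : UnitAddTorus (Fin m ⊕ Fin k) → ℝ}, Continuous q →
      Tendsto (fun η : ℝ => mixEntropy β V (η ^ 2) q) (𝓝[>] 0) (𝓝 (mixEntropy β V 0 q)) := by
    intro q hq
    have := ((continuous_mixEntropy hV hβ hq).comp (continuous_pow 2)).tendsto (0:ℝ)
    simp only [Function.comp_def, ne_eq, OfNat.ofNat_ne_zero, not_false_eq_true, zero_pow] at this
    exact this.mono_left nhdsWithin_le_nhds
  have hid : Tendsto (fun η : ℝ => η) (𝓝[>] 0) (𝓝 0) := tendsto_id.mono_left nhdsWithin_le_nhds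
  -- At fixed T and ε, η tends to zero: the error Kη in Gronwall's lemma disappears and the
  -- entropies converge to those of p itself.
  have hfin := le_of_tendsto_of_tendsto ((hlim (h.continuous_density hT)).add_const (κ * N T))
    ((((hlim hc0).add_const (κ * N 0)).add (((hid.const_mul K).mul_const
      (Real.exp (|r| * T))).mul_const T)).const_mul (Real.exp (-r * T))) (by
      have h1 : ∀ᶠ η : ℝ in 𝓝[>] 0, η < 1 / 2 :=
        nhdsWithin_le_nhds (gt_mem_nhds (by norm_num))
      have h2 : ∀ᶠ η : ℝ in 𝓝[>] 0, η < 2 * β⁻¹ :=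
        nhdsWithin_le_nhds (gt_mem_nhds (by positivity))
      filter_upwards [h1, h2, self_mem_nhdsWithin] with η h1 h2 h3
      exact key η h3 h1.le h2.le)
  have hNT := mul_nonneg hκ0.le (hN T)
  have hexp := Real.exp_pos (-r * T)
  have hbound : mixEntropy β V 0 (p 0) + κ * N 0
      ≤ (mixEntropy β V 0 (p 0) + 2 * K * M * N 0 + 1) * (1 + 1 / ε ^ 2) := by
    have h1 : 0 ≤ 1 / ε ^ 2 := by positivity
    have h2 : 0 ≤ mixEntropy β V 0 (p 0) * (1 / ε ^ 2) := by positivity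
    rw [hκ]
    nlinarith
  have h3 := mul_le_mul_of_nonneg_left hbound hexp.le
  simp only [mul_zero, zero_mul, add_zero] at hfin
  linarith

end IsSolution

/-- The pair `(μ_A, ∇A)` is the only stationary state. -/
lemma IsStationary.eq_muA {p : UnitAddTorus (Fin m ⊕ Fin k) → ℝ}
    {B : UnitAddTorus (Fin m) → Fin m → ℝ} (hV : C1 V) (hβ : 0 < β)
    (h : IsStationary alg β (gradForce V) p B) :
    p = muA β V ∧ B =ᵐ[volume] gradFreeEnergy β V := by
  have hs : IsSolution alg β (gradForce V) (fun _ => p) (fun _ => B) := h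
  have hp := hs.continuous_density le_rfl
  have hp0 := hs.nonneg 0 le_rfl
  have hmass := hs.mass 0 le_rfl
  -- For a stationary state N is constant in time, so its dissipation vanishes. Poincaré's
  -- inequality then makes the marginal uniform, hence positive, as the decay estimate requires.
  have hY : ∫ x, ∑ i, pd i (marginal p) x ^ 2 = 0 := by
    have h1 := (hs.hasDerivAt_integral_sq hV one_pos).unique (hasDerivAt_const 1 _)
    rcases mul_eq_zero.1 h1 with h2 | h2
    · have : 0 < 2 * β⁻¹ := by positivity
      linarith
    · exact h2
  have hS : ∀ x, marginal p x = 1 := by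
    have hc : Continuous fun x => (marginal p x - 1) ^ 2 :=
      ((continuous_marginal hp).sub continuous_const).pow 2
    have hnn : 0 ≤ fun x => (marginal p x - 1) ^ 2 := fun x => sq_nonneg _
    have h1 := hs.poincare_marginal one_pos
    rw [hY] at h1
    have h2 : ∫ x, (marginal p x - 1) ^ 2 ≤ 0 :=
      nonpos_of_mul_nonpos_right h1 (by positivity)
    have h3 := (integral_eq_zero_iff_of_nonneg hnn (integrable_of_continuous hc)).1
      (le_antisymm h2 (integral_nonneg hnn))
    intro x
    have h4 : (marginal p x - 1) ^ 2 = 0 :=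
      congrFun ((hc.ae_eq_iff_eq _ continuous_const).1 h3) x
    have := pow_eq_zero_iff two_ne_zero |>.1 h4
    linarith
  obtain ⟨ρ, hρ, hlsi⟩ := exists_lsi_condMuA hV hβ
  obtain ⟨K, hK, hdecay⟩ := hs.exists_mixEntropy_le hV hβ hρ hlsi
    (fun x => by rw [hS x]; exact one_pos)
  have hΛ : 0 < min (8 * Real.pi ^ 2) (2 * ρ) * β⁻¹ := by positivity
  set Λ := min (8 * Real.pi ^ 2) (2 * ρ) * β⁻¹
  -- The entropy does not depend on t, and the decay estimate with ε = Λ/2 bounds it by a quantity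
  -- tending to zero.
  have hle : mixEntropy β V 0 p ≤ 0 := by
    have hlim : Tendsto (fun t : ℝ => K * (1 + 1 / (Λ / 2) ^ 2)
        * Real.exp (-(Λ - Λ / 2) * t)) atTop (𝓝 (K * (1 + 1 / (Λ / 2) ^ 2) * 0)) := by
      refine Tendsto.const_mul _ (Real.tendsto_exp_atBot.comp ?_)
      exact tendsto_id.const_mul_atTop_of_neg (by linarith)
    rw [mul_zero] at hlim
    refine ge_of_tendsto hlim ?_
    filter_upwards [eventually_ge_atTop 0] with t ht
    exact hdecay (Λ / 2) (by positivity) t ht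
  have hpμ := eq_muA_of_mixEntropy_nonpos hV hβ hp hp0 hmass hle
  refine ⟨hpμ, ?_⟩
  have hb := hs.bias 0 le_rfl
  simp only [hpμ, meanForce_muA hV hβ] at hb
  exact hb.ae_eq_of_gradient (hV.freeEnergy β)

/-- The argument yields 8π² in both cases, since the projected drift also drops out of the
dissipation of the marginal; the PABF rate with 4π² follows a fortiori. -/
lemma rate_le (alg : Algorithm) {β ρ : ℝ} (hβ : 0 < β) :
    rate alg β ρ ≤ min (8 * Real.pi ^ 2) (2 * ρ) * β⁻¹ := by
  cases alg with
  | abf => exact le_rfl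
  | pabf =>
    exact mul_le_mul_of_nonneg_right (min_le_min_right _ (by nlinarith [sq_nonneg Real.pi]))
      (inv_pos.2 hβ).le

end Convergence

end ABF

end

theorem mainTheorem3 (m k : ℕ) (hm : 1 ≤ m) (β : ℝ) (hβ : 0 < β)
    (V : UnitAddTorus (Fin m ⊕ Fin k) → ℝ) (hV : ABF.IsC 2 V) (alg : ABF.Algorithm) :
    -- the conditional measures of `μ_A` satisfy a common log-Sobolev inequality
    (∃ ρ : ℝ, 0 < ρ ∧
      ∀ x : UnitAddTorus (Fin m), ABF.LSI (ABF.densityMeasure (ABF.condMuA β V x)) ρ) ∧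
    -- convergence in relative entropy, for every log-Sobolev constant `ρ` of these measures
    (∀ ρ : ℝ, 0 < ρ →
      (∀ x : UnitAddTorus (Fin m), ABF.LSI (ABF.densityMeasure (ABF.condMuA β V x)) ρ) →
      ∀ (p : ℝ → UnitAddTorus (Fin m ⊕ Fin k) → ℝ) (B : ℝ → UnitAddTorus (Fin m) → Fin m → ℝ),
        ABF.IsSolution alg β (ABF.gradForce V) p B →
        ABF.IsC ∞ (p 0) → (∀ x, 0 < ABF.marginal (p 0) x) →
        ∃ K : ℝ, 0 < K ∧ ∀ ε : ℝ, 0 < ε → ∀ t : ℝ, 0 ≤ t →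
          InformationTheory.klDiv (ABF.densityMeasure (p t)) (ABF.densityMeasure (ABF.muA β V))
            ≤ ENNReal.ofReal
                (K * (1 + 1 / ε ^ 2) * Real.exp (- (ABF.rate alg β ρ - ε) * t))) ∧
    -- `(μ_A, ∇A)` is a stationary state, and the only one
    ABF.IsStationary alg β (ABF.gradForce V) (ABF.muA β V) (ABF.gradFreeEnergy β V) ∧
    (∀ (p : UnitAddTorus (Fin m ⊕ Fin k) → ℝ) (B : UnitAddTorus (Fin m) → Fin m → ℝ),
      ABF.IsStationary alg β (ABF.gradForce V) p B →
        p = ABF.muA β V ∧ B =ᵐ[volume] ABF.gradFreeEnergy β V) := by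
  have hV1 : ABF.C1 V := (hV.of_le (by norm_num)).c1
  refine ⟨ABF.exists_lsi_condMuA hV1 hβ, ?_, ABF.isStationary_muA hV1 hβ alg,
    fun p B h => h.eq_muA hV1 hβ⟩
  intro ρ hρ hlsi p B h _ hpos
  obtain ⟨K, hK, hdecay⟩ := h.exists_mixEntropy_le hV1 hβ hρ hlsi hpos
  refine ⟨K, hK, fun ε hε t ht => ?_⟩
  rw [ABF.klDiv_muA hV1 hβ (h.continuous_density ht) (h.nonneg t ht) (h.mass t ht)]
  -- The decay was obtained at a rate at least `rate alg β ρ`, so for t ≥ 0 the exponential can only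
  -- grow when the rate is replaced.
  refine ENNReal.ofReal_le_ofReal ((hdecay ε hε t ht).trans
    (mul_le_mul_of_nonneg_left (Real.exp_le_exp.2 ?_) (by positivity)))
  exact mul_le_mul_of_nonneg_right (by linarith [ABF.rate_le alg (ρ := ρ) hβ]) ht
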